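/- **Setting.** Let $d\in\{2,3\}$. For $j=1,\dots,d$ let $p_j\ge 3$ be odd, $n_j\ge 1$, and let $T_j^0=(t_{j,1},\dots,t_{j,n_j+p_j+1})$ be an open knot vector with $t_{j,1}=\dots=t_{j,p_j+1}=0$, $t_{j,n_j+1}=\dots=t_{j,n_j+p_j+1}=1$ and $t_{j,i}<t_{j,i+1}$ for $p_j+1\le i\le n_j$. For dyadic rational $r$ between consecutive integers $i$ and $i+1$, $p_j+1\le i\le n_j$, the knots $t_{j,r}$ are defined by successive averaging, $t_{j,r}=\frac12(t_{j,r-2^{-k}}+t_{j,r+2^{-k}})$ for every index $r$ that is new at stage $k$ (i.e. an odd multiple of $2^{-k}$). **Index T-meshes.** Elements are open boxes $\check Q=\prod_j(a_j,b_j)$ carrying a level $\mathrm{lev}(\check Q)\in\mathbb N_0$ (equal boxes with different levels are distinguished). The initial index mesh $\check{\mathcal Q}_0$ consists of all boxes $\prod_j(l_j,l_j+1)$ with integers $1\le l_j\le n_j+p_j$, at level $0$. An element of level $\ell$ is bisected in direction $s=(\ell \bmod d)+1$: if $t_{s,a_s}\ne t_{s,b_s}$ it is replaced by its two halves in direction $s$,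 otherwise its box is kept; in both cases the level becomes $\ell+1$. Let $\check\Omega_{\rm ip}=\prod_j(p_j+1,n_j+1)$ and let $\mathbf x_{\check Q}$ be the midpoint of $\check Q$. The parametric image of $\check Q$ is $\prod_j(t_{j,a_j},t_{j,b_j})$, and the parametric T-mesh of an index T-mesh is the set of parametric images of its elements that have nonzero measure. **Admissible refinement.** For $d=2$ put $\mathbf D(k)=2^{-k/2}\left(\lfloor \frac{p_1}2\rfloor+\frac12,\lceil\frac{p_2}2\rceil+\frac12\right)$ for even $k$ and $\mathbf D(k)=2^{-(k+1)/2}\left(\lceil \frac{p_1}2\rceil+\frac12,2\lfloor\frac{p_2}2\rfloor+1\right)$ for odd $k$. For $d=3$ put $\mathbf D(k)_j=2^{-\lfloor k/3\rfloor}(p_j+\frac32)\,c_j$, with $c_j=\frac12$ if $j\le k \bmod 3$ and $c_j=1$ otherwise. For $\check Q\subseteq\check\Omega_{\rm ip}$ in an index mesh $\check{\mathcal Q}$, its neighbors are the $\check Q'\in\check{\mathcal Q}$ with $\check Q'\subseteq\check\Omega_{\rm ip}$ and $\mathrm{lev}(\check Q')<\mathrm{lev}(\check Q)$ that contain a point $x$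 with $|x_j-(\mathbf x_{\check Q})_j|<\mathbf D(\mathrm{lev}(\check Q))_j$ for all $j$. One refinement step takes an arbitrary set of marked elements of the current parametric T-mesh, passes to the corresponding index elements, adds neighbors of marked elements until no new ones occur, then adds all $\check Q'\in\check{\mathcal Q}$ such that the projection of $\mathbf x_{\check Q'}$ to $\overline{\check\Omega_{\rm ip}}$ (coordinatewise $\min(\max(x_j,p_j+1),n_j+1)$) lies on $\partial\check Q$ for some marked $\check Q$, and finally bisects all marked elements simultaneously. The parametric T-mesh $\hat{\mathcal Q}$ of an index T-mesh $\check{\mathcal Q}$ obtained from $\check{\mathcal Q}_0$ by finitely many such steps is called admissible. **Bézier elements.** The anchors of $\check{\mathcal Q}$ are the vertices $z$ of its elements with $\lceil p_j/2\rceil+1\le z_j\le n_j+p_j+1-\lceil p_j/2\rceil$ for all $j$. The global index vector of $z$ in direction $j$ is the set of all $s\in[1,n_j+p_j+1]$ such that $(z_1,\dots,z_{j-1},s,z_{j+1},\dots,z_d)$ lies on a closed face, orthogonal to direction $j$, of some element of $\check{\mathcal Q}$; the local index vector consists of its $p_j+2$ consecutive entries with $z_j$ in the middle position. The blending function of $z$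 is $\hat B_z(x)=\prod_j \hat B[T_j(z)](x_j)$, where $\hat B[T_j(z)]$ is the (Cox–de Boor) B-spline of degree $p_j$ on the knots $t_{j,r}$ with $r$ in the local index vector. A Bézier element is a maximal open set $U\subseteq(0,1)^d$ such that, for every anchor $z$, the restriction $\hat B_z|_U$ is a polynomial of degree at most $p_j$ in the $j$-th variable, $j=1,\dots,d$. **Claim.** Let $\hat{\mathcal Q}$ be an admissible parametric T-mesh and $\hat Q\in\hat{\mathcal Q}$. Then either $\hat Q$ is itself a Bézier element and the only one that meets $\hat Q$, or exactly two Bézier elements $B_1\ne B_2$ meet $\hat Q$, and these satisfy $B_1,B_2\subseteq\hat Q$, $B_1\cap B_2=\emptyset$, $\overline{B_1\cup B_2}=\overline{\hat Q}$ and $|B_1|=|B_2|=|\hat Q|/2$. -/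

import Mathlib

open MeasureTheory

noncomputable section

namespace TSpline

/-! ### Knots, index domain, index elements -/

/-- Degrees, numbers of univariate functions and initial open knot vectors
`T_j = (t_{j,1}, …, t_{j,n_j+p_j+1})` in each direction. Knots are indexed from `1`; values of
`knot j i` for `i` outside `1, …, n j + p j + 1` are irrelevant. The first and last knots are
repeated exactly `p j + 1` times, and the internal knots are not repeated. -/
structure Data (d : ℕ) where
  /-- polynomial degrees -/
  p : Fin d → ℕ
  /-- numbers of univariate B-splines -/
  n : Fin d → ℕ
  /-- initial knots -/
  knot : Fin d → ℕ → ℝ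
  p_odd : ∀ j, Odd (p j)
  three_le_p : ∀ j, 3 ≤ p j
  n_pos : ∀ j, 0 < n j
  knot_left : ∀ j i, 1 ≤ i → i ≤ p j + 1 → knot j i = 0
  knot_right : ∀ j i, n j + 1 ≤ i → i ≤ n j + p j + 1 → knot j i = 1
  knot_lt : ∀ j i, p j + 1 ≤ i → i ≤ n j → knot j i < knot j (i + 1)

/-- An element of an index T-mesh: the open hyperrectangle `∏ (lo j, hi j)`, together with its
level. Equal boxes with different levels are distinguished. -/
@[ext]
structure Elem (d : ℕ) where
  /-- lower corner -/
  lo : Fin d → ℝ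
  /-- upper corner -/
  hi : Fin d → ℝ
  /-- level -/
  level : ℕ

variable {d : ℕ}

/-- The open hyperrectangle underlying an element. -/
def Elem.box (e : Elem d) : Set (Fin d → ℝ) :=
  Set.univ.pi fun j => Set.Ioo (e.lo j) (e.hi j)

/-- The middle point of an element. -/
def Elem.mid (e : Elem d) : Fin d → ℝ := fun j => (e.lo j + e.hi j) / 2

/-- The knot `t_{j,r}` at a rational index `r`. At natural numbers it is the initial knot; the
dyadic refinement of the knot vectors by midpoints makes it the linear interpolation between two
consecutive natural numbers, see `knotAt_natCast` and `knotAt_dyadic`. -/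
def Data.knotAt (D : Data d) (j : Fin d) (r : ℝ) : ℝ :=
  D.knot j ⌊r⌋₊ + (r - ⌊r⌋₊) * (D.knot j (⌊r⌋₊ + 1) - D.knot j ⌊r⌋₊)

theorem Data.knotAt_natCast (D : Data d) (j : Fin d) (i : ℕ) :
    D.knotAt j (i : ℝ) = D.knot j i := by
  simp [Data.knotAt]

theorem Data.knotAt_eq (D : Data d) (j : Fin d) (i : ℕ) (r : ℝ) (h₁ : (i : ℝ) ≤ r)
    (h₂ : r ≤ i + 1) :
    D.knotAt j r = D.knot j i + (r - i) * (D.knot j (i + 1) - D.knot j i) := by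
  rcases h₂.lt_or_eq with h | h
  · have hf : ⌊r⌋₊ = i := (Nat.floor_eq_iff ((Nat.cast_nonneg i).trans h₁)).2 ⟨h₁, h⟩
    simp [Data.knotAt, hf]
  · have h' : r = ((i + 1 : ℕ) : ℝ) := by push_cast; exact h
    rw [h', D.knotAt_natCast]
    push_cast
    ring

/-- The recursion for the knots at stage `k`: the knot at a new index `i + m / 2 ^ k` is the
average of the knots at the two adjacent indices of the stage. -/
theorem Data.knotAt_dyadic (D : Data d) (j : Fin d) (i k m : ℕ) (hm : 1 ≤ m)
    (hm' : m + 1 ≤ 2 ^ k) :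
    D.knotAt j (i + m / 2 ^ k) =
      (D.knotAt j (i + m / 2 ^ k - 1 / 2 ^ k) + D.knotAt j (i + m / 2 ^ k + 1 / 2 ^ k)) / 2 := by
  have hp : (0 : ℝ) < 2 ^ k := by positivity
  have h1 : (1 : ℝ) / 2 ^ k ≤ m / 2 ^ k := by
    have : (1 : ℝ) ≤ m := by exact_mod_cast hm
    gcongr
  have h2 : (m : ℝ) / 2 ^ k + 1 / 2 ^ k ≤ 1 := by
    rw [← add_div, div_le_one hp]
    exact_mod_cast hm'
  have h3 : (0 : ℝ) < 1 / 2 ^ k := by positivity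
  rw [D.knotAt_eq j i _ (by linarith) (by linarith), D.knotAt_eq j i _ (by linarith) (by linarith),
    D.knotAt_eq j i _ (by linarith) (by linarith)]
  ring

/-- The index/parametric domain `∏ (p_j + 1, n_j + 1)`. -/
def Data.ipDomain (D : Data d) : Set (Fin d → ℝ) :=
  Set.univ.pi fun j => Set.Ioo ((D.p j : ℝ) + 1) ((D.n j : ℝ) + 1)

/-- The parametric domain `(0,1)^d`. -/
def paramDomain (d : ℕ) : Set (Fin d → ℝ) :=
  Set.univ.pi fun _ => Set.Ioo 0 1

/-- The initial index T-mesh: all unit cells of the index domain, at level zero. -/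
def Data.initialMesh (D : Data d) : Set (Elem d) :=
  {e | e.level = 0 ∧ ∃ l : Fin d → ℕ, (∀ j, 1 ≤ l j ∧ l j ≤ D.n j + D.p j) ∧
    ∀ j, e.lo j = l j ∧ e.hi j = l j + 1}

/-! ### Bisection -/

/-- The direction in which elements of level `ℓ` are bisected (directions are numbered from
zero). -/
def dir (d : ℕ) [NeZero d] (ℓ : ℕ) : Fin d :=
  ⟨ℓ % d, Nat.mod_lt _ (NeZero.pos d)⟩

/-- Bisection of an element in the direction given by its level. An element with coinciding
end knots in this direction keeps its box. The level always increases by one. -/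
def Data.bisect (D : Data d) [NeZero d] (e : Elem d) : Set (Elem d) :=
  let j := dir d e.level
  {e' | (D.knotAt j (e.lo j) ≠ D.knotAt j (e.hi j) ∧
      (e' = ⟨e.lo, Function.update e.hi j ((e.lo j + e.hi j) / 2), e.level + 1⟩ ∨
        e' = ⟨Function.update e.lo j ((e.lo j + e.hi j) / 2), e.hi, e.level + 1⟩)) ∨
    (D.knotAt j (e.lo j) = D.knotAt j (e.hi j) ∧ e' = ⟨e.lo, e.hi, e.level + 1⟩)}

/-! ### The parametric T-mesh -/

/-- The parametric image `∏ (t_{j,a_j}, t_{j,b_j})` of the index element `∏ (a_j, b_j)`. -/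
def Data.paramImage (D : Data d) (e : Elem d) : Set (Fin d → ℝ) :=
  Set.univ.pi fun j => Set.Ioo (D.knotAt j (e.lo j)) (D.knotAt j (e.hi j))

/-- The parametric T-mesh of an index T-mesh: the parametric images of nonzero measure. -/
def Data.paramMesh (D : Data d) (Q : Set (Elem d)) : Set (Set (Fin d → ℝ)) :=
  {E | volume E ≠ 0 ∧ ∃ e ∈ Q, E = D.paramImage e}

/-! ### Admissible refinement -/

/-- The vector `𝐃_𝐩(k)` which gives the extent of the generalized neighborhood of an element of
level `k`, for `d = 2` and for `d = 3`. (Only these two dimensions are used.) Divisions of natural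
numbers round down, so `p / 2` and `(p + 1) / 2` are the floor and the ceiling of half of `p`. -/
def Data.nbhdRadius (D : Data d) (k : ℕ) (j : Fin d) : ℝ :=
  if d = 2 then
    if k % 2 = 0 then
      1 / 2 ^ (k / 2) *
        (if j.val = 0 then ((D.p j / 2 : ℕ) : ℝ) + 1 / 2 else (((D.p j + 1) / 2 : ℕ) : ℝ) + 1 / 2)
    else
      1 / 2 ^ ((k + 1) / 2) *
        (if j.val = 0 then (((D.p j + 1) / 2 : ℕ) : ℝ) + 1 / 2 else 2 * ((D.p j / 2 : ℕ) : ℝ) + 1)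
  else
    1 / 2 ^ (k / 3) *
      (if j.val < k % 3 then ((D.p j : ℝ) + 3 / 2) / 2 else (D.p j : ℝ) + 3 / 2)

/-- Generalized neighbors of `e` in the index T-mesh `Q` (for `e` inside the index/parametric
domain). -/
def Data.genNeighbors (D : Data d) (Q : Set (Elem d)) (e : Elem d) : Set (Elem d) :=
  {e' | e' ∈ Q ∧ e'.box ⊆ D.ipDomain ∧
    ∃ x ∈ e'.box, ∀ j, |x j - e.mid j| < D.nbhdRadius e.level j}

/-- Neighbors: the generalized neighbors of smaller level. -/
def Data.neighbors (D : Data d) (Q : Set (Elem d)) (e : Elem d) : Set (Elem d) :=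
  {e' | e' ∈ D.genNeighbors Q e ∧ e'.level < e.level}

/-- Projection of a point to the closure of the index/parametric domain. -/
def Data.proj (D : Data d) (x : Fin d → ℝ) : Fin d → ℝ :=
  fun j => min (max (x j) ((D.p j : ℝ) + 1)) ((D.n j : ℝ) + 1)

/-- Boundary prolongation of a set `M` of elements in the index T-mesh `Q`. -/
def Data.boundaryProlongation (D : Data d) (Q M : Set (Elem d)) : Set (Elem d) :=
  {e' | e' ∈ Q ∧ ∃ e ∈ M, D.proj e'.mid ∈ frontier e.box}

/-- One pass of the marking loop: add all neighbors of marked elements. -/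
def Data.markStep (D : Data d) (Q M : Set (Elem d)) : Set (Elem d) :=
  M ∪ {e' | e' ∈ Q ∧ ∃ e ∈ M, e' ∈ D.neighbors Q e}

/-- Result of the marking loop. -/
def Data.markClosure (D : Data d) (Q M : Set (Elem d)) : Set (Elem d) :=
  ⋃ k : ℕ, (D.markStep Q)^[k] M

/-- All elements to be bisected: result of the marking loop and its boundary prolongation. -/
def Data.markAll (D : Data d) (Q M : Set (Elem d)) : Set (Elem d) :=
  D.markClosure Q M ∪ D.boundaryProlongation Q (D.markClosure Q M)

/-- Admissible refinement of the index T-mesh `Q` with marked elements `M`. -/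
def Data.refineIndex (D : Data d) [NeZero d] (Q M : Set (Elem d)) : Set (Elem d) :=
  (Q \ D.markAll Q M) ∪ ⋃ e ∈ D.markAll Q M, D.bisect e

/-- The index elements whose parametric image lies in `M`. -/
def Data.indexPreimage (D : Data d) (Q : Set (Elem d)) (M : Set (Set (Fin d → ℝ))) :
    Set (Elem d) :=
  {e | e ∈ Q ∧ D.paramImage e ∈ M}

/-- The index T-meshes obtained from the initial one by finitely many calls of the refinement
algorithm, each with an arbitrary set `M` of marked elements of the current parametric T-mesh.
Their parametric T-meshes `D.paramMesh Q` are the admissible parametric T-meshes. -/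
inductive Data.IsAdmissible (D : Data d) [NeZero d] : Set (Elem d) → Prop
  | init : D.IsAdmissible D.initialMesh
  | refine (Q : Set (Elem d)) (M : Set (Set (Fin d → ℝ))) (hQ : D.IsAdmissible Q)
      (hM : M ⊆ D.paramMesh Q) : D.IsAdmissible (D.refineIndex Q (D.indexPreimage Q M))

/-! ### Blending functions -/

/-- B-splines of degree `k` by the Cox–de Boor recursion on the knots `τ 0, τ 1, …`; quotients
with zero denominator are zero. -/
def bspline (τ : ℕ → ℝ) : ℕ → ℕ → ℝ → ℝ
  | 0, i, t => if τ i ≤ t ∧ t < τ (i + 1) then 1 else 0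
  | k + 1, i, t =>
      (t - τ i) / (τ (i + k + 1) - τ i) * bspline τ k i t +
        (τ (i + k + 2) - t) / (τ (i + k + 2) - τ (i + 1)) * bspline τ k (i + 1) t

/-- The anchors: vertices of elements which lie in the closure of the active region. For odd `p`,
the number `(p + 1) / 2` is the ceiling of half of `p`. -/
def Data.anchors (D : Data d) (Q : Set (Elem d)) : Set (Fin d → ℝ) :=
  {z | (∀ j, (((D.p j + 1) / 2 : ℕ) : ℝ) + 1 ≤ z j ∧
      z j ≤ (D.n j : ℝ) + D.p j + 1 - (((D.p j + 1) / 2 : ℕ) : ℝ)) ∧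
    ∃ e ∈ Q, ∀ j, z j = e.lo j ∨ z j = e.hi j}

/-- The skeleton of an index T-mesh in direction `j`: the union of the closed faces of the
elements orthogonal to direction `j`. -/
def skeleton (Q : Set (Elem d)) (j : Fin d) : Set (Fin d → ℝ) :=
  {x | ∃ e ∈ Q, (x j = e.lo j ∨ x j = e.hi j) ∧
    ∀ i, i ≠ j → x i ∈ Set.Icc (e.lo i) (e.hi i)}

/-- The global index vector of `z` in direction `j` (a finite set for the meshes used here). -/
def Data.globalIndex (D : Data d) (Q : Set (Elem d)) (z : Fin d → ℝ) (j : Fin d) : Set ℝ :=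
  {s | s ∈ Set.Icc (1 : ℝ) ((D.n j : ℝ) + D.p j + 1) ∧ Function.update z j s ∈ skeleton Q j}

/-- The local index vector of `z` in direction `j`: the `p + 2` consecutive entries, numbered
`0, …, p + 1`, of the global index vector which have `z j` in the middle position `(p + 1) / 2`.
The other entries are reached from `z j` by moving to the next smaller or the next larger entry of
the global index vector. (Values for `i > p + 1` are irrelevant.) -/
def Data.localIndex (D : Data d) (Q : Set (Elem d)) (z : Fin d → ℝ) (j : Fin d) (i : ℕ) : ℝ :=
  let G := D.globalIndex Q z j
  let c := (D.p j + 1) / 2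
  if c ≤ i then (fun s => sInf {r | r ∈ G ∧ s < r})^[i - c] (z j)
  else (fun s => sSup {r | r ∈ G ∧ r < s})^[c - i] (z j)

/-- The T-spline blending function associated with the anchor `z`. -/
def Data.blending (D : Data d) (Q : Set (Elem d)) (z x : Fin d → ℝ) : ℝ :=
  ∏ j, bspline (fun i => D.knotAt j (D.localIndex Q z j i)) (D.p j) 0 (x j)

/-! ### The Bézier mesh -/

/-- On `U`, the function `f` coincides with a polynomial of degree at most `p j` in the `j`-th
variable, for all `j`. -/
def IsPolynomialOn (p : Fin d → ℕ) (U : Set (Fin d → ℝ)) (f : (Fin d → ℝ) → ℝ) : Prop :=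
  ∃ q : MvPolynomial (Fin d) ℝ, (∀ j, q.degreeOf j ≤ p j) ∧ ∀ x ∈ U, f x = MvPolynomial.eval x q

/-- The Bézier mesh: the maximal open subsets of the parametric domain on which every blending
function is a polynomial of degree `𝐩`. -/
def Data.bezierMesh (D : Data d) (Q : Set (Elem d)) : Set (Set (Fin d → ℝ)) :=
  {B | Maximal (fun U => IsOpen U ∧ U ⊆ paramDomain d ∧
    ∀ z ∈ D.anchors Q, IsPolynomialOn D.p U (D.blending Q z)) B}

/-- The Bézier elements which meet a given set `E`. -/
def Data.bezierElementsMeeting (D : Data d) (Q : Set (Elem d)) (E : Set (Fin d → ℝ)) :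
    Set (Set (Fin d → ℝ)) :=
  {B | B ∈ D.bezierMesh Q ∧ (B ∩ E).Nonempty}

end TSpline

end

/-! ### Univariate B-splines: the polynomial pieces on different knot spans -/

namespace TSpline

/-! The argument takes place in the index/parametric domain. There every element is a dyadic cell
whose shape is determined by its level, while the elements outside are unit prolongations of those
touching the boundary. Refinement preserves this structure together with a grading: if `a` is the
cell of a proper ancestor of an element, then no element coarser than `a` meets the generalized
neighborhood of `a` (`Data.Structured`, `Data.Structured.bisect_step`).

The heart is `Data.Structured.localIndex_eq_mid`: if the support of a blending function meets an
element `e` and one of its knots lies strictly inside a side of `e`, then the knot is at the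
midpoint of `e` in the direction of the next bisection. Indeed, the knot comes from a face of some
finer element `f`, and it is the midpoint of a unique ancestor cell `a` of `f` whose level is at
least that of `e`. If the levels agree, `a` and `e` share this side, and the midpoint is that of
`e`. Otherwise `a` is finer than `e`, and grading keeps `e` out of the neighborhood of `a`. That
neighborhood contains all grid lines of the level of `a`. In the cut direction there are enough of
them to force the anchor close to `a`, and in each other direction enough to confine the support to
the neighborhood whenever the neighborhood is bounded by something inside the domain. So the support
misses `e`, a contradiction.

Hence all blending functions are polynomial on `e`, or on its two halves if the midpoint actually
occurs as a knot (`Data.IsPart`, `Data.Structured.off_or_exists_spans`). These parts cannot be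
enlarged: any two of them are separated by a knot of a blending function that does not vanish on one
of them (`Data.Structured.separated`), and the pieces of a B-spline on two different knot spans are
nonzero and not proportional (`piece_ne_zero`, `eq_zero_of_piece_proportional`). Polynomial regions
that overlap can be merged, so the parts are the only Bézier elements meeting `e`. The halves have
equal measure because knots are interpolated linearly inside each initial cell. -/

open Polynomial in
/-- The polynomial that agrees on the knot span `(τ a, τ (a + 1))` with the `i`-th B-spline of
degree `k`. -/
noncomputable def piece (τ : ℕ → ℝ) (a : ℕ) : ℕ → ℕ → Polynomial ℝ
  | 0, i => if i = a then 1 else 0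
  | k + 1, i =>
      (X - C (τ i)) * (C (1 / (τ (i + k + 1) - τ i)) * piece τ a k i) +
        (C (τ (i + k + 2)) - X) * (C (1 / (τ (i + k + 2) - τ (i + 1))) * piece τ a k (i + 1))

theorem bspline_congr {τ σ : ℕ → ℝ} {t : ℝ} : ∀ (k i : ℕ),
    (∀ m, i ≤ m → m ≤ i + k + 1 → τ m = σ m) → bspline τ k i t = bspline σ k i t
  | 0, i, h => by
      simp only [bspline]
      rw [h i le_rfl (by omega), h (i + 1) (by omega) (by omega)]
  | k + 1, i, h => by
      simp only [bspline]
      rw [bspline_congr k i (fun m h1 h2 => h m h1 (by omega)),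
        bspline_congr k (i + 1) (fun m h1 h2 => h m (by omega) (by omega)),
        h i le_rfl (by omega), h (i + 1) (by omega) (by omega), h (i + k + 1) (by omega) (by omega),
        h (i + k + 2) (by omega) (by omega)]

theorem bspline_eq_zero {τ : ℕ → ℝ} (hτ : Monotone τ) {t : ℝ} : ∀ (k i : ℕ),
    (t < τ i ∨ τ (i + k + 1) ≤ t) → bspline τ k i t = 0
  | 0, i, h => by
      simp only [bspline]
      rw [if_neg]
      rintro ⟨h1, h2⟩
      rcases h with h | h
      · linarith
      · simp only [add_zero] at h; linarith
  | k + 1, i, h => by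
      simp only [bspline]
      have e : i + 1 + k + 1 = i + (k + 1) + 1 := by omega
      rw [bspline_eq_zero hτ k i, bspline_eq_zero hτ k (i + 1)]
      · simp
      · rw [e]
        exact h.imp (fun h => h.trans_le (hτ (by omega))) id
      · exact h.imp id (fun h => (hτ (by omega)).trans h)

theorem bspline_eq_piece {τ : ℕ → ℝ} (hτ : Monotone τ) {a : ℕ} {t : ℝ} (h1 : τ a < t)
    (h2 : t < τ (a + 1)) : ∀ k i : ℕ, bspline τ k i t = (piece τ a k i).eval t
  | 0, i => by
      simp only [bspline, piece]
      by_cases h : i = a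
      · subst h; simp [h1.le, h2]
      · rw [if_neg h, if_neg]
        · simp
        · rintro ⟨h3, h4⟩
          rcases lt_or_gt_of_ne h with h | h
          · exact absurd (h4.trans_le (hτ (show i + 1 ≤ a from h))) (by linarith)
          · exact absurd (h2.trans_le (hτ (show a + 1 ≤ i from h))) (by linarith)
  | k + 1, i => by
      simp only [bspline, piece]
      rw [bspline_eq_piece hτ h1 h2 k i, bspline_eq_piece hτ h1 h2 k (i + 1)]
      simp only [Polynomial.eval_add, Polynomial.eval_mul, Polynomial.eval_sub, Polynomial.eval_X,
        Polynomial.eval_C]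
      ring

theorem piece_eq_zero (τ : ℕ → ℝ) (a : ℕ) : ∀ k i : ℕ, (a < i ∨ i + k < a) → piece τ a k i = 0
  | 0, i, h => by
      simp only [piece]
      rw [if_neg (by omega)]
  | k + 1, i, h => by
      simp only [piece]
      rw [piece_eq_zero τ a k i (by omega), piece_eq_zero τ a k (i + 1) (by omega)]
      simp

theorem natDegree_piece_le (τ : ℕ → ℝ) (a : ℕ) : ∀ k i : ℕ, (piece τ a k i).natDegree ≤ k
  | 0, i => by
      simp only [piece]
      split_ifs <;> simp
  | k + 1, i => by
      simp only [piece]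
      have h1 := natDegree_piece_le τ a k i
      have h2 := natDegree_piece_le τ a k (i + 1)
      refine (Polynomial.natDegree_add_le _ _).trans (max_le ?_ ?_)
      · refine Polynomial.natDegree_mul_le.trans ?_
        have := Polynomial.natDegree_C_mul_le (1 / (τ (i + k + 1) - τ i)) (piece τ a k i)
        have h3 := Polynomial.natDegree_X_sub_C_le (τ i)
        omega
      · refine Polynomial.natDegree_mul_le.trans ?_
        have := Polynomial.natDegree_C_mul_le (1 / (τ (i + k + 2) - τ (i + 1))) (piece τ a k (i + 1))
        have h3 : (Polynomial.C (τ (i + k + 2)) - Polynomial.X).natDegree ≤ 1 := by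
          refine (Polynomial.natDegree_sub_le _ _).trans ?_
          simp
        omega

section

variable {τ : ℕ → ℝ} {a : ℕ}

open Polynomial

/-- The pieces, divided by the length of their support. -/
noncomputable def scaledPiece (τ : ℕ → ℝ) (a k i : ℕ) : Polynomial ℝ :=
  C (1 / (τ (i + k + 1) - τ i)) * piece τ a k i

theorem piece_succ (k i : ℕ) :
    piece τ a (k + 1) i = (X - C (τ i)) * scaledPiece τ a k i +
      (C (τ (i + k + 2)) - X) * scaledPiece τ a k (i + 1) := by
  simp only [piece, scaledPiece]
  have e : i + 1 + k + 1 = i + k + 2 := by omega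
  rw [e]

theorem knot_lt_of_mem (hτ : Monotone τ) (ha : τ a < τ (a + 1)) {k i : ℕ} (h1 : i ≤ a)
    (h2 : a ≤ i + k) : τ i < τ (i + k + 1) :=
  (hτ h1).trans_lt (ha.trans_le (hτ (by omega)))

theorem C_mul_scaledPiece (hτ : Monotone τ) (ha : τ a < τ (a + 1)) (k i : ℕ) :
    C (τ (i + k + 1) - τ i) * scaledPiece τ a k i = piece τ a k i := by
  unfold scaledPiece
  by_cases h : i ≤ a ∧ a ≤ i + k
  · have := knot_lt_of_mem hτ ha h.1 h.2
    rw [← mul_assoc, ← C_mul, mul_one_div_cancel (by linarith), C_1, one_mul]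
  · rw [piece_eq_zero τ a k i (by omega)]
    simp

theorem scaledPiece_eq_zero (k i : ℕ) (h : a < i ∨ i + k < a) : scaledPiece τ a k i = 0 := by
  rw [scaledPiece, piece_eq_zero τ a k i h, mul_zero]

theorem C_inj_mul {c : ℝ} (hc : c ≠ 0) {p q : Polynomial ℝ} (h : C c * p = C c * q) : p = q :=
  mul_left_cancel₀ (by simpa using hc) h

/-- The classical derivative formula, by induction on the degree. Multiplication by the knot
difference clears each quotient; where that difference may vanish, the piece is zero and the formula
is trivial. -/
theorem derivative_piece (hτ : Monotone τ) (ha : τ a < τ (a + 1)) : ∀ k i : ℕ,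
    derivative (piece τ a (k + 1) i) =
      C ((k : ℝ) + 1) * (scaledPiece τ a k i - scaledPiece τ a k (i + 1))
  | 0, i => by
      rw [piece_succ]
      have h : ∀ i, derivative (scaledPiece τ a 0 i) = 0 := by
        intro i
        simp only [scaledPiece, piece]
        split_ifs <;> simp
      simp [h]
      ring
  | k + 1, i => by
      rw [piece_succ]
      have left : (X - C (τ i)) * derivative (scaledPiece τ a (k + 1) i) =
          C ((k : ℝ) + 1) * (scaledPiece τ a (k + 1) i - scaledPiece τ a k (i + 1)) := by
        by_cases h : i ≤ a ∧ a ≤ i + (k + 1)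
        · have hd := knot_lt_of_mem hτ ha h.1 h.2
          refine C_inj_mul (sub_ne_zero.2 hd.ne') ?_
          have e1 := C_mul_scaledPiece hτ ha (k + 1) i
          have e2 := congrArg derivative e1
          rw [derivative_C_mul, derivative_piece hτ ha k i] at e2
          rw [piece_succ] at e1
          have e3 : i + (k + 1) + 1 = i + k + 2 := by omega
          simp only [e3, C_sub] at e1 e2 ⊢
          linear_combination (X - C (τ i)) * e2 - C ((k : ℝ) + 1) * e1
        · rw [scaledPiece_eq_zero _ _ (by omega), scaledPiece_eq_zero k (i + 1) (by omega)]
          simp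
      have right : (C (τ (i + (k + 1) + 2)) - X) * derivative (scaledPiece τ a (k + 1) (i + 1)) =
          - C ((k : ℝ) + 1) * (scaledPiece τ a (k + 1) (i + 1) - scaledPiece τ a k (i + 1)) := by
        by_cases h : i + 1 ≤ a ∧ a ≤ i + 1 + (k + 1)
        · have hd := knot_lt_of_mem hτ ha h.1 h.2
          refine C_inj_mul (sub_ne_zero.2 hd.ne') ?_
          have e1 := C_mul_scaledPiece hτ ha (k + 1) (i + 1)
          have e2 := congrArg derivative e1
          rw [derivative_C_mul, derivative_piece hτ ha k (i + 1)] at e2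
          rw [piece_succ] at e1
          have e3 : i + 1 + (k + 1) + 1 = i + (k + 1) + 2 := by omega
          have e4 : i + 1 + k + 2 = i + (k + 1) + 2 := by omega
          simp only [e3, e4, C_sub] at e1 e2 ⊢
          linear_combination (C (τ (i + (k + 1) + 2)) - X) * e2 + C ((k : ℝ) + 1) * e1
        · rw [scaledPiece_eq_zero _ _ (by omega), scaledPiece_eq_zero k (i + 1) (by omega)]
          simp
      simp only [derivative_add, derivative_mul, derivative_sub, derivative_X, derivative_C]
      push_cast
      simp only [C_add, C_1] at left right ⊢
      linear_combination left + right

/-- The `k`-th derivative of a B-spline of degree `k + 1` is a combination of hat functions with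
alternating coefficients. On the span `a` it is thus affine and changes sign there, in a sense given
by the parity of `a + i`. Strictness fails only at an end of the support, which is why the two
strict claims carry different index ranges. -/
theorem iterate_derivative_piece_sign (hτ : Monotone τ) (ha : τ a < τ (a + 1)) : ∀ k i : ℕ,
    ((a < i ∨ i + (k + 1) < a) → (derivative^[k] (piece τ a (k + 1) i)) = 0) ∧
    0 ≤ (-1) ^ (a + i) * (derivative^[k] (piece τ a (k + 1) i)).eval (τ (a + 1)) ∧
    (i ≤ a → a < i + (k + 1) →
      0 < (-1) ^ (a + i) * (derivative^[k] (piece τ a (k + 1) i)).eval (τ (a + 1))) ∧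
    (-1) ^ (a + i) * (derivative^[k] (piece τ a (k + 1) i)).eval (τ a) ≤ 0 ∧
    (i < a → a ≤ i + (k + 1) →
      (-1) ^ (a + i) * (derivative^[k] (piece τ a (k + 1) i)).eval (τ a) < 0)
  | 0, i => by
      refine ⟨fun h => by simp [piece_eq_zero τ a (0 + 1) i h], ?_⟩
      simp only [Function.iterate_zero, id]
      rcases lt_trichotomy a i with h | h | h
      · rw [piece_eq_zero τ a (0 + 1) i (Or.inl h)]
        simp
        omega
      · subst h
        have h0 : piece τ a 0 (a + 1) = 0 := piece_eq_zero τ a 0 (a + 1) (Or.inl (by omega))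
        have h1 : (piece τ a 0 a) = 1 := by simp [piece]
        have h2 : (τ (a + 1) - τ a) * (τ (a + 1) - τ a)⁻¹ = 1 :=
          mul_inv_cancel₀ (sub_ne_zero.2 ha.ne')
        simp [piece_succ, scaledPiece, h0, h1, h2, ← two_mul]
      · rcases Nat.lt_or_ge (i + 1) a with h' | h'
        · rw [piece_eq_zero τ a (0 + 1) i (Or.inr (by omega))]
          simp
          omega
        · obtain rfl : a = i + 1 := by omega
          have h0 : piece τ (i + 1) 0 i = 0 := piece_eq_zero τ (i + 1) 0 i (Or.inr (by omega))
          have h1 : (piece τ (i + 1) 0 (i + 1)) = 1 := by simp [piece]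
          have h2 : (τ (i + 1 + 1) - τ (i + 1)) * (τ (i + 1 + 1) - τ (i + 1))⁻¹ = 1 :=
            mul_inv_cancel₀ (sub_ne_zero.2 ha.ne')
          have h3 : ((-1 : ℝ)) ^ (i + 1 + i) = -1 := by
            rw [show i + 1 + i = 2 * i + 1 by omega, pow_succ, pow_mul]; simp
          have e : i + 2 = i + 1 + 1 := rfl
          simp [piece_succ, scaledPiece, h0, h1, e, h2, h3]
  | k + 1, i => by
      have hrec : derivative^[k + 1] (piece τ a (k + 1 + 1) i) =
          C ((k : ℝ) + 1 + 1) *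
            (C (1 / (τ (i + (k + 1) + 1) - τ i)) * derivative^[k] (piece τ a (k + 1) i) -
              C (1 / (τ (i + 1 + (k + 1) + 1) - τ (i + 1))) *
                derivative^[k] (piece τ a (k + 1) (i + 1))) := by
        rw [Function.iterate_succ_apply, derivative_piece hτ ha, iterate_derivative_C_mul,
          iterate_derivative_sub, scaledPiece, scaledPiece, iterate_derivative_C_mul,
          iterate_derivative_C_mul]
        push_cast
        rfl
      obtain ⟨z1, p1, q1, n1, m1⟩ := iterate_derivative_piece_sign hτ ha k i
      obtain ⟨z2, p2, q2, n2, m2⟩ := iterate_derivative_piece_sign hτ ha k (i + 1)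
      have hs : ((-1 : ℝ)) ^ (a + (i + 1)) = - (-1) ^ (a + i) := by rw [← add_assoc, pow_succ]; ring
      rw [hs] at p2 q2 n2 m2
      have c1 : 0 ≤ 1 / (τ (i + (k + 1) + 1) - τ i) := by
        have := hτ (show i ≤ i + (k + 1) + 1 by omega)
        exact div_nonneg zero_le_one (by linarith)
      have c2 : 0 ≤ 1 / (τ (i + 1 + (k + 1) + 1) - τ (i + 1)) := by
        have := hτ (show i + 1 ≤ i + 1 + (k + 1) + 1 by omega)
        exact div_nonneg zero_le_one (by linarith)
      have c1' : i ≤ a → a ≤ i + (k + 1) → 0 < 1 / (τ (i + (k + 1) + 1) - τ i) := by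
        intro h h'
        have := knot_lt_of_mem hτ ha h h'
        exact div_pos zero_lt_one (by linarith)
      have c2' : i + 1 ≤ a → a ≤ i + 1 + (k + 1) →
          0 < 1 / (τ (i + 1 + (k + 1) + 1) - τ (i + 1)) := by
        intro h h'
        have := knot_lt_of_mem hτ ha h h'
        exact div_pos zero_lt_one (by linarith)
      rw [hrec]
      generalize 1 / (τ (i + (k + 1) + 1) - τ i) = d1 at *
      generalize 1 / (τ (i + 1 + (k + 1) + 1) - τ (i + 1)) = d2 at *
      generalize derivative^[k] (piece τ a (k + 1) i) = f1 at *
      generalize derivative^[k] (piece τ a (k + 1) (i + 1)) = f2 at *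
      have hk : (0 : ℝ) < (k : ℝ) + 1 + 1 := by positivity
      have key : ∀ s : ℝ, (-1) ^ (a + i) *
          eval s (C ((k : ℝ) + 1 + 1) * (C d1 * f1 - C d2 * f2)) =
          ((k : ℝ) + 1 + 1) * (d1 * ((-1) ^ (a + i) * eval s f1) +
            d2 * (-(-1) ^ (a + i) * eval s f2)) := by
        intro s
        simp only [eval_mul, eval_C, eval_sub]
        ring
      simp only [key]
      refine ⟨fun h => ?_, ?_, ?_, ?_, ?_⟩
      · rw [z1 (by omega), z2 (by omega)]; simp
      · exact mul_nonneg hk.le (add_nonneg (mul_nonneg c1 p1) (mul_nonneg c2 p2))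
      · intro h h'
        refine mul_pos hk ?_
        by_cases h3 : a < i + (k + 1)
        · exact add_pos_of_pos_of_nonneg (mul_pos (c1' h (by omega)) (q1 h h3)) (mul_nonneg c2 p2)
        · exact add_pos_of_nonneg_of_pos (mul_nonneg c1 p1)
            (mul_pos (c2' (by omega) (by omega)) (q2 (by omega) (by omega)))
      · exact mul_nonpos_of_nonneg_of_nonpos hk.le (add_nonpos
          (mul_nonpos_of_nonneg_of_nonpos c1 n1) (mul_nonpos_of_nonneg_of_nonpos c2 n2))
      · intro h h'
        refine mul_neg_of_pos_of_neg hk ?_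
        by_cases h3 : a ≤ i + (k + 1)
        · exact add_neg_of_neg_of_nonpos (mul_neg_of_pos_of_neg (c1' (by omega) h3) (m1 h h3))
            (mul_nonpos_of_nonneg_of_nonpos c2 n2)
        · exact add_neg_of_nonpos_of_neg (mul_nonpos_of_nonneg_of_nonpos c1 n1)
            (mul_neg_of_pos_of_neg (c2' (by omega) (by omega)) (m2 (by omega) (by omega)))

end

/-- The pieces of a B-spline on knot spans inside its support do not vanish. -/
theorem piece_ne_zero {τ : ℕ → ℝ} (hτ : Monotone τ) {a p : ℕ} (hp : 1 ≤ p) (hap : a ≤ p)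
    (ha : τ a < τ (a + 1)) : piece τ a p 0 ≠ 0 := by
  obtain ⟨k, rfl⟩ : ∃ k, p = k + 1 := ⟨p - 1, by omega⟩
  intro h
  obtain ⟨-, -, q, -, m⟩ := iterate_derivative_piece_sign hτ ha k 0
  rw [h] at q m
  simp at q m
  omega

/-- The `k`-th derivatives of both pieces are affine and non-constant. The first vanishes before `τ
(a + 1)`, the second only after `τ b`, and `τ (a + 1) ≤ τ b`. Proportional affine functions with
nonzero factors would share their zero. -/
theorem eq_zero_of_piece_proportional_of_lt {τ : ℕ → ℝ} (hτ : Monotone τ) {a b p : ℕ}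
    (hab : a < b) (hbp : b ≤ p) (ha : τ a < τ (a + 1)) (hb : τ b < τ (b + 1)) {c c' : ℝ}
    (h : ∀ t, c * (piece τ a p 0).eval t = c' * (piece τ b p 0).eval t) : c = 0 ∧ c' = 0 := by
  obtain ⟨k, rfl⟩ : ∃ k, p = k + 1 := ⟨p - 1, by omega⟩
  have hpoly : Polynomial.C c * piece τ a (k + 1) 0 = Polynomial.C c' * piece τ b (k + 1) 0 := by
    refine Polynomial.funext fun t => ?_
    simpa using h t
  have hder := congrArg (Polynomial.derivative^[k]) hpoly
  rw [Polynomial.iterate_derivative_C_mul, Polynomial.iterate_derivative_C_mul] at hder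
  obtain ⟨-, -, qa, na, -⟩ := iterate_derivative_piece_sign hτ ha k 0
  obtain ⟨-, pb, -, -, mb⟩ := iterate_derivative_piece_sign hτ hb k 0
  have qa := qa (by omega) (by omega)
  have mb := mb (by omega) (by omega)
  have lin : ∀ f : Polynomial ℝ, f.natDegree ≤ k + 1 → ∃ u v : ℝ, ∀ t,
      (Polynomial.derivative^[k] f).eval t = u * t + v := by
    intro f hf
    have hd : (Polynomial.derivative^[k] f).natDegree ≤ 1 :=
      (Polynomial.natDegree_iterate_derivative f k).trans (by omega)
    refine ⟨(Polynomial.derivative^[k] f).coeff 1, (Polynomial.derivative^[k] f).coeff 0,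
      fun t => ?_⟩
    rw [congrArg (Polynomial.eval t) (Polynomial.eq_X_add_C_of_natDegree_le_one hd)]
    simp only [Polynomial.eval_add, Polynomial.eval_mul, Polynomial.eval_C, Polynomial.eval_X]
  obtain ⟨u, v, huv⟩ := lin _ (natDegree_piece_le τ a (k + 1) 0)
  obtain ⟨u', v', huv'⟩ := lin _ (natDegree_piece_le τ b (k + 1) 0)
  have hlin : ∀ t, c * (u * t + v) = c' * (u' * t + v') := by
    intro t
    have := congrArg (Polynomial.eval t) hder
    simpa [huv, huv'] using this
  rw [huv] at qa na
  rw [huv'] at pb mb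
  have hsq : ∀ n : ℕ, ((-1 : ℝ) ^ n) * (-1) ^ n = 1 := by
    intro n; rw [← mul_pow]; simp
  have ea := hsq (a + 0)
  have eb := hsq (b + 0)
  generalize ((-1 : ℝ) ^ (a + 0)) = ε at *
  generalize ((-1 : ℝ) ^ (b + 0)) = δ at *
  have hle : τ (a + 1) ≤ τ b := hτ hab
  have hu : 0 < ε * u := by
    have : 0 < (ε * u) * (τ (a + 1) - τ a) := by nlinarith
    exact (pos_iff_pos_of_mul_pos this).2 (by linarith)
  have hu' : 0 < δ * u' := by
    have : 0 < (δ * u') * (τ (b + 1) - τ b) := by nlinarith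
    exact (pos_iff_pos_of_mul_pos this).2 (by linarith)
  -- the zero `t₀` of the first linear function lies before `τ b`
  have hu0 : u ≠ 0 := by rintro rfl; simp at hu
  have h0 : c' * (u' * (-v / u) + v') = 0 := by
    rw [← hlin]; field_simp; ring
  have hc' : c' = 0 := by
    rcases mul_eq_zero.1 h0 with h0 | h0
    · exact h0
    · exfalso
      have h1 : ε * u * (τ (a + 1) - -v / u) = ε * (u * τ (a + 1) + v) := by field_simp; ring
      have h2 : 0 < τ (a + 1) - -v / u := by
        rw [← h1] at qa
        exact (pos_iff_pos_of_mul_pos qa).1 hu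
      have h3 : δ * (u' * τ b + v') = δ * u' * (τ b - -v / u) := by
        linear_combination δ * h0
      rw [h3] at mb
      nlinarith [mul_pos hu' (show 0 < τ b - -v / u by linarith)]
  refine ⟨?_, hc'⟩
  have h1 := hlin (τ (a + 1))
  rw [hc', zero_mul] at h1
  rcases mul_eq_zero.1 h1 with h1 | h1
  · exact h1
  · rw [h1] at qa; simp at qa

/-- The pieces of a B-spline on two different knot spans are not proportional. -/
theorem eq_zero_of_piece_proportional {τ : ℕ → ℝ} (hτ : Monotone τ) {a b p : ℕ}
    (hab : a ≠ b) (hap : a ≤ p) (hbp : b ≤ p) (ha : τ a < τ (a + 1)) (hb : τ b < τ (b + 1))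
    {c c' : ℝ} (h : ∀ t, c * (piece τ a p 0).eval t = c' * (piece τ b p 0).eval t) : c = 0 := by
  rcases lt_or_gt_of_ne hab with hab | hab
  · exact (eq_zero_of_piece_proportional_of_lt hτ hab hbp ha hb h).1
  · exact (eq_zero_of_piece_proportional_of_lt hτ hab hap hb ha fun t => (h t).symm).2

end TSpline

/-! ### Polynomials on open sets and tensor product B-splines -/

namespace TSpline

variable {d : ℕ}

theorem exists_infinite_pi_subset {W : Set (Fin d → ℝ)} (hW : IsOpen W) {x : Fin d → ℝ}
    (hx : x ∈ W) : ∃ s : Fin d → Set ℝ, (∀ i, (s i).Infinite) ∧ Set.univ.pi s ⊆ W := by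
  obtain ⟨u, hu, hsub⟩ := isOpen_pi_iff'.1 hW x hx
  exact ⟨u, fun i => infinite_of_mem_nhds (x i) ((hu i).1.mem_nhds (hu i).2), hsub⟩

/-- An open set contains a product of infinite sets, and such a product determines a polynomial. -/
theorem mvPolynomial_eq_of_eqOn {W : Set (Fin d → ℝ)} (hW : IsOpen W) {x : Fin d → ℝ}
    (hx : x ∈ W) {q q' : MvPolynomial (Fin d) ℝ}
    (h : ∀ y ∈ W, MvPolynomial.eval y q = MvPolynomial.eval y q') : q = q' := by
  obtain ⟨s, hs, hsub⟩ := exists_infinite_pi_subset hW hx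
  exact MvPolynomial.funext_set s hs fun y hy => h y (hsub hy)

theorem IsPolynomialOn.union {p : Fin d → ℕ} {U V : Set (Fin d → ℝ)} {f : (Fin d → ℝ) → ℝ}
    (hU : IsOpen U) (hV : IsOpen V) (hUV : (U ∩ V).Nonempty) (h : IsPolynomialOn p U f)
    (h' : IsPolynomialOn p V f) : IsPolynomialOn p (U ∪ V) f := by
  obtain ⟨q, hq, hqU⟩ := h
  obtain ⟨q', -, hqV⟩ := h'
  obtain ⟨x, hx⟩ := hUV
  have : q = q' := mvPolynomial_eq_of_eqOn (hU.inter hV) hx fun y hy => by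
    rw [← hqU y hy.1, hqV y hy.2]
  subst this
  exact ⟨q, hq, fun y hy => hy.elim (hqU y) (hqV y)⟩

/-- The tensor product of univariate polynomials. -/
noncomputable def tensorPoly (P : Fin d → Polynomial ℝ) : MvPolynomial (Fin d) ℝ :=
  ∏ j, Polynomial.aeval (MvPolynomial.X j) (P j)

theorem eval_tensorPoly (P : Fin d → Polynomial ℝ) (x : Fin d → ℝ) :
    MvPolynomial.eval x (tensorPoly P) = ∏ j, (P j).eval (x j) := by
  rw [tensorPoly, map_prod]
  refine Finset.prod_congr rfl fun j _ => ?_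
  rw [Polynomial.aeval_eq_sum_range, map_sum, Polynomial.eval_eq_sum_range]
  refine Finset.sum_congr rfl fun n _ => ?_
  simp [MvPolynomial.smul_eval]

theorem degreeOf_tensorPoly_le (P : Fin d → Polynomial ℝ) (j : Fin d) :
    (tensorPoly P).degreeOf j ≤ (P j).natDegree := by
  have key : ∀ i, (Polynomial.aeval (MvPolynomial.X i : MvPolynomial (Fin d) ℝ) (P i)).degreeOf j ≤
      if i = j then (P j).natDegree else 0 := by
    intro i
    rw [Polynomial.aeval_eq_sum_range]
    refine (MvPolynomial.degreeOf_sum_le _ _ _).trans (Finset.sup_le fun n hn => ?_)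
    rw [MvPolynomial.smul_eq_C_mul]
    refine (MvPolynomial.degreeOf_C_mul_le _ _ _).trans ?_
    split_ifs with h
    · subst h
      rw [MvPolynomial.degreeOf_X_self_pow]
      exact Nat.lt_succ_iff.1 (Finset.mem_range.1 hn)
    · rw [MvPolynomial.degreeOf_X_pow_of_ne _ (Ne.symm h)]
  refine (MvPolynomial.degreeOf_prod_le _ _ _).trans ?_
  refine (Finset.sum_le_sum fun i _ => key i).trans ?_
  simp

/-- The tensor product B-spline on the knot vectors `τ j`. -/
noncomputable def tensorSpline (τ : Fin d → ℕ → ℝ) (p : Fin d → ℕ) (x : Fin d → ℝ) : ℝ :=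
  ∏ j, bspline (τ j) (p j) 0 (x j)

section

variable {τ : Fin d → ℕ → ℝ} {p : Fin d → ℕ}

theorem tensorSpline_eq_eval (hτ : ∀ j, Monotone (τ j)) {a : Fin d → ℕ} {x : Fin d → ℝ}
    (hx : ∀ j, x j ∈ Set.Ioo (τ j (a j)) (τ j (a j + 1))) :
    tensorSpline τ p x =
      MvPolynomial.eval x (tensorPoly fun j => piece (τ j) (a j) (p j) 0) := by
  rw [eval_tensorPoly]
  exact Finset.prod_congr rfl fun j _ => bspline_eq_piece (hτ j) (hx j).1 (hx j).2 _ _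

theorem tensorSpline_eq_zero (hτ : ∀ j, Monotone (τ j)) {x : Fin d → ℝ} {j : Fin d}
    (hx : x j < τ j 0 ∨ τ j (p j + 1) ≤ x j) : tensorSpline τ p x = 0 :=
  Finset.prod_eq_zero (Finset.mem_univ j) (bspline_eq_zero (hτ j) _ _ (by simpa using hx))

/-- A tensor product B-spline is a polynomial on boxes without knots. -/
theorem isPolynomialOn_tensorSpline (hτ : ∀ j, Monotone (τ j)) {a : Fin d → ℕ}
    {U : Set (Fin d → ℝ)}
    (hU : ∀ x ∈ U, ∀ j, x j ∈ Set.Ioo (τ j (a j)) (τ j (a j + 1))) :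
    IsPolynomialOn p U (tensorSpline τ p) :=
  ⟨_, fun j => (degreeOf_tensorPoly_le _ j).trans (natDegree_piece_le _ _ _ _),
    fun x hx => tensorSpline_eq_eval hτ (hU x hx)⟩

theorem isPolynomialOn_zero {U : Set (Fin d → ℝ)} {f : (Fin d → ℝ) → ℝ}
    (h : ∀ x ∈ U, f x = 0) : IsPolynomialOn p U f :=
  ⟨0, fun j => by simp, fun x hx => by simp [h x hx]⟩

theorem isOpen_setOf_forall_mem_Ioo (α β : Fin d → ℝ) :
    IsOpen {x : Fin d → ℝ | ∀ j, x j ∈ Set.Ioo (α j) (β j)} := by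
  simp only [Set.ofPred_forall]
  exact isOpen_iInter_of_finite fun j => isOpen_Ioo.preimage (continuous_apply j)

/-- A tensor product B-spline is not a polynomial on an open set that meets two of its knot spans,
if it does not vanish on the first one. -/
theorem not_isPolynomialOn_tensorSpline (hτ : ∀ j, Monotone (τ j)) (hp : ∀ j, 1 ≤ p j)
    {V : Set (Fin d → ℝ)} (hV : IsOpen V) {a : Fin d → ℕ} (hap : ∀ j, a j ≤ p j)
    {x y : Fin d → ℝ} (hxV : x ∈ V) (hyV : y ∈ V)
    (hx : ∀ j, x j ∈ Set.Ioo (τ j (a j)) (τ j (a j + 1)))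
    (hy : (∃ j, y j < τ j 0 ∨ τ j (p j + 1) < y j) ∨
      ∃ b : Fin d → ℕ, (∀ j, b j ≤ p j) ∧ (∀ j, y j ∈ Set.Ioo (τ j (b j)) (τ j (b j + 1))) ∧
        a ≠ b) :
    ¬ IsPolynomialOn p V (tensorSpline τ p) := by
  rintro ⟨q, -, hq⟩
  have spanq : ∀ (c : Fin d → ℕ) (w : Fin d → ℝ), w ∈ V →
      (∀ j, w j ∈ Set.Ioo (τ j (c j)) (τ j (c j + 1))) →
      q = tensorPoly fun j => piece (τ j) (c j) (p j) 0 := by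
    intro c w hw hc
    refine mvPolynomial_eq_of_eqOn
      (hV.inter (isOpen_setOf_forall_mem_Ioo (fun j => τ j (c j)) fun j => τ j (c j + 1)))
      ⟨hw, hc⟩ fun v hv => ?_
    rw [← hq v hv.1, tensorSpline_eq_eval hτ hv.2]
  have hqa := spanq a x hxV hx
  have hne : ∀ j, ∃ w : ℝ, (piece (τ j) (a j) (p j) 0).eval w ≠ 0 := by
    intro j
    by_contra! h
    exact piece_ne_zero (hτ j) (hp j) (hap j) ((hx j).1.trans (hx j).2)
      (Polynomial.funext fun t => by simpa using h t)
  choose w hw using hne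
  rcases hy with ⟨j, hj⟩ | ⟨b, hbp, hyb, hab⟩
  · have hopen : IsOpen {v : Fin d → ℝ | v j < τ j 0 ∨ τ j (p j + 1) < v j} :=
      (isOpen_lt (continuous_apply j) continuous_const).union
        (isOpen_lt continuous_const (continuous_apply j))
    have hq0 : q = 0 := mvPolynomial_eq_of_eqOn (hV.inter hopen) ⟨hyV, hj⟩ fun v hv => by
      rw [← hq v hv.1, tensorSpline_eq_zero hτ (hv.2.imp id le_of_lt), map_zero]
    have := congrArg (MvPolynomial.eval w) (hqa.symm.trans hq0)
    rw [eval_tensorPoly, map_zero] at this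
    exact Finset.prod_ne_zero_iff.2 (fun j _ => hw j) this
  · obtain ⟨j, hj⟩ := Function.ne_iff.1 hab
    have hpoly := hqa.symm.trans (spanq b y hyV hyb)
    -- Freezing all coordinates except `j` at `w`, where no factor of the first product vanishes,
    -- turns equality of the two tensor products into proportionality of two univariate pieces.
    have hprod : ∀ (c : Fin d → ℕ) (t : ℝ), MvPolynomial.eval (Function.update w j t)
        (tensorPoly fun j => piece (τ j) (c j) (p j) 0) =
        (∏ i ∈ Finset.univ.erase j, (piece (τ i) (c i) (p i) 0).eval (w i)) *
          (piece (τ j) (c j) (p j) 0).eval t := by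
      intro c t
      rw [eval_tensorPoly, ← Finset.prod_erase_mul _ _ (Finset.mem_univ j)]
      congr 1
      · refine Finset.prod_congr rfl fun i hi => ?_
        rw [Function.update_of_ne (Finset.ne_of_mem_erase hi)]
      · rw [Function.update_self]
    have h0 := eq_zero_of_piece_proportional (hτ j) hj (hap j) (hbp j)
      ((hx j).1.trans (hx j).2) ((hyb j).1.trans (hyb j).2) (fun t => by
        rw [← hprod a t, ← hprod b t, hpoly])
    exact Finset.prod_ne_zero_iff.2 (fun i _ => hw i) h0

end

end TSpline

/-! ### The knot function: monotonicity and linear interpolation -/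

namespace TSpline

variable {d : ℕ}

namespace Data

variable (D : Data d) (j : Fin d)

/-- Otherwise the knot with index `n + 1` would belong to both the initial block of zeros and the
final block of ones. -/
theorem p_lt_n : D.p j < D.n j := by
  by_contra! h
  have h1 := D.knot_left j (D.n j + 1) (by omega) (by omega)
  have h2 := D.knot_right j (D.n j + 1) le_rfl (by omega)
  linarith

theorem knot_strictMono {i k : ℕ} (hi : D.p j + 1 ≤ i) (hik : i < k) (hk : k ≤ D.n j + 1) :
    D.knot j i < D.knot j k := by
  induction k, hik using Nat.le_induction with
  | base => exact D.knot_lt j i hi (by omega)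
  | succ k hk' ih => exact (ih (by omega)).trans (D.knot_lt j k (by omega) (by omega))

theorem knotAt_left {r : ℝ} (h1 : 1 ≤ r) (h2 : r ≤ D.p j + 1) : D.knotAt j r = 0 := by
  have h0 : 0 ≤ r := by linarith
  have hf1 := Nat.floor_le h0
  have hf2 : 1 ≤ ⌊r⌋₊ := Nat.le_floor (by simpa using h1)
  rcases h2.lt_or_eq with h | h
  · have hf3 : ⌊r⌋₊ < D.p j + 1 := (Nat.floor_lt h0).2 (by push_cast; exact h)
    rw [knotAt, D.knot_left j _ hf2 (by omega), D.knot_left j _ (by omega) (by omega)]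
    simp
  · have h' : r = ((D.p j + 1 : ℕ) : ℝ) := by push_cast; exact h
    rw [h', D.knotAt_natCast, D.knot_left j _ (by omega) le_rfl]

theorem knotAt_right {r : ℝ} (h1 : (D.n j : ℝ) + 1 ≤ r) (h2 : r ≤ D.n j + D.p j + 1) :
    D.knotAt j r = 1 := by
  have hn : (0 : ℝ) ≤ D.n j := Nat.cast_nonneg _
  have h0 : 0 ≤ r := by linarith
  have hf1 := Nat.floor_le h0
  have hf2 : D.n j + 1 ≤ ⌊r⌋₊ := Nat.le_floor (by push_cast; exact h1)
  rcases h2.lt_or_eq with h | h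
  · have hf3 : ⌊r⌋₊ < D.n j + D.p j + 1 := (Nat.floor_lt h0).2 (by push_cast; exact h)
    rw [knotAt, D.knot_right j _ hf2 (by omega), D.knot_right j _ (by omega) (by omega)]
    simp
  · have h' : r = ((D.n j + D.p j + 1 : ℕ) : ℝ) := by push_cast; exact h
    rw [h', D.knotAt_natCast, D.knot_right j _ (by omega) le_rfl]

theorem knotAt_strictMonoOn :
    StrictMonoOn (D.knotAt j) (Set.Icc ((D.p j : ℝ) + 1) ((D.n j : ℝ) + 1)) := by
  rintro r ⟨hr1, hr2⟩ s ⟨hs1, hs2⟩ hrs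
  have hp : (0 : ℝ) ≤ D.p j := Nat.cast_nonneg _
  have h0 : 0 ≤ r := by linarith
  have hi1 := Nat.floor_le h0
  have hi2 := Nat.lt_floor_add_one r
  have hi : D.p j + 1 ≤ ⌊r⌋₊ := Nat.le_floor (by push_cast; exact hr1)
  have hin : ⌊r⌋₊ < D.n j + 1 := (Nat.floor_lt h0).2 (by push_cast; linarith)
  generalize ⌊r⌋₊ = i at *
  rw [D.knotAt_eq j i r hi1 hi2.le]
  have hlt := D.knot_lt j i hi (by omega)
  rcases le_or_gt s (i + 1) with hs | hs
  · rw [D.knotAt_eq j i s (hi1.trans hrs.le) hs]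
    have := mul_lt_mul_of_pos_right (sub_lt_sub_right hrs (i : ℝ)) (sub_pos.2 hlt)
    linarith
  · have h0' : 0 ≤ s := by linarith
    have hk1 := Nat.floor_le h0'
    have hk2 := Nat.lt_floor_add_one s
    have hik : i + 1 ≤ ⌊s⌋₊ := Nat.le_floor (by push_cast; linarith)
    have hkn : ⌊s⌋₊ ≤ D.n j + 1 := by
      have : ((⌊s⌋₊ : ℕ) : ℝ) ≤ ((D.n j + 1 : ℕ) : ℝ) := by push_cast; linarith
      exact_mod_cast this
    generalize ⌊s⌋₊ = k at *
    have h1 : D.knot j i + (r - i) * (D.knot j (i + 1) - D.knot j i) < D.knot j (i + 1) := by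
      have := mul_lt_mul_of_pos_right (show r - i < 1 by linarith) (sub_pos.2 hlt)
      linarith
    have h2 : D.knot j (i + 1) ≤ D.knot j k := by
      rcases hik.lt_or_eq with h | h
      · exact (D.knot_strictMono j (by omega) h hkn).le
      · rw [h]
    have h3 : D.knot j k ≤ D.knotAt j s := by
      rw [D.knotAt_eq j k s hk1 hk2.le]
      rcases hkn.lt_or_eq with h | h
      · have := D.knot_lt j k (by omega) (by omega)
        have := mul_nonneg (sub_nonneg.2 hk1) (sub_pos.2 this).le
        linarith
      · have : s = k := by rw [h] at hk1 ⊢; push_cast at hk1 ⊢; linarith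
        rw [this]; simp
    linarith

theorem knotAt_monotoneOn :
    MonotoneOn (D.knotAt j) (Set.Icc (1 : ℝ) ((D.n j : ℝ) + D.p j + 1)) := by
  rintro r ⟨hr1, hr2⟩ s ⟨hs1, hs2⟩ hrs
  have hpn : (D.p j : ℝ) < D.n j := by exact_mod_cast D.p_lt_n j
  have hp : (0 : ℝ) ≤ D.p j := Nat.cast_nonneg _
  have hm := (D.knotAt_strictMonoOn j).monotoneOn
  have hl : D.knotAt j ((D.p j : ℝ) + 1) = 0 := D.knotAt_left j (by linarith) le_rfl
  have hr : D.knotAt j ((D.n j : ℝ) + 1) = 1 := D.knotAt_right j le_rfl (by linarith)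
  have hm01 : ∀ t ∈ Set.Icc ((D.p j : ℝ) + 1) ((D.n j : ℝ) + 1),
      0 ≤ D.knotAt j t ∧ D.knotAt j t ≤ 1 := by
    intro t ht
    constructor
    · rw [← hl]; exact hm ⟨le_rfl, by linarith⟩ ht ht.1
    · rw [← hr]; exact hm ht ⟨by linarith, le_rfl⟩ ht.2
  rcases le_or_gt r (D.p j + 1) with h | h
  · rw [D.knotAt_left j hr1 h]
    rcases le_or_gt s (D.p j + 1) with h' | h'
    · rw [D.knotAt_left j hs1 h']
    · rcases le_or_gt s (D.n j + 1) with h'' | h''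
      · exact (hm01 s ⟨h'.le, h''⟩).1
      · rw [D.knotAt_right j h''.le hs2]; norm_num
  · rcases le_or_gt s (D.n j + 1) with h'' | h''
    · exact hm ⟨h.le, by linarith⟩ ⟨by linarith, h''⟩ hrs
    · rw [D.knotAt_right j h''.le hs2]
      rcases le_or_gt r (D.n j + 1) with h' | h'
      · exact (hm01 r ⟨h.le, h'⟩).2
      · rw [D.knotAt_right j h'.le hr2]

/-- Every parametric coordinate is the image of an index coordinate. -/
theorem exists_knotAt_eq {x : ℝ} (h0 : 0 < x) (h1 : x < 1) :
    ∃ y ∈ Set.Ioo ((D.p j : ℝ) + 1) ((D.n j : ℝ) + 1), D.knotAt j y = x := by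
  have key : ∀ k : ℕ, D.p j + 1 ≤ k → k ≤ D.n j + 1 → x < D.knot j k →
      ∃ i, D.p j + 1 ≤ i ∧ i ≤ D.n j ∧ D.knot j i ≤ x ∧ x < D.knot j (i + 1) := by
    intro k hk
    induction k, hk using Nat.le_induction with
    | base =>
      intro _ h
      rw [D.knot_left j _ (by omega) le_rfl] at h
      linarith
    | succ k hk ih =>
      intro hkn hx
      rcases le_or_gt (D.knot j k) x with h | h
      · exact ⟨k, hk, by omega, h, hx⟩
      · exact ih (by omega) h
  have hpn := D.p_lt_n j
  obtain ⟨i, hi1, hi2, hx1, hx2⟩ := key (D.n j + 1) (by omega) le_rfl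
    (by rw [D.knot_right j _ le_rfl (by omega)]; exact h1)
  have hpos : 0 < D.knot j (i + 1) - D.knot j i := by linarith
  set δ := (x - D.knot j i) / (D.knot j (i + 1) - D.knot j i) with hδ
  have hδ0 : 0 ≤ δ := div_nonneg (by linarith) hpos.le
  have hδ1 : δ < 1 := by rw [hδ, div_lt_one hpos]; linarith
  have hval : D.knotAt j (i + δ) = x := by
    rw [D.knotAt_eq j i _ (by linarith) (by linarith), add_sub_cancel_left, hδ,
      div_mul_cancel₀ _ hpos.ne']
    ring
  have hir : ((D.p j + 1 : ℕ) : ℝ) ≤ i := by exact_mod_cast hi1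
  have hin : (i : ℝ) ≤ D.n j := by exact_mod_cast hi2
  push_cast at hir
  refine ⟨i + δ, ⟨?_, by linarith⟩, hval⟩
  rcases (show (D.p j : ℝ) + 1 ≤ i + δ by linarith).lt_or_eq with h | h
  · exact h
  · exfalso
    rw [← h, D.knotAt_left j (by linarith [(Nat.cast_nonneg (D.p j) : (0 : ℝ) ≤ D.p j)]) le_rfl]
      at hval
    linarith

/-- Inside one initial cell the knot is an affine function of the index, so bisection of index
elements is bisection of their parametric images. -/
theorem knotAt_midpoint {i : ℕ} {r s : ℝ} (h1 : (i : ℝ) ≤ r) (hrs : r ≤ s) (h2 : s ≤ i + 1) :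
    D.knotAt j ((r + s) / 2) = (D.knotAt j r + D.knotAt j s) / 2 := by
  rw [D.knotAt_eq j i r h1 (by linarith), D.knotAt_eq j i s (by linarith) h2,
    D.knotAt_eq j i _ (by linarith) (by linarith)]
  ring

end Data

end TSpline

/-! ### Dyadic grids and cells -/

namespace TSpline

variable {d : ℕ} [NeZero d]

/-- The side length in direction `j` of an element of level `k` in the index/parametric domain. -/
noncomputable def sideLength (d : ℕ) [NeZero d] : ℕ → Fin d → ℝ
  | 0, _ => 1
  | k + 1, j => if dir d k = j then sideLength d k j / 2 else sideLength d k j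

theorem sideLength_succ_dir (k : ℕ) :
    sideLength d (k + 1) (dir d k) = sideLength d k (dir d k) / 2 := by
  simp [sideLength]

theorem sideLength_succ_of_ne {k : ℕ} {j : Fin d} (h : dir d k ≠ j) :
    sideLength d (k + 1) j = sideLength d k j := by
  simp [sideLength, h]

theorem sideLength_pos (k : ℕ) (j : Fin d) : 0 < sideLength d k j := by
  induction k with
  | zero => simp [sideLength]
  | succ k ih =>
    simp only [sideLength]
    split_ifs <;> linarith

/-- The grid formed by the `j`-th coordinates of the vertices of the elements of level `k`. -/
def OnGrid (k : ℕ) (j : Fin d) (r : ℝ) : Prop :=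
  ∃ m : ℤ, r = m * sideLength d k j

theorem OnGrid.succ {k : ℕ} {j : Fin d} {r : ℝ} (h : OnGrid k j r) : OnGrid (k + 1) j r := by
  obtain ⟨m, rfl⟩ := h
  by_cases hj : dir d k = j
  · refine ⟨2 * m, ?_⟩
    subst hj
    rw [sideLength_succ_dir]
    push_cast
    ring
  · exact ⟨m, by rw [sideLength_succ_of_ne hj]⟩

theorem OnGrid.mono {k k' : ℕ} {j : Fin d} {r : ℝ} (h : OnGrid k j r) (hk : k ≤ k') :
    OnGrid k' j r := by
  induction k', hk using Nat.le_induction with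
  | base => exact h
  | succ k' _ ih => exact ih.succ

theorem onGrid_natCast (k : ℕ) (j : Fin d) (n : ℕ) : OnGrid k j (n : ℝ) :=
  OnGrid.mono ⟨n, by simp [sideLength]⟩ (Nat.zero_le k)

theorem OnGrid.add {k : ℕ} {j : Fin d} {r s : ℝ} (hr : OnGrid k j r) (hs : OnGrid k j s) :
    OnGrid k j (r + s) := by
  obtain ⟨m, rfl⟩ := hr
  obtain ⟨m', rfl⟩ := hs
  exact ⟨m + m', by push_cast; ring⟩

theorem onGrid_int_mul (k : ℕ) (j : Fin d) (m : ℤ) : OnGrid k j (m * sideLength d k j) :=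
  ⟨m, rfl⟩

theorem onGrid_sideLength (k : ℕ) (j : Fin d) : OnGrid k j (sideLength d k j) :=
  ⟨1, by simp⟩

theorem OnGrid.add_le_of_lt {k : ℕ} {j : Fin d} {r s : ℝ} (hr : OnGrid k j r) (hs : OnGrid k j s)
    (h : r < s) : r + sideLength d k j ≤ s := by
  obtain ⟨m, rfl⟩ := hr
  obtain ⟨m', rfl⟩ := hs
  have hpos := sideLength_pos k j
  have h1 : (m : ℝ) < m' := lt_of_mul_lt_mul_right h hpos.le
  have h2 : (m : ℝ) + 1 ≤ m' := by exact_mod_cast (show m + 1 ≤ m' by exact_mod_cast h1)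
  nlinarith

theorem countable_onGrid (j : Fin d) : {r : ℝ | ∃ k, OnGrid k j r}.Countable := by
  have : {r : ℝ | ∃ k, OnGrid k j r} =
      ⋃ k : ℕ, Set.range fun m : ℤ => (m : ℝ) * sideLength d k j := by
    ext r
    simp [OnGrid, eq_comm]
  rw [this]
  exact Set.countable_iUnion fun k => Set.countable_range _

/-- Points without any dyadic coordinate. -/
def Generic (x : Fin d → ℝ) : Prop :=
  ∀ j k, ¬ OnGrid k j (x j)

theorem dense_generic : Dense {x : Fin d → ℝ | Generic x} := by
  have : {x : Fin d → ℝ | Generic x} =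
      Set.univ.pi fun j => {r : ℝ | ∃ k, OnGrid k j r}ᶜ := by
    ext x
    simp [Generic]
  rw [this]
  exact dense_pi _ fun j _ => (countable_onGrid j).dense_compl ℝ

/-- The box of the element is a dyadic cell of the level of the element. -/
def Elem.IsCell (e : Elem d) : Prop :=
  ∀ j, OnGrid e.level j (e.lo j) ∧ e.hi j = e.lo j + sideLength d e.level j

namespace Elem.IsCell

variable {e a : Elem d}

theorem lo_lt_hi (he : e.IsCell) (j : Fin d) : e.lo j < e.hi j := by
  have := sideLength_pos e.level j
  rw [(he j).2]
  linarith

theorem onGrid_hi (he : e.IsCell) (j : Fin d) : OnGrid e.level j (e.hi j) := by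
  rw [(he j).2]
  exact (he j).1.add (onGrid_sideLength _ _)

/-- Grids are nested and points of one grid are at least one side length apart, so no line of a
coarser or equal grid runs through the interior of a cell. -/
theorem le_or_le (he : e.IsCell) {k : ℕ} (hk : k ≤ e.level) {j : Fin d} {r : ℝ}
    (hr : OnGrid k j r) : r ≤ e.lo j ∨ e.hi j ≤ r := by
  refine (le_or_gt r (e.lo j)).imp id fun h => ?_
  rw [(he j).2]
  exact (he j).1.add_le_of_lt (hr.mono hk) h

theorem nested (he : e.IsCell) (ha : a.IsCell) (hk : a.level ≤ e.level) {j : Fin d}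
    (h1 : a.lo j < e.hi j) (h2 : e.lo j < a.hi j) : a.lo j ≤ e.lo j ∧ e.hi j ≤ a.hi j := by
  constructor
  · rcases he.le_or_le hk (ha j).1 with h | h <;> linarith
  · rcases he.le_or_le hk (ha.onGrid_hi j) with h | h <;> linarith

theorem mid_sub_lo (he : e.IsCell) (j : Fin d) :
    e.mid j = e.lo j + sideLength d e.level j / 2 := by
  rw [Elem.mid, (he j).2]
  ring

theorem hi_eq_mid (he : e.IsCell) (j : Fin d) :
    e.hi j = e.mid j + sideLength d e.level j / 2 := by
  rw [Elem.mid, (he j).2]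
  ring

theorem onGrid_mid (he : e.IsCell) : OnGrid (e.level + 1) (dir d e.level) (e.mid (dir d e.level)) := by
  rw [he.mid_sub_lo, ← sideLength_succ_dir]
  exact (he _).1.succ.add (onGrid_sideLength _ _)

/-- Parents and ancestors are taken as geometric cells; they need not belong to the current mesh.
The midpoint estimate serves to compare the neighborhoods of a cell and of its parent. -/
theorem exists_parent (he : e.IsCell) {k : ℕ} (hk : e.level = k + 1) :
    ∃ a : Elem d, a.IsCell ∧ a.level = k ∧ (∀ j, a.lo j ≤ e.lo j ∧ e.hi j ≤ a.hi j) ∧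
      (∀ j, dir d k ≠ j → a.mid j = e.mid j) ∧
      |e.mid (dir d k) - a.mid (dir d k)| ≤ sideLength d (k + 1) (dir d k) / 2 := by
  have hpos := sideLength_pos (k + 1) (dir d k)
  have hs := sideLength_succ_dir (d := d) k
  obtain ⟨m, hm⟩ := (he (dir d k)).1
  have hhi := fun j => (he j).2
  rw [hk] at hm
  simp only [hk] at hhi
  set j₀ := dir d k with hj₀
  set s := sideLength d (k + 1) j₀ with hsdef
  have hs2 : sideLength d k j₀ = 2 * s := by linarith
  have hlo : ∀ q : ℤ, (m : ℝ) = 2 * q ∨ (m : ℝ) = 2 * q + 1 →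
      (2 * q * s ≤ e.lo j₀ ∧ e.hi j₀ ≤ 2 * q * s + 2 * s) ∧
      |e.mid j₀ - (2 * q * s + s)| ≤ s / 2 := by
    intro q hq
    rw [Elem.mid, hhi, hm]
    rcases hq with hq | hq <;> rw [hq]
    · refine ⟨⟨le_rfl, by linarith⟩, ?_⟩
      rw [abs_le]; constructor <;> linarith
    · refine ⟨⟨by linarith, by linarith⟩, ?_⟩
      rw [abs_le]; constructor <;> linarith
  -- The parity of the grid index decides whether the cell is the lower or the upper half of its
  -- parent.
  have hq : (m : ℝ) = 2 * ((m / 2 : ℤ) : ℝ) ∨ (m : ℝ) = 2 * ((m / 2 : ℤ) : ℝ) + 1 := by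
    rcases Int.emod_two_eq_zero_or_one m with h | h
    · left; exact_mod_cast (show m = 2 * (m / 2) by omega)
    · right; exact_mod_cast (show m = 2 * (m / 2) + 1 by omega)
  generalize m / 2 = q at *
  obtain ⟨hl, hmid⟩ := hlo q hq
  refine ⟨⟨Function.update e.lo j₀ (2 * q * s), Function.update e.hi j₀ (2 * q * s + 2 * s), k⟩,
    ?_, rfl, ?_, ?_, ?_⟩
  · intro j
    by_cases hj : j = j₀
    · subst hj
      simp only [Function.update_self]
      exact ⟨⟨q, by rw [hs2]; ring⟩, by rw [hs2]⟩
    · have hj' : dir d k ≠ j := Ne.symm hj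
      simp only [Function.update_of_ne hj]
      have h1 := (he j).1
      rw [hk] at h1
      obtain ⟨m', hm'⟩ := h1
      rw [sideLength_succ_of_ne hj'] at hm'
      exact ⟨⟨m', hm'⟩, by rw [hhi j, sideLength_succ_of_ne hj']⟩
  · intro j
    by_cases hj : j = j₀
    · subst hj
      simpa only [Function.update_self] using hl
    · simp only [Function.update_of_ne hj]
      exact ⟨le_rfl, le_rfl⟩
  · intro j hj
    simp only [Elem.mid, Function.update_of_ne (Ne.symm hj)]
  · have : Elem.mid (⟨Function.update e.lo j₀ (2 * q * s),
        Function.update e.hi j₀ (2 * q * s + 2 * s), k⟩ : Elem d) j₀ = 2 * q * s + s := by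
      simp only [Elem.mid, Function.update_self]
      ring
    rw [this]
    exact hmid

theorem exists_ancestor {k : ℕ} : ∀ {e : Elem d}, e.IsCell → k ≤ e.level →
    ∃ a : Elem d, a.IsCell ∧ a.level = k ∧ ∀ j, a.lo j ≤ e.lo j ∧ e.hi j ≤ a.hi j := by
  have key : ∀ (n : ℕ) (e : Elem d), e.IsCell → e.level = k + n →
      ∃ a : Elem d, a.IsCell ∧ a.level = k ∧ ∀ j, a.lo j ≤ e.lo j ∧ e.hi j ≤ a.hi j := by
    intro n
    induction n with
    | zero => exact fun e he hl => ⟨e, he, hl, fun j => ⟨le_rfl, le_rfl⟩⟩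
    | succ n ih =>
      intro e he hl
      obtain ⟨b, hb, hbl, hbe, -, -⟩ := he.exists_parent (k := k + n) (by omega)
      obtain ⟨a, ha, hal, hab⟩ := ih b hb hbl
      exact ⟨a, ha, hal, fun j => ⟨(hab j).1.trans (hbe j).1, (hbe j).2.trans (hab j).2⟩⟩
  intro e he hk
  exact key (e.level - k) e he (by omega)

end Elem.IsCell

/-! ### The extent of the generalized neighborhoods -/

theorem dir_val (k : ℕ) : (dir d k).val = k % d := rfl

theorem sideLength_two (k : ℕ) (j : Fin 2) :
    sideLength 2 k j = 1 / 2 ^ (if j.val = 0 then (k + 1) / 2 else k / 2) := by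
  induction k with
  | zero => simp [sideLength]
  | succ k ih =>
    simp only [sideLength]
    simp only [ih, Fin.ext_iff, dir_val]
    have hj := j.isLt
    rcases Nat.mod_two_eq_zero_or_one k with h | h
    · have e1 : (k + 1 + 1) / 2 = (k + 1) / 2 + 1 := by omega
      have e2 : (k + 1) / 2 = k / 2 := by omega
      by_cases h0 : j.val = 0
      · rw [if_pos (by omega), if_pos h0, if_pos h0, e1, pow_succ]; field_simp
      · rw [if_neg (by omega), if_neg h0, if_neg h0, e2]
    · have e1 : (k + 1 + 1) / 2 = (k + 1) / 2 := by omega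
      have e2 : (k + 1) / 2 = k / 2 + 1 := by omega
      by_cases h0 : j.val = 0
      · rw [if_neg (by omega), if_pos h0, if_pos h0, e1]
      · rw [if_pos (by omega), if_neg h0, if_neg h0, e2, pow_succ]; field_simp

theorem sideLength_three (k : ℕ) (j : Fin 3) :
    sideLength 3 k j = 1 / 2 ^ (k / 3) * (if j.val < k % 3 then 1 / 2 else 1) := by
  induction k with
  | zero => simp [sideLength]
  | succ k ih =>
    simp only [sideLength]
    simp only [ih, Fin.ext_iff, dir_val]
    have hj := j.isLt
    by_cases h3 : k % 3 = 2
    · have e1 : (k + 1) / 3 = k / 3 + 1 := by omega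
      have e2 : (k + 1) % 3 = 0 := by omega
      rw [e1, e2, pow_succ, if_neg (Nat.not_lt_zero _)]
      by_cases hj2 : j.val = 2
      · rw [if_pos (by omega), if_neg (by omega)]; field_simp
      · rw [if_neg (by omega), if_pos (by omega)]; field_simp
    · have e1 : (k + 1) / 3 = k / 3 := by omega
      have e2 : (k + 1) % 3 = k % 3 + 1 := by omega
      rw [e1, e2]
      rcases lt_trichotomy j.val (k % 3) with h | h | h
      · rw [if_neg (by omega), if_pos (by omega), if_pos (by omega)]
      · rw [if_pos (by omega), if_neg (by omega), if_pos (by omega)]; ring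
      · rw [if_neg (by omega), if_neg (by omega), if_neg (by omega)]

/-- Measured in side lengths the radius no longer depends on the level: it is `p / 2` in the
direction of the next bisection and `p / 2 + 1` in the other. -/
theorem Data.nbhdRadius_two (D : Data 2) (k : ℕ) (j : Fin 2) :
    D.nbhdRadius k j = sideLength 2 k j * (if dir 2 k = j then (D.p j : ℝ) / 2 else D.p j / 2 + 1) := by
  obtain ⟨q, hq⟩ := D.p_odd j
  have e1 : D.p j / 2 = q := by omega
  have e2 : (D.p j + 1) / 2 = q + 1 := by omega
  rw [Data.nbhdRadius, if_pos rfl, sideLength_two, e1, e2, hq]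
  simp only [Fin.ext_iff, dir_val]
  have hj := j.isLt
  push_cast
  rcases Nat.mod_two_eq_zero_or_one k with h | h
  · have e3 : (k + 1) / 2 = k / 2 := by omega
    rw [h, e3, if_pos rfl, ite_self]
    by_cases h0 : j.val = 0
    · rw [if_pos h0, if_pos h0.symm]; ring
    · rw [if_neg h0, if_neg (Ne.symm h0)]; ring
  · have e3 : (k + 1) / 2 = k / 2 + 1 := by omega
    rw [h, e3, if_neg one_ne_zero]
    by_cases h0 : j.val = 0
    · rw [if_pos h0, if_pos h0, if_neg (by omega)]; ring
    · rw [if_neg h0, if_neg h0, if_pos (by omega), pow_succ]; field_simp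

theorem Data.nbhdRadius_three (D : Data 3) (k : ℕ) (j : Fin 3) :
    D.nbhdRadius k j = sideLength 3 k j * ((D.p j : ℝ) + 3 / 2) := by
  rw [Data.nbhdRadius, if_neg (by norm_num), sideLength_three]
  split_ifs <;> ring

/-- The properties of the extent of the generalized neighborhoods which the analysis of the meshes
uses. -/
structure Data.WideNbhds (D : Data d) : Prop where
  half_p_le : ∀ k j, sideLength d k j * ((D.p j : ℝ) / 2) ≤ D.nbhdRadius k j
  half_p_add_one_le : ∀ k j, dir d k ≠ j →
    sideLength d k j * ((D.p j : ℝ) / 2 + 1) ≤ D.nbhdRadius k j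
  succ_le : ∀ k j, D.nbhdRadius (k + 1) j ≤ D.nbhdRadius k j
  succ_add_le : ∀ k, D.nbhdRadius (k + 1) (dir d k) + sideLength d (k + 1) (dir d k) / 2 ≤
    D.nbhdRadius k (dir d k)

/-- The first two bounds count how many grid lines fit into a neighborhood; the last two say that
the neighborhood of a child lies in that of its parent. -/
theorem Data.wideNbhds (hd : d = 2 ∨ d = 3) (D : Data d) : D.WideNbhds := by
  have hp : ∀ j, (3 : ℝ) ≤ D.p j := fun j => by exact_mod_cast D.three_le_p j
  have key : (∀ k j, sideLength d k j * ((D.p j : ℝ) / 2) ≤ D.nbhdRadius k j) ∧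
      (∀ k j, dir d k ≠ j → sideLength d k j * ((D.p j : ℝ) / 2 + 1) ≤ D.nbhdRadius k j) ∧
      (∀ k j, dir d k ≠ j → D.nbhdRadius (k + 1) j ≤ D.nbhdRadius k j) ∧
      (∀ k, D.nbhdRadius (k + 1) (dir d k) + sideLength d (k + 1) (dir d k) / 2 ≤
        D.nbhdRadius k (dir d k)) := by
    rcases hd with rfl | rfl
    · refine ⟨fun k j => ?_, fun k j hj => ?_, fun k j hj => ?_, fun k => ?_⟩
      · have := sideLength_pos k j
        rw [D.nbhdRadius_two]
        split_ifs <;> nlinarith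
      · rw [D.nbhdRadius_two, if_neg hj]
      · have h' : dir 2 (k + 1) = j := by
          have := j.isLt
          rw [Ne, Fin.ext_iff, dir_val] at hj
          rw [Fin.ext_iff, dir_val]
          omega
        have := sideLength_pos k j
        rw [D.nbhdRadius_two, D.nbhdRadius_two, if_neg hj, if_pos h', sideLength_succ_of_ne hj]
        nlinarith
      · have h' : dir 2 (k + 1) ≠ dir 2 k := by
          rw [Ne, Fin.ext_iff, dir_val, dir_val]
          omega
        have := sideLength_pos k (dir 2 k)
        have := hp (dir 2 k)
        -- In units of the parent side the claim is `(p / 2 + 1) / 2 + 1 / 4 ≤ p / 2`, that is `3 ≤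
        -- p`, with equality for cubic degree.
        rw [D.nbhdRadius_two, D.nbhdRadius_two, if_neg h', if_pos rfl, sideLength_succ_dir]
        nlinarith
    · refine ⟨fun k j => ?_, fun k j hj => ?_, fun k j hj => ?_, fun k => ?_⟩
      · have := sideLength_pos k j
        have := hp j
        rw [D.nbhdRadius_three]
        nlinarith
      · have := sideLength_pos k j
        have := hp j
        rw [D.nbhdRadius_three]
        nlinarith
      · rw [D.nbhdRadius_three, D.nbhdRadius_three, sideLength_succ_of_ne hj]
      · have := sideLength_pos k (dir 3 k)
        have := hp (dir 3 k)
        rw [D.nbhdRadius_three, D.nbhdRadius_three, sideLength_succ_dir]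
        nlinarith
  refine ⟨key.1, key.2.1, fun k j => ?_, key.2.2.2⟩
  by_cases hj : dir d k = j
  · subst hj
    have := key.2.2.2 k
    have := sideLength_pos (k + 1) (dir d k)
    linarith
  · exact key.2.2.1 k j hj

theorem Data.WideNbhds.sideLength_div_two_le {D : Data d} (hD : D.WideNbhds) (k : ℕ) (j : Fin d) :
    sideLength d k j / 2 ≤ D.nbhdRadius k j := by
  have hp : (3 : ℝ) ≤ D.p j := by exact_mod_cast D.three_le_p j
  have := sideLength_pos k j
  refine le_trans ?_ (hD.half_p_le k j)
  nlinarith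

theorem Data.WideNbhds.nbhdRadius_pos {D : Data d} (hD : D.WideNbhds) (k : ℕ) (j : Fin d) :
    0 < D.nbhdRadius k j :=
  (half_pos (sideLength_pos k j)).trans_le (hD.sideLength_div_two_le k j)

end TSpline

namespace TSpline

variable {d : ℕ}

/-! ### Elements outside the index/parametric domain -/

/-- The interval `(a', b')` is `(a, b)`, or a unit interval outside the index/parametric domain on a
side on which `(a, b)` touches the boundary. -/
def Data.MirrorSide (D : Data d) (j : Fin d) (a b a' b' : ℝ) : Prop :=
  (a' = a ∧ b' = b) ∨
    (a = (D.p j : ℝ) + 1 ∧ ∃ l : ℕ, 1 ≤ l ∧ l ≤ D.p j ∧ a' = l ∧ b' = l + 1) ∨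
    (b = (D.n j : ℝ) + 1 ∧ ∃ l : ℕ, D.n j + 1 ≤ l ∧ l ≤ D.n j + D.p j ∧ a' = l ∧ b' = l + 1)

/-- The element `e'` prolongs the element `e` of the index/parametric domain. -/
def Data.Mirror (D : Data d) (e e' : Elem d) : Prop :=
  e'.level = e.level ∧ ∀ j, D.MirrorSide j (e.lo j) (e.hi j) (e'.lo j) (e'.hi j)

/-- All prolongations of the elements in `S`. -/
def Data.prolong (D : Data d) (S : Set (Elem d)) : Set (Elem d) :=
  {e' | ∃ e ∈ S, D.Mirror e e'}

theorem Data.Mirror.refl (D : Data d) (e : Elem d) : D.Mirror e e :=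
  ⟨rfl, fun _ => Or.inl ⟨rfl, rfl⟩⟩

/-- The element lies in the index/parametric domain. -/
def Data.Inside (D : Data d) (e : Elem d) : Prop :=
  ∀ j, (D.p j : ℝ) + 1 ≤ e.lo j ∧ e.hi j ≤ (D.n j : ℝ) + 1

theorem Data.p_lt_n_real (D : Data d) (j : Fin d) : (D.p j : ℝ) + 1 ≤ D.n j := by
  exact_mod_cast D.p_lt_n j

theorem Data.knotAt_eq_succ_left (D : Data d) {j : Fin d} {l : ℕ} (h1 : 1 ≤ l) (h2 : l ≤ D.p j) :
    D.knotAt j l = D.knotAt j (l + 1) := by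
  have h4 : (l : ℝ) + 1 = ((l + 1 : ℕ) : ℝ) := by push_cast; rfl
  rw [h4, D.knotAt_natCast, D.knotAt_natCast, D.knot_left j l h1 (by omega),
    D.knot_left j (l + 1) (by omega) (by omega)]

theorem Data.knotAt_eq_succ_right (D : Data d) {j : Fin d} {l : ℕ} (h1 : D.n j + 1 ≤ l)
    (h2 : l ≤ D.n j + D.p j) : D.knotAt j l = D.knotAt j (l + 1) := by
  have h4 : (l : ℝ) + 1 = ((l + 1 : ℕ) : ℝ) := by push_cast; rfl
  rw [h4, D.knotAt_natCast, D.knotAt_natCast, D.knot_right j l h1 (by omega),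
    D.knot_right j (l + 1) (by omega) (by omega)]

/-- The midpoint of a prolongation is projected to the closure of the original element. -/
theorem Data.Mirror.proj_mid {D : Data d} {e e' : Elem d} (h : D.Mirror e e') (he : D.Inside e)
    (hlt : ∀ j, e.lo j < e.hi j) (j : Fin d) :
    (e'.lo j = e.lo j ∧ e'.hi j = e.hi j ∧ D.proj e'.mid j = e.mid j) ∨
      (e'.hi j ≤ (D.p j : ℝ) + 1 ∧ D.proj e'.mid j = e.lo j ∧ e.lo j = (D.p j : ℝ) + 1 ∧
        D.knotAt j (e'.lo j) = D.knotAt j (e'.hi j)) ∨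
      ((D.n j : ℝ) + 1 ≤ e'.lo j ∧ D.proj e'.mid j = e.hi j ∧ e.hi j = (D.n j : ℝ) + 1 ∧
        D.knotAt j (e'.lo j) = D.knotAt j (e'.hi j)) := by
  have hpn := D.p_lt_n_real j
  have hlt := hlt j
  obtain ⟨he1, he2⟩ := he j
  rcases h.2 j with ⟨h1, h2⟩ | ⟨h1, l, hl1, hl2, h2, h3⟩ | ⟨h1, l, hl1, hl2, h2, h3⟩
  · left
    refine ⟨h1, h2, ?_⟩
    simp only [Data.proj, Elem.mid, h1, h2]
    rw [max_eq_left (by linarith), min_eq_left (by linarith)]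
  · right; left
    have hl : (l : ℝ) ≤ D.p j := by exact_mod_cast hl2
    refine ⟨by linarith, ?_, h1, ?_⟩
    · simp only [Data.proj, Elem.mid, h1, h2, h3]
      rw [max_eq_right (by linarith), min_eq_left (by linarith)]
    · rw [h2, h3, D.knotAt_eq_succ_left hl1 hl2]
  · right; right
    have hl : (D.n j : ℝ) + 1 ≤ l := by exact_mod_cast hl1
    refine ⟨by linarith, ?_, h1, ?_⟩
    · simp only [Data.proj, Elem.mid, h1, h2, h3]
      rw [max_eq_left (by linarith), min_eq_right (by linarith)]
    · rw [h2, h3, D.knotAt_eq_succ_right hl1 hl2]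

/-- The boxes of the elements intersect. -/
def Elem.Overlap (e f : Elem d) : Prop :=
  ∀ j, e.lo j < f.hi j ∧ f.lo j < e.hi j

/-- In each direction `g` either keeps the side of its source or lies beyond a boundary that the
source touches. Two sources of `g` therefore have overlapping sides, and in a mesh without overlaps
a prolongation has only one source. -/
theorem Data.Mirror.overlap {D : Data d} {e f g : Elem d} (he : D.Mirror e g) (hf : D.Mirror f g)
    (hei : D.Inside e) (hfi : D.Inside f) (helt : ∀ j, e.lo j < e.hi j)
    (hflt : ∀ j, f.lo j < f.hi j) : e.Overlap f := by
  intro j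
  have hpn := D.p_lt_n_real j
  have := hei j
  have := hfi j
  have := helt j
  have := hflt j
  rcases he.proj_mid hei helt j with h1 | h1 | h1 <;>
    rcases hf.proj_mid hfi hflt j with h2 | h2 | h2 <;>
    refine ⟨?_, ?_⟩ <;> linarith [h1.1, h1.2.1, h1.2.2, h2.1, h2.2.1, h2.2.2]

theorem Data.knotAt_lt_knotAt (D : Data d) {e : Elem d} (he : D.Inside e) {j : Fin d}
    (hlt : e.lo j < e.hi j) : D.knotAt j (e.lo j) < D.knotAt j (e.hi j) :=
  D.knotAt_strictMonoOn j ⟨(he j).1, hlt.le.trans (he j).2⟩ ⟨(he j).1.trans hlt.le, (he j).2⟩ hlt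

/-! ### The two halves of an element -/

section

variable [NeZero d]

/-- The lower half of an element. -/
noncomputable def Elem.lower (e : Elem d) : Elem d :=
  ⟨e.lo, Function.update e.hi (dir d e.level) (e.mid (dir d e.level)), e.level + 1⟩

/-- The upper half of an element. -/
noncomputable def Elem.upper (e : Elem d) : Elem d :=
  ⟨Function.update e.lo (dir d e.level) (e.mid (dir d e.level)), e.hi, e.level + 1⟩

/-- `e'` is one of the two halves of `e`. -/
def Elem.IsHalf (e e' : Elem d) : Prop :=
  e' = e.lower ∨ e' = e.upper

theorem Elem.IsHalf.level {e e' : Elem d} (h : e.IsHalf e') : e'.level = e.level + 1 := by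
  rcases h with rfl | rfl <;> rfl

theorem Elem.IsHalf.side_of_ne {e e' : Elem d} (h : e.IsHalf e') {j : Fin d}
    (hj : j ≠ dir d e.level) : e'.lo j = e.lo j ∧ e'.hi j = e.hi j := by
  rcases h with rfl | rfl <;> simp [Elem.lower, Elem.upper, hj]

theorem Elem.IsHalf.subset {e e' : Elem d} (h : e.IsHalf e') (hlt : ∀ j, e.lo j < e.hi j)
    (j : Fin d) : e.lo j ≤ e'.lo j ∧ e'.hi j ≤ e.hi j := by
  have := hlt j
  by_cases hj : j = dir d e.level
  · subst hj
    have h1 : e.lo (dir d e.level) ≤ e.mid (dir d e.level) := by rw [Elem.mid]; linarith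
    have h2 : e.mid (dir d e.level) ≤ e.hi (dir d e.level) := by rw [Elem.mid]; linarith
    rcases h with rfl | rfl <;> simp [Elem.lower, Elem.upper, h1, h2]
  · obtain ⟨h1, h2⟩ := h.side_of_ne hj
    exact ⟨h1.ge, h2.le⟩

theorem Elem.IsHalf.isCell {e e' : Elem d} (h : e.IsHalf e') (he : e.IsCell) : e'.IsCell := by
  intro j
  rw [h.level]
  by_cases hj : j = dir d e.level
  · subst hj
    have h1 := he.onGrid_mid
    have h2 := sideLength_succ_dir (d := d) e.level
    have h3 := he.mid_sub_lo (dir d e.level)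
    have h4 := he.hi_eq_mid (dir d e.level)
    rw [← h2] at h3 h4
    rcases h with rfl | rfl
    · simp only [Elem.lower, Function.update_self]
      exact ⟨(he _).1.succ, h3⟩
    · simp only [Elem.upper, Function.update_self]
      exact ⟨h1, h4⟩
  · obtain ⟨h1, h2⟩ := h.side_of_ne hj
    rw [h1, h2, sideLength_succ_of_ne (Ne.symm hj)]
    exact ⟨(he j).1.succ, (he j).2⟩

theorem Elem.IsHalf.eq_of_overlap {e f g : Elem d} (hf : e.IsHalf f) (hg : e.IsHalf g)
    (h : f.Overlap g) : f = g := by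
  have h := h (dir d e.level)
  rcases hf with rfl | rfl <;> rcases hg with rfl | rfl
  · rfl
  · simp [Elem.lower, Elem.upper] at h
  · simp [Elem.lower, Elem.upper] at h
  · rfl

theorem Data.mem_bisect_of_ne (D : Data d) {e e' : Elem d}
    (h : D.knotAt (dir d e.level) (e.lo (dir d e.level)) ≠
      D.knotAt (dir d e.level) (e.hi (dir d e.level))) :
    e' ∈ D.bisect e ↔ e.IsHalf e' := by
  simp only [Data.bisect, Set.mem_ofPred_eq]
  constructor
  · rintro (⟨-, h'⟩ | ⟨h', -⟩)
    · exact h'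
    · exact absurd h' h
  · exact fun h' => Or.inl ⟨h, h'⟩

theorem Data.mem_bisect_of_eq (D : Data d) {e e' : Elem d}
    (h : D.knotAt (dir d e.level) (e.lo (dir d e.level)) =
      D.knotAt (dir d e.level) (e.hi (dir d e.level))) :
    e' ∈ D.bisect e ↔ e' = ⟨e.lo, e.hi, e.level + 1⟩ := by
  simp only [Data.bisect, Set.mem_ofPred_eq]
  constructor
  · rintro (⟨h', -⟩ | ⟨-, h'⟩)
    · exact absurd h h'
    · exact h'
  · exact fun h' => Or.inr ⟨h, h'⟩

theorem Data.finite_bisect (D : Data d) (e : Elem d) : (D.bisect e).Finite := by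
  refine Set.Finite.subset (s := {e.lower, e.upper, ⟨e.lo, e.hi, e.level + 1⟩}) (by simp) ?_
  rintro e' (⟨-, h | h⟩ | ⟨-, h⟩)
  · exact Or.inl h
  · exact Or.inr (Or.inl h)
  · exact Or.inr (Or.inr h)

/-- Bisection commutes with prolongation. -/
theorem Data.exists_mirror_of_mem_bisect (D : Data d) {e g h : Elem d} (he : D.Inside e)
    (hlt : ∀ j, e.lo j < e.hi j) (hg : D.Mirror e g) (hh : h ∈ D.bisect g) :
    ∃ e', e.IsHalf e' ∧ D.Mirror e' h := by
  have hlev := hg.1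
  rcases hg.2 (dir d e.level) with ⟨h1, h2⟩ | hside | hside
  · have hne : D.knotAt (dir d g.level) (g.lo (dir d g.level)) ≠
        D.knotAt (dir d g.level) (g.hi (dir d g.level)) := by
      rw [hlev, h1, h2]; exact (D.knotAt_lt_knotAt he (hlt _)).ne
    have hmid : g.mid (dir d e.level) = e.mid (dir d e.level) := by rw [Elem.mid, Elem.mid, h1, h2]
    rcases (D.mem_bisect_of_ne hne).1 hh with rfl | rfl
    · refine ⟨e.lower, Or.inl rfl, by simp [Elem.lower, hlev], fun j => ?_⟩
      by_cases hj : j = dir d e.level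
      · subst hj
        left
        simp [Elem.lower, hlev, h1, hmid]
      · simpa [Elem.lower, hlev, hj] using hg.2 j
    · refine ⟨e.upper, Or.inr rfl, by simp [Elem.upper, hlev], fun j => ?_⟩
      by_cases hj : j = dir d e.level
      · subst hj
        left
        simp [Elem.upper, hlev, h2, hmid]
      · simpa [Elem.upper, hlev, hj] using hg.2 j
  · have h2 : D.knotAt (dir d g.level) (g.lo (dir d g.level)) =
        D.knotAt (dir d g.level) (g.hi (dir d g.level)) := by
      obtain ⟨-, l, hl1, hl2, h4, h5⟩ := hside
      rw [hlev, h4, h5, D.knotAt_eq_succ_left hl1 hl2]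
    rw [(D.mem_bisect_of_eq h2).1 hh]
    -- Left of the domain the box of `g` is kept. It then prolongs only the half of `e` that still
    -- touches the left boundary; on the right this is the upper half.
    refine ⟨e.lower, Or.inl rfl, by simp [Elem.lower, hlev], fun j => ?_⟩
    by_cases hj : j = dir d e.level
    · subst hj
      right; left; exact hside
    · simpa [Elem.lower, hlev, hj] using hg.2 j
  · have h2 : D.knotAt (dir d g.level) (g.lo (dir d g.level)) =
        D.knotAt (dir d g.level) (g.hi (dir d g.level)) := by
      obtain ⟨-, l, hl1, hl2, h4, h5⟩ := hside
      rw [hlev, h4, h5, D.knotAt_eq_succ_right hl1 hl2]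
    rw [(D.mem_bisect_of_eq h2).1 hh]
    refine ⟨e.upper, Or.inr rfl, by simp [Elem.upper, hlev], fun j => ?_⟩
    by_cases hj : j = dir d e.level
    · subst hj
      right; right; exact hside
    · simpa [Elem.upper, hlev, hj] using hg.2 j

/-- The converse of the previous result. If `h` sits beyond the boundary in the bisected direction,
its predecessor is the same box one level lower; otherwise the half side is completed to the full
side of `e`. -/
theorem Data.exists_mem_bisect_of_mirror (D : Data d) {e e' h : Elem d} (he : D.Inside e)
    (hlt : ∀ j, e.lo j < e.hi j) (he' : e.IsHalf e') (hh : D.Mirror e' h) :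
    ∃ g, D.Mirror e g ∧ h ∈ D.bisect g := by
  have hlev : h.level = e.level + 1 := hh.1.trans he'.level
  have hi := he (dir d e.level)
  have hl := hlt (dir d e.level)
  have hmid1 : e.lo (dir d e.level) < e.mid (dir d e.level) := by rw [Elem.mid]; linarith
  have hmid2 : e.mid (dir d e.level) < e.hi (dir d e.level) := by rw [Elem.mid]; linarith
  have hside : ∀ j, j ≠ dir d e.level → D.MirrorSide j (e.lo j) (e.hi j) (h.lo j) (h.hi j) := by
    intro j hj
    have := hh.2 j
    rwa [(he'.side_of_ne hj).1, (he'.side_of_ne hj).2] at this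
  have outer : D.MirrorSide (dir d e.level) (e.lo (dir d e.level)) (e.hi (dir d e.level))
      (h.lo (dir d e.level)) (h.hi (dir d e.level)) →
      D.knotAt (dir d e.level) (h.lo (dir d e.level)) =
        D.knotAt (dir d e.level) (h.hi (dir d e.level)) →
      ∃ g, D.Mirror e g ∧ h ∈ D.bisect g := by
    intro h1 h2
    refine ⟨⟨h.lo, h.hi, e.level⟩, ⟨rfl, fun j => ?_⟩, ?_⟩
    · by_cases hj : j = dir d e.level
      · subst hj; exact h1
      · exact hside j hj
    · rw [D.mem_bisect_of_eq h2]
      ext1 <;> simp [hlev]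
  have inner : ∀ g : Elem d, g.level = e.level →
      g.lo (dir d e.level) = e.lo (dir d e.level) → g.hi (dir d e.level) = e.hi (dir d e.level) →
      (∀ j, j ≠ dir d e.level → g.lo j = h.lo j ∧ g.hi j = h.hi j) → g.IsHalf h →
      ∃ g, D.Mirror e g ∧ h ∈ D.bisect g := by
    intro g h1 h2 h3 h4 h5
    refine ⟨g, ⟨h1, fun j => ?_⟩, ?_⟩
    · by_cases hj : j = dir d e.level
      · subst hj; exact Or.inl ⟨h2, h3⟩
      · rw [(h4 j hj).1, (h4 j hj).2]; exact hside j hj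
    · rw [D.mem_bisect_of_ne]
      · exact h5
      · rw [h1, h2, h3]; exact (D.knotAt_lt_knotAt he hl).ne
  have hs := hh.2 (dir d e.level)
  rcases he' with rfl | rfl
  · simp only [Elem.lower, Function.update_self] at hs
    rcases hs with ⟨h1, h2⟩ | hs | hs
    · refine inner ⟨h.lo, Function.update h.hi (dir d e.level) (e.hi (dir d e.level)), e.level⟩ rfl
        h1 (by simp) (fun j hj => by simp [hj]) (Or.inl ?_)
      ext1
      · rfl
      · simp [Elem.lower, Elem.mid, h1, h2]
      · exact hlev
    · obtain ⟨-, l, hl1, hl2, h4, h5⟩ := id hs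
      exact outer (Or.inr (Or.inl hs)) (by rw [h4, h5, D.knotAt_eq_succ_left hl1 hl2])
    · linarith [hs.1]
  · simp only [Elem.upper, Function.update_self] at hs
    rcases hs with ⟨h1, h2⟩ | hs | hs
    · refine inner ⟨Function.update h.lo (dir d e.level) (e.lo (dir d e.level)), h.hi, e.level⟩ rfl
        (by simp) h2 (fun j hj => by simp [hj]) (Or.inr ?_)
      ext1
      · simp [Elem.upper, Elem.mid, h1, h2]
      · rfl
      · exact hlev
    · linarith [hs.1]
    · obtain ⟨-, l, hl1, hl2, h4, h5⟩ := id hs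
      exact outer (Or.inr (Or.inr hs)) (by rw [h4, h5, D.knotAt_eq_succ_right hl1 hl2])

end

end TSpline

namespace TSpline

variable {d : ℕ}

theorem Data.finite_initialMesh (D : Data d) : D.initialMesh.Finite := by
  have hfin : (Set.univ.pi fun j => Set.Iic (D.n j + D.p j)).Finite :=
    Set.Finite.pi fun j => Set.finite_Iic _
  refine (hfin.image fun l : Fin d → ℕ =>
    (⟨fun j => l j, fun j => l j + 1, 0⟩ : Elem d)).subset ?_
  rintro e ⟨he, l, hl, hle⟩
  refine ⟨l, fun j _ => (hl j).2, ?_⟩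
  ext j
  · exact (hle j).1.symm
  · exact (hle j).2.symm
  · exact he.symm

variable [NeZero d]

/-! ### The structure of admissible meshes -/

/-- The structure of an admissible index T-mesh `Q`, where `S` is the set of its elements in the
index/parametric domain. -/
structure Data.Structured (D : Data d) (S Q : Set (Elem d)) : Prop where
  finite : Q.Finite
  isCell : ∀ e ∈ S, e.IsCell
  inside : ∀ e ∈ S, D.Inside e
  -- Only generic points are required to be covered: boxes are open, and generic points lie on no
  -- face.
  cover : ∀ x ∈ D.ipDomain, Generic x → ∃ e ∈ S, x ∈ e.box
  eq_of_overlap : ∀ e ∈ S, ∀ f ∈ S, e.Overlap f → e = f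
  -- The condition concerns the neighborhoods of the proper ancestors `a` of `e`, not that of `e`
  -- itself: coarser neighbors of `e` are refined only at the moment when `e` is bisected.
  graded : ∀ e ∈ S, ∀ a : Elem d, a.IsCell → a.level < e.level →
    (∀ j, a.lo j ≤ e.lo j ∧ e.hi j ≤ a.hi j) → ∀ f ∈ S, ∀ x ∈ f.box,
    (∀ j, |x j - a.mid j| < D.nbhdRadius a.level j) → a.level ≤ f.level
  eq_prolong : Q = D.prolong S

namespace Data.Structured

variable {D : Data d} {S Q : Set (Elem d)}

theorem lt (hS : D.Structured S Q) {e : Elem d} (he : e ∈ S) (j : Fin d) : e.lo j < e.hi j :=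
  (hS.isCell e he).lo_lt_hi j

theorem subset (hS : D.Structured S Q) : S ⊆ Q := by
  rw [hS.eq_prolong]
  exact fun e he => ⟨e, he, Data.Mirror.refl D e⟩

theorem eq_of_mirror (hS : D.Structured S Q) {e f g : Elem d} (he : e ∈ S) (hf : f ∈ S)
    (h : D.Mirror e g) (h' : D.Mirror f g) : e = f :=
  hS.eq_of_overlap e he f hf
    (h.overlap h' (hS.inside e he) (hS.inside f hf) (hS.lt he) (hS.lt hf))

theorem box_subset (hS : D.Structured S Q) {e : Elem d} (he : e ∈ S) : e.box ⊆ D.ipDomain :=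
  fun _ hx j hj => ⟨(hS.inside e he j).1.trans_lt (hx j hj).1,
    (hx j hj).2.trans_le (hS.inside e he j).2⟩

theorem mirror_eq_of_side (hS : D.Structured S Q) {e g : Elem d} (he : e ∈ S) (h : D.Mirror e g)
    (hg : ∀ j, ¬ g.hi j ≤ (D.p j : ℝ) + 1 ∧ ¬ (D.n j : ℝ) + 1 ≤ g.lo j) : g = e := by
  ext j
  · rcases h.proj_mid (hS.inside e he) (hS.lt he) j with h1 | h1 | h1
    · exact h1.1
    · exact absurd h1.1 (hg j).1
    · exact absurd h1.1 (hg j).2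
  · rcases h.proj_mid (hS.inside e he) (hS.lt he) j with h1 | h1 | h1
    · exact h1.2.1
    · exact absurd h1.1 (hg j).1
    · exact absurd h1.1 (hg j).2
  · exact h.1

theorem mirror_lt (hS : D.Structured S Q) {e g : Elem d} (he : e ∈ S) (h : D.Mirror e g)
    (j : Fin d) : g.lo j < g.hi j := by
  have := hS.lt he j
  rcases h.2 j with ⟨h1, h2⟩ | ⟨h1, l, hl1, hl2, h2, h3⟩ | ⟨h1, l, hl1, hl2, h2, h3⟩ <;> linarith

theorem mem_of_box_subset (hS : D.Structured S Q) {g : Elem d} (hg : g ∈ Q)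
    (h : g.box ⊆ D.ipDomain) : g ∈ S := by
  rw [hS.eq_prolong] at hg
  obtain ⟨e, he, hm⟩ := hg
  have hmid : g.mid ∈ g.box := by
    intro j _
    have := hS.mirror_lt he hm j
    exact ⟨by rw [Elem.mid]; linarith, by rw [Elem.mid]; linarith⟩
  have h1 := h hmid
  rw [hS.mirror_eq_of_side he hm fun j => ?_]
  · exact he
  · have h2 := h1 j trivial
    have h3 := hmid j trivial
    constructor
    · intro h4; linarith [h2.1, h3.2]
    · intro h4; linarith [h2.2, h3.1]

/-- Elements whose parametric image has nonzero measure lie in the index/parametric domain. -/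
theorem mem_of_volume_ne_zero (hS : D.Structured S Q) {g : Elem d} (hg : g ∈ Q)
    (h : volume (D.paramImage g) ≠ 0) : g ∈ S := by
  rw [hS.eq_prolong] at hg
  obtain ⟨e, he, hm⟩ := hg
  have hne : ∀ j, D.knotAt j (g.lo j) ≠ D.knotAt j (g.hi j) := by
    intro j hj
    apply h
    rw [Data.paramImage, Real.volume_pi_Ioo]
    exact Finset.prod_eq_zero (Finset.mem_univ j) (by rw [hj]; simp)
  have : g = e := by
    have hside : ∀ j, g.lo j = e.lo j ∧ g.hi j = e.hi j := by
      intro j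
      rcases hm.proj_mid (hS.inside e he) (hS.lt he) j with h1 | h1 | h1
      · exact ⟨h1.1, h1.2.1⟩
      · exact absurd h1.2.2.2 (hne j)
      · exact absurd h1.2.2.2 (hne j)
    ext j
    · exact (hside j).1
    · exact (hside j).2
    · exact hm.1
  rwa [this]

end Data.Structured

/-! ### The initial mesh -/

theorem Data.structured_initialMesh (D : Data d) :
    D.Structured {e | e ∈ D.initialMesh ∧ D.Inside e} D.initialMesh where
  finite := D.finite_initialMesh
  isCell := by
    rintro e ⟨⟨he, l, -, hl⟩, -⟩ j
    rw [he, (hl j).1, (hl j).2]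
    exact ⟨onGrid_natCast 0 j (l j), by simp [sideLength]⟩
  inside := fun e he => he.2
  cover := by
    intro x hx hgen
    have hx0 : ∀ j, 0 ≤ x j := fun j => by
      have := (hx j trivial).1
      have : (0 : ℝ) ≤ D.p j := Nat.cast_nonneg _
      linarith
    have hl1 : ∀ j, D.p j + 1 ≤ ⌊x j⌋₊ := fun j =>
      Nat.le_floor (by push_cast; exact (hx j trivial).1.le)
    have hl2 : ∀ j, ⌊x j⌋₊ < D.n j + 1 := fun j =>
      (Nat.floor_lt (hx0 j)).2 (by push_cast; exact (hx j trivial).2)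
    refine ⟨⟨fun j => ⌊x j⌋₊, fun j => ⌊x j⌋₊ + 1, 0⟩, ⟨⟨rfl, fun j => ⌊x j⌋₊, fun j => ?_,
      fun j => ⟨rfl, rfl⟩⟩, fun j => ⟨?_, ?_⟩⟩, fun j _ => ⟨?_, ?_⟩⟩
    · have := hl1 j; have := hl2 j; dsimp only; omega
    · dsimp only; exact_mod_cast hl1 j
    · dsimp only; exact_mod_cast hl2 j
    · refine lt_of_le_of_ne (Nat.floor_le (hx0 j)) fun h => hgen j 0 ?_
      rw [← h]
      exact onGrid_natCast 0 j _
    · exact Nat.lt_floor_add_one _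
  eq_of_overlap := by
    rintro e ⟨⟨he, l, -, hl⟩, -⟩ f ⟨⟨hf, m, -, hm⟩, -⟩ h
    have : ∀ j, l j = m j := by
      intro j
      have h1 := h j
      rw [(hl j).1, (hl j).2, (hm j).1, (hm j).2] at h1
      have h2 : l j < m j + 1 := by exact_mod_cast h1.1
      have h3 : m j < l j + 1 := by exact_mod_cast h1.2
      omega
    ext j
    · rw [(hl j).1, (hm j).1, this j]
    · rw [(hl j).2, (hm j).2, this j]
    · rw [he, hf]
  graded := by
    rintro e ⟨⟨he, -⟩, -⟩ a - ha
    rw [he] at ha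
    exact absurd ha (Nat.not_lt_zero _)
  eq_prolong := by
    ext g
    constructor
    · rintro ⟨hg, l, hl, hlg⟩
      have hpn := D.p_lt_n
      -- The source of an initial cell is found by clamping its lower corner to the range from `p +
      -- 1` to `n`.
      have hc : ∀ j, ∃ m : ℕ, D.p j + 1 ≤ m ∧ m ≤ D.n j ∧
          D.MirrorSide j (m : ℝ) ((m : ℝ) + 1) (l j : ℝ) ((l j : ℝ) + 1) := by
        intro j
        have hpnj := hpn j
        rcases Nat.lt_or_ge (D.p j) (l j) with h | h
        · rcases Nat.lt_or_ge (D.n j) (l j) with h' | h'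
          · exact ⟨D.n j, by omega, le_rfl, Or.inr (Or.inr ⟨rfl, l j, h', by
              have := (hl j).2; omega, rfl, rfl⟩)⟩
          · exact ⟨l j, by omega, by omega, Or.inl ⟨rfl, rfl⟩⟩
        · exact ⟨D.p j + 1, le_rfl, by omega,
            Or.inr (Or.inl ⟨by push_cast; rfl, l j, (hl j).1, h, rfl, rfl⟩)⟩
      choose m hm1 hm2 hm3 using hc
      refine ⟨⟨fun j => m j, fun j => m j + 1, 0⟩, ⟨⟨rfl, m, fun j => ?_, fun j => ⟨rfl, rfl⟩⟩,
        fun j => ⟨?_, ?_⟩⟩, hg, fun j => ?_⟩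
      · have := hm1 j; have := hm2 j; omega
      · dsimp only; exact_mod_cast hm1 j
      · dsimp only; exact_mod_cast Nat.succ_le_succ (hm2 j)
      · rw [(hlg j).1, (hlg j).2]
        exact hm3 j
    · rintro ⟨e, ⟨⟨he, l, hl, hle⟩, -⟩, h1, h2⟩
      have hc : ∀ j, ∃ m : ℕ, (1 ≤ m ∧ m ≤ D.n j + D.p j) ∧ g.lo j = m ∧ g.hi j = m + 1 := by
        intro j
        rcases h2 j with ⟨h3, h4⟩ | ⟨-, m, hm1, hm2, h3, h4⟩ | ⟨-, m, hm1, hm2, h3, h4⟩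
        · exact ⟨l j, hl j, h3.trans (hle j).1, h4.trans (hle j).2⟩
        · exact ⟨m, ⟨hm1, by omega⟩, h3, h4⟩
        · exact ⟨m, ⟨by omega, hm2⟩, h3, h4⟩
      choose m hm1 hm2 using hc
      exact ⟨h1.trans he, m, hm1, hm2⟩

/-! ### Refinement -/

/-- The elements of the index/parametric domain after bisection of the elements in `C`. -/
def bisected (S C : Set (Elem d)) : Set (Elem d) :=
  (S \ C) ∪ {e' | ∃ e ∈ C, e.IsHalf e'}

namespace Data.Structured

variable {D : Data d} {S Q C : Set (Elem d)}

theorem exists_parent_of_mem_bisected (hS : D.Structured S Q) (hC : C ⊆ S) {e : Elem d}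
    (he : e ∈ bisected S C) : ∃ f ∈ S, ((f ∉ C ∧ e = f) ∨ (f ∈ C ∧ f.IsHalf e)) ∧
      ∀ j, f.lo j ≤ e.lo j ∧ e.hi j ≤ f.hi j := by
  rcases he with he | ⟨f, hf, h⟩
  · exact ⟨e, he.1, Or.inl ⟨he.2, rfl⟩, fun j => ⟨le_rfl, le_rfl⟩⟩
  · exact ⟨f, hC hf, Or.inr ⟨hf, h⟩, h.subset (hS.lt (hC hf))⟩

theorem prolong_bisected (hS : D.Structured S Q) (hC : C ⊆ S) :
    D.prolong (bisected S C) =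
      (Q \ D.prolong C) ∪ ⋃ e ∈ D.prolong C, D.bisect e := by
  ext g
  constructor
  · rintro ⟨e, he | ⟨f, hf, h⟩, hm⟩
    · left
      refine ⟨by rw [hS.eq_prolong]; exact ⟨e, he.1, hm⟩, ?_⟩
      rintro ⟨f, hf, hm'⟩
      exact he.2 (hS.eq_of_mirror he.1 (hC hf) hm hm' ▸ hf)
    · right
      obtain ⟨g', hg', hb⟩ :=
        D.exists_mem_bisect_of_mirror (hS.inside f (hC hf)) (hS.lt (hC hf)) h hm
      exact Set.mem_biUnion (show g' ∈ D.prolong C from ⟨f, hf, hg'⟩) hb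
  · rintro (⟨hg, hgC⟩ | hg)
    · rw [hS.eq_prolong] at hg
      obtain ⟨e, he, hm⟩ := hg
      exact ⟨e, Or.inl ⟨he, fun h => hgC ⟨e, h, hm⟩⟩, hm⟩
    · simp only [Set.mem_iUnion] at hg
      obtain ⟨g', ⟨e, he, hm⟩, hb⟩ := hg
      obtain ⟨e', h, hm'⟩ :=
        D.exists_mirror_of_mem_bisect (hS.inside e (hC he)) (hS.lt (hC he)) hm hb
      exact ⟨e', Or.inr ⟨e, he, h⟩, hm'⟩

/-- Only the grading needs an argument. A newly acquired proper ancestor is a bisected element `e₀`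
itself. Closure under neighbors bisects every coarser element meeting its neighborhood, and the old
grading at the parent of `e₀` shows that such an element was at most one level behind. -/
theorem bisect_step (hS : D.Structured S Q) (hD : D.WideNbhds) (hC : C ⊆ S)
    (hclosed : ∀ e ∈ C, ∀ f ∈ S, f.level < e.level →
      (∃ x ∈ f.box, ∀ j, |x j - e.mid j| < D.nbhdRadius e.level j) → f ∈ C) :
    D.Structured (bisected S C) ((Q \ D.prolong C) ∪ ⋃ e ∈ D.prolong C, D.bisect e) where
  finite := by
    have hfin : (D.prolong C).Finite := by
      refine hS.finite.subset ?_
      rw [hS.eq_prolong]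
      rintro g ⟨e, he, hm⟩
      exact ⟨e, hC he, hm⟩
    exact (hS.finite.subset Set.sdiff_subset).union
      (hfin.biUnion fun e _ => D.finite_bisect e)
  isCell := by
    rintro e (he | ⟨f, hf, h⟩)
    · exact hS.isCell e he.1
    · exact h.isCell (hS.isCell f (hC hf))
  inside := by
    intro e he j
    obtain ⟨f, hf, -, hsub⟩ := hS.exists_parent_of_mem_bisected hC he
    exact ⟨(hS.inside f hf j).1.trans (hsub j).1, (hsub j).2.trans (hS.inside f hf j).2⟩
  cover := by
    intro x hx hgen
    obtain ⟨e, he, hxe⟩ := hS.cover x hx hgen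
    by_cases h : e ∈ C
    · have hne : x (dir d e.level) ≠ e.mid (dir d e.level) := by
        intro h'
        refine hgen (dir d e.level) (e.level + 1) ?_
        rw [h']
        exact (hS.isCell e he).onGrid_mid
      rcases lt_or_gt_of_ne hne with hlt | hlt
      · refine ⟨e.lower, Or.inr ⟨e, h, Or.inl rfl⟩, fun j hj => ?_⟩
        by_cases hjd : j = dir d e.level
        · subst hjd
          simpa [Elem.lower] using ⟨(hxe _ hj).1, hlt⟩
        · simpa [Elem.lower, hjd] using hxe j hj
      · refine ⟨e.upper, Or.inr ⟨e, h, Or.inr rfl⟩, fun j hj => ?_⟩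
        by_cases hjd : j = dir d e.level
        · subst hjd
          simpa [Elem.upper] using ⟨hlt, (hxe _ hj).2⟩
        · simpa [Elem.upper, hjd] using hxe j hj
    · exact ⟨e, Or.inl ⟨he, h⟩, hxe⟩
  eq_of_overlap := by
    intro e he f hf h
    obtain ⟨e₀, he₀, he', hesub⟩ := hS.exists_parent_of_mem_bisected hC he
    obtain ⟨f₀, hf₀, hf', hfsub⟩ := hS.exists_parent_of_mem_bisected hC hf
    have h₀ : e₀ = f₀ := hS.eq_of_overlap e₀ he₀ f₀ hf₀ fun j =>
      ⟨(hesub j).1.trans_lt ((h j).1.trans_le (hfsub j).2),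
        (hfsub j).1.trans_lt ((h j).2.trans_le (hesub j).2)⟩
    subst h₀
    rcases he' with ⟨hn, rfl⟩ | ⟨hn, he'⟩ <;> rcases hf' with ⟨hn', rfl⟩ | ⟨hn', hf'⟩
    · rfl
    · exact absurd hn' hn
    · exact absurd hn hn'
    · exact he'.eq_of_overlap hf' h
  graded := by
    intro e he a ha hae hsub f hf x hx hnear
    obtain ⟨e₀, he₀, he', hesub⟩ := hS.exists_parent_of_mem_bisected hC he
    obtain ⟨f₀, hf₀, hf', hfsub⟩ := hS.exists_parent_of_mem_bisected hC hf
    have hx₀ : x ∈ f₀.box := fun j hj =>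
      ⟨(hfsub j).1.trans_lt (hx j hj).1, (hx j hj).2.trans_le (hfsub j).2⟩
    have hlevel : f₀.level ≤ f.level := by
      rcases hf' with ⟨-, rfl⟩ | ⟨-, hf'⟩
      · exact le_rfl
      · rw [hf'.level]; omega
    have hecell := hS.isCell e₀ he₀
    have helt : ∀ j, e.lo j < e.hi j := by
      rcases he' with ⟨-, rfl⟩ | ⟨-, he'⟩
      · exact hS.lt he₀
      · exact (he'.isCell hecell).lo_lt_hi
    by_cases hlev : a.level < e₀.level
    · have hsub₀ : ∀ j, a.lo j ≤ e₀.lo j ∧ e₀.hi j ≤ a.hi j := fun j =>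
        hecell.nested ha hlev.le
          ((hsub j).1.trans_lt ((helt j).trans_le (hesub j).2))
          ((hesub j).1.trans_lt ((helt j).trans_le (hsub j).2))
      exact (hS.graded e₀ he₀ a ha hlev hsub₀ f₀ hf₀ x hx₀ hnear).trans hlevel
    · rcases he' with ⟨-, rfl⟩ | ⟨heC, he'⟩
      · exact absurd hae hlev
      · have hl : a.level = e₀.level := by rw [he'.level] at hae; omega
        -- Cells of the same level that overlap coincide, so `a` is `e₀`.
        have hbox : ∀ j, a.lo j = e₀.lo j ∧ a.hi j = e₀.hi j := by
          intro j
          have h1 := (hsub j).1.trans_lt ((helt j).trans_le (hesub j).2)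
          have h2 := (hesub j).1.trans_lt ((helt j).trans_le (hsub j).2)
          have h3 := hecell.nested ha hl.le h1 h2
          have h4 := ha.nested hecell hl.ge h2 h1
          exact ⟨le_antisymm h3.1 h4.1, le_antisymm h4.2 h3.2⟩
        have hmid : a.mid = e₀.mid := by
          funext j
          rw [Elem.mid, Elem.mid, (hbox j).1, (hbox j).2]
        rw [hmid, hl] at hnear
        by_contra! hcon
        have hf₀lev : f₀.level < e₀.level := by omega
        have hf₀C : f₀ ∈ C := hclosed e₀ heC f₀ hf₀ hf₀lev ⟨x, hx₀, hnear⟩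
        have hflev : f.level = f₀.level + 1 := by
          rcases hf' with ⟨h, -⟩ | ⟨-, hf'⟩
          · exact absurd hf₀C h
          · exact hf'.level
        obtain ⟨k, hk⟩ : ∃ k, e₀.level = k + 1 := ⟨e₀.level - 1, by omega⟩
        obtain ⟨b, hb, hbl, hbsub, hbmid, hbmid'⟩ := hecell.exists_parent hk
        -- The neighborhood of `e₀` lies in that of its parent `b`, so `f₀` has at least level `k`.
        -- Its bisection then reaches level `k + 1`, contradicting the assumption that `f` is
        -- coarser than `e₀`.
        have := hS.graded e₀ he₀ b hb (by omega) hbsub f₀ hf₀ x hx₀ fun j => by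
          have hj := hnear j
          rw [hbl]
          rw [hk] at hj
          by_cases hjd : dir d k = j
          · subst hjd
            have h1 := hD.succ_add_le k
            have h2 := abs_sub_le (x (dir d k)) (e₀.mid (dir d k)) (b.mid (dir d k))
            linarith
          · rw [hbmid j hjd]
            exact hj.trans_le (hD.succ_le k j)
        omega
  eq_prolong := (hS.prolong_bisected hC).symm

theorem markClosure_subset (hS : D.Structured S Q) {M : Set (Elem d)} (hM : M ⊆ S) :
    D.markClosure Q M ⊆ S := by
  refine Set.iUnion_subset fun k => ?_
  induction k with
  | zero => simpa using hM
  | succ k ih =>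
    rw [Function.iterate_succ_apply']
    rintro e (he | ⟨he, f, -, hf⟩)
    · exact ih he
    · exact hS.mem_of_box_subset he hf.1.2.1

theorem mem_markClosure (hS : D.Structured S Q) {M : Set (Elem d)} {e f : Elem d}
    (he : e ∈ D.markClosure Q M) (hf : f ∈ S) (hlt : f.level < e.level)
    (h : ∃ x ∈ f.box, ∀ j, |x j - e.mid j| < D.nbhdRadius e.level j) :
    f ∈ D.markClosure Q M := by
  obtain ⟨k, hk⟩ := Set.mem_iUnion.1 he
  refine Set.mem_iUnion.2 ⟨k + 1, ?_⟩
  rw [Function.iterate_succ_apply']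
  exact Or.inr ⟨hS.subset hf, e, hk, ⟨hS.subset hf, hS.box_subset hf, h⟩, hlt⟩

theorem closure_box (hS : D.Structured S Q) {e : Elem d} (he : e ∈ S) :
    closure e.box = Set.univ.pi fun j => Set.Icc (e.lo j) (e.hi j) := by
  rw [Elem.box, closure_pi_set]
  congr 1
  funext j
  exact closure_Ioo (hS.lt he j).ne

/-- The projected midpoint of a prolongation of `f` is the midpoint of `f` in the kept directions
and a boundary coordinate of the domain in the others. If it lies in the closure of an element `e`
of the domain, then `e` and `f` overlap, hence agree. It lies in the open box of the source only if
the prolongation is the source itself. -/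
theorem markAll_eq (hS : D.Structured S Q) {M : Set (Elem d)} (hM : M ⊆ S) :
    D.markAll Q M = D.prolong (D.markClosure Q M) := by
  have hC := hS.markClosure_subset hM
  have hopen : ∀ e : Elem d, IsOpen e.box := fun e =>
    isOpen_set_pi Set.finite_univ fun j _ => isOpen_Ioo
  ext g
  constructor
  · rintro (hg | ⟨hg, e, he, hfr⟩)
    · exact ⟨g, hg, Data.Mirror.refl D g⟩
    · rw [hS.eq_prolong] at hg
      obtain ⟨f, hf, hm⟩ := hg
      have heS := hC he
      rw [(hopen e).frontier_eq, hS.closure_box heS] at hfr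
      have : e = f := by
        refine hS.eq_of_overlap e heS f hf fun j => ?_
        have h1 := hfr.1 j trivial
        have h2 := hS.lt heS j
        have h3 := hS.lt hf j
        have h4 := hS.inside e heS j
        have h5 := hS.inside f hf j
        have h6 : f.mid j = (f.lo j + f.hi j) / 2 := rfl
        rcases hm.proj_mid (hS.inside f hf) (hS.lt hf) j with ⟨-, -, h⟩ | ⟨-, h, h', -⟩ | ⟨-, h, h', -⟩ <;>
          rw [h] at h1 <;> exact ⟨by linarith [h1.1, h1.2], by linarith [h1.1, h1.2]⟩
      exact ⟨e, he, this ▸ hm⟩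
  · rintro ⟨e, he, hm⟩
    have heS := hC he
    by_cases hge : g = e
    · exact Or.inl (hge ▸ he)
    · right
      refine ⟨by rw [hS.eq_prolong]; exact ⟨e, heS, hm⟩, e, he, ?_⟩
      rw [(hopen e).frontier_eq, hS.closure_box heS]
      constructor
      · intro j _
        have h2 := hS.lt heS j
        have h6 : e.mid j = (e.lo j + e.hi j) / 2 := rfl
        rcases hm.proj_mid (hS.inside e heS) (hS.lt heS) j with ⟨-, -, h⟩ | ⟨-, h, -⟩ | ⟨-, h, -⟩ <;>
          rw [h] <;> exact ⟨by linarith, by linarith⟩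
      · intro hbox
        refine hge (hS.mirror_eq_of_side heS hm fun j => ?_)
        have h1 := hbox j trivial
        have h2 := hS.lt heS j
        have h3 := hS.inside e heS j
        have hpn := D.p_lt_n_real j
        rcases hm.proj_mid (hS.inside e heS) (hS.lt heS) j with ⟨h, h', -⟩ | ⟨-, h, -⟩ | ⟨-, h, -⟩
        · rw [h, h']
          exact ⟨by linarith, by linarith⟩
        · rw [h] at h1; exact absurd h1.1 (lt_irrefl _)
        · rw [h] at h1; exact absurd h1.2 (lt_irrefl _)

end Data.Structured

theorem Data.IsAdmissible.exists_structured {D : Data d} (hD : D.WideNbhds) {Q : Set (Elem d)}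
    (hQ : D.IsAdmissible Q) : ∃ S, D.Structured S Q := by
  induction hQ with
  | init => exact ⟨_, D.structured_initialMesh⟩
  | refine Q M hQ hM ih =>
    obtain ⟨S, hS⟩ := ih
    have hI : D.indexPreimage Q M ⊆ S := fun e he =>
      hS.mem_of_volume_ne_zero he.1 (hM he.2).1
    refine ⟨bisected S (D.markClosure Q (D.indexPreimage Q M)), ?_⟩
    rw [Data.refineIndex, hS.markAll_eq hI]
    exact hS.bisect_step hD (hS.markClosure_subset hI) fun e he f hf hlt h =>
      hS.mem_markClosure he hf hlt h

end TSpline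

namespace TSpline

variable {d : ℕ}

/-! ### Consecutive entries of index vectors -/

/-- The next larger entry of an index vector. -/
noncomputable def nextEntry (G : Set ℝ) (s : ℝ) : ℝ := sInf {r | r ∈ G ∧ s < r}

/-- The next smaller entry of an index vector. -/
noncomputable def prevEntry (G : Set ℝ) (s : ℝ) : ℝ := sSup {r | r ∈ G ∧ r < s}

theorem nextEntry_le {G : Set ℝ} {s r : ℝ} (hr : r ∈ G) (h : s < r) : nextEntry G s ≤ r :=
  csInf_le ⟨s, fun _ hx => hx.2.le⟩ ⟨hr, h⟩

theorem nextEntry_spec {G : Set ℝ} (hG : G.Finite) {s r : ℝ} (hr : r ∈ G) (h : s < r) :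
    s < nextEntry G s ∧ nextEntry G s ∈ G := by
  have := Set.Nonempty.csInf_mem (s := {r | r ∈ G ∧ s < r}) ⟨r, hr, h⟩
    (hG.subset fun _ hx => hx.1)
  exact ⟨this.2, this.1⟩

/-- The counting principle for local index vectors: with `t + 1` known entries beyond `s`, moving on
`t + 1` times cannot pass the last of them. -/
theorem iterate_nextEntry_le {G : Set ℝ} {g : ℕ → ℝ} (hg : StrictMono g) {s : ℝ} (hs : s < g 0)
    {t : ℕ} (hG : ∀ i ≤ t, g i ∈ G) : (nextEntry G)^[t + 1] s ≤ g t := by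
  induction t with
  | zero => exact nextEntry_le (hG 0 le_rfl) hs
  | succ t ih =>
    rw [Function.iterate_succ_apply']
    exact nextEntry_le (hG _ le_rfl)
      ((ih fun i hi => hG i (by omega)).trans_lt (hg (Nat.lt_succ_self t)))

/-- The known entries guarantee that every step still has an entry ahead of it, so the infimum is
attained and is not the default value for an empty set. -/
theorem iterate_nextEntry_spec {G : Set ℝ} (hfin : G.Finite) {g : ℕ → ℝ} (hg : StrictMono g)
    {s : ℝ} (hs : s < g 0) {t : ℕ} (hG : ∀ i ≤ t, g i ∈ G) :
    (nextEntry G)^[t] s < (nextEntry G)^[t + 1] s ∧ (nextEntry G)^[t + 1] s ∈ G := by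
  have h : (nextEntry G)^[t] s < g t := by
    cases t with
    | zero => exact hs
    | succ t =>
      exact (iterate_nextEntry_le hg hs fun i hi => hG i (by omega)).trans_lt
        (hg (Nat.lt_succ_self t))
  rw [Function.iterate_succ_apply']
  exact nextEntry_spec hfin (hG t le_rfl) h

theorem le_prevEntry {G : Set ℝ} {s r : ℝ} (hr : r ∈ G) (h : r < s) : r ≤ prevEntry G s :=
  le_csSup ⟨s, fun _ hx => hx.2.le⟩ ⟨hr, h⟩

theorem prevEntry_spec {G : Set ℝ} (hG : G.Finite) {s r : ℝ} (hr : r ∈ G) (h : r < s) :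
    prevEntry G s < s ∧ prevEntry G s ∈ G := by
  have := Set.Nonempty.csSup_mem (s := {r | r ∈ G ∧ r < s}) ⟨r, hr, h⟩
    (hG.subset fun _ hx => hx.1)
  exact ⟨this.2, this.1⟩

theorem le_iterate_prevEntry {G : Set ℝ} {g : ℕ → ℝ} (hg : StrictAnti g) {s : ℝ} (hs : g 0 < s)
    {t : ℕ} (hG : ∀ i ≤ t, g i ∈ G) : g t ≤ (prevEntry G)^[t + 1] s := by
  induction t with
  | zero => exact le_prevEntry (hG 0 le_rfl) hs
  | succ t ih =>
    rw [Function.iterate_succ_apply']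
    exact le_prevEntry (hG _ le_rfl)
      ((hg (Nat.lt_succ_self t)).trans_le (ih fun i hi => hG i (by omega)))

theorem iterate_prevEntry_spec {G : Set ℝ} (hfin : G.Finite) {g : ℕ → ℝ} (hg : StrictAnti g)
    {s : ℝ} (hs : g 0 < s) {t : ℕ} (hG : ∀ i ≤ t, g i ∈ G) :
    (prevEntry G)^[t + 1] s < (prevEntry G)^[t] s ∧ (prevEntry G)^[t + 1] s ∈ G := by
  have h : g t < (prevEntry G)^[t] s := by
    cases t with
    | zero => exact hs
    | succ t =>
      exact (hg (Nat.lt_succ_self t)).trans_le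
        (le_iterate_prevEntry hg hs fun i hi => hG i (by omega))
  rw [Function.iterate_succ_apply']
  exact prevEntry_spec hfin (hG t le_rfl) h

namespace Data

theorem localIndex_add (D : Data d) (Q : Set (Elem d)) (z : Fin d → ℝ) (j : Fin d) (t : ℕ) :
    D.localIndex Q z j ((D.p j + 1) / 2 + t) = (nextEntry (D.globalIndex Q z j))^[t] (z j) := by
  unfold localIndex
  simp only [Nat.le_add_right, if_true, Nat.add_sub_cancel_left]
  rfl

theorem localIndex_sub (D : Data d) (Q : Set (Elem d)) (z : Fin d → ℝ) (j : Fin d) {t : ℕ}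
    (ht : t ≤ (D.p j + 1) / 2) :
    D.localIndex Q z j ((D.p j + 1) / 2 - t) = (prevEntry (D.globalIndex Q z j))^[t] (z j) := by
  unfold localIndex
  rcases Nat.eq_zero_or_pos t with rfl | h
  · simp
  · have h1 : ¬ (D.p j + 1) / 2 ≤ (D.p j + 1) / 2 - t := by omega
    have h2 : (D.p j + 1) / 2 - ((D.p j + 1) / 2 - t) = t := by omega
    simp only [h1, if_false, h2]
    rfl

theorem localIndex_half (D : Data d) (Q : Set (Elem d)) (z : Fin d → ℝ) (j : Fin d) :
    D.localIndex Q z j ((D.p j + 1) / 2) = z j :=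
  D.localIndex_add Q z j 0

/-- The closed index domain. -/
def InDomain (D : Data d) (z : Fin d → ℝ) : Prop :=
  ∀ j, z j ∈ Set.Icc (1 : ℝ) ((D.n j : ℝ) + D.p j + 1)

theorem half_succ (D : Data d) (j : Fin d) : D.p j + 1 = 2 * ((D.p j + 1) / 2) := by
  obtain ⟨q, hq⟩ := D.p_odd j
  omega

theorem inDomain_of_mem_anchors (D : Data d) {Q : Set (Elem d)} {z : Fin d → ℝ}
    (hz : z ∈ D.anchors Q) : D.InDomain z := by
  intro j
  have h1 := hz.1 j
  have h2 : (0 : ℝ) ≤ (((D.p j + 1) / 2 : ℕ) : ℝ) := Nat.cast_nonneg _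
  exact ⟨by linarith, by linarith⟩

theorem proj_mem (D : Data d) (z : Fin d → ℝ) (j : Fin d) :
    (D.p j : ℝ) + 1 ≤ D.proj z j ∧ D.proj z j ≤ (D.n j : ℝ) + 1 := by
  have := D.p_lt_n_real j
  exact ⟨le_min (le_max_right _ _) (by linarith), min_le_right _ _⟩

theorem proj_le (D : Data d) {z : Fin d → ℝ} {j : Fin d} (h : (D.p j : ℝ) + 1 ≤ z j) :
    D.proj z j ≤ z j :=
  (min_le_left _ _).trans (max_le le_rfl h)

theorem le_proj (D : Data d) {z : Fin d → ℝ} {j : Fin d} (h : z j ≤ (D.n j : ℝ) + 1) :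
    z j ≤ D.proj z j :=
  le_min (le_max_left _ _) h

/-- If the closed side contains the projection of a coordinate, then some prolongation of the side
contains the coordinate itself. Thus global index vectors can be computed with projected anchors. -/
theorem exists_mirrorSide (D : Data d) (j : Fin d) {a b s : ℝ} (ha : (D.p j : ℝ) + 1 ≤ a)
    (hb : b ≤ (D.n j : ℝ) + 1) (hs : s ∈ Set.Icc (1 : ℝ) ((D.n j : ℝ) + D.p j + 1))
    (h : min (max s ((D.p j : ℝ) + 1)) ((D.n j : ℝ) + 1) ∈ Set.Icc a b) :
    ∃ a' b', D.MirrorSide j a b a' b' ∧ s ∈ Set.Icc a' b' := by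
  have hpn := D.p_lt_n_real j
  rcases lt_or_ge s ((D.p j : ℝ) + 1) with h1 | h1
  · rw [max_eq_right h1.le, min_eq_left (by linarith)] at h
    have h0 : 0 ≤ s := by linarith [hs.1]
    refine ⟨⌊s⌋₊, ⌊s⌋₊ + 1, Or.inr (Or.inl ⟨le_antisymm h.1 ha, ⌊s⌋₊, Nat.le_floor (by
      simpa using hs.1), ?_, rfl, rfl⟩), Nat.floor_le h0, (Nat.lt_floor_add_one s).le⟩
    exact Nat.lt_succ_iff.1 ((Nat.floor_lt h0).2 (by push_cast; exact h1))
  · rcases le_or_gt s ((D.n j : ℝ) + 1) with h2 | h2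
    · rw [max_eq_left h1, min_eq_left h2] at h
      exact ⟨a, b, Or.inl ⟨rfl, rfl⟩, h⟩
    · rw [max_eq_left h1, min_eq_right h2.le] at h
      -- On the right the unit interval is chosen by its upper end `⌈s⌉`: rounding down would leave
      -- the index domain when `s` is its last point.
      have hc1 : D.n j + 1 < ⌈s⌉₊ := Nat.lt_ceil.2 (by push_cast; exact h2)
      have hc2 : ⌈s⌉₊ ≤ D.n j + D.p j + 1 := Nat.ceil_le.2 (by push_cast; exact hs.2)
      obtain ⟨l, hl⟩ : ∃ l, ⌈s⌉₊ = l + 1 := ⟨⌈s⌉₊ - 1, by omega⟩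
      have hc3 := Nat.le_ceil s
      have hc4 : (l : ℝ) < s := Nat.lt_ceil.1 (by omega)
      rw [hl] at hc3
      push_cast at hc3
      exact ⟨l, l + 1, Or.inr (Or.inr ⟨le_antisymm hb h.2, l, by omega, by omega, rfl, rfl⟩),
        hc4.le, hc3⟩

end Data

variable [NeZero d]

namespace Data.Structured

variable {D : Data d} {S Q : Set (Elem d)} {z : Fin d → ℝ}

theorem finite_globalIndex (hS : D.Structured S Q) (z : Fin d → ℝ) (j : Fin d) :
    (D.globalIndex Q z j).Finite := by
  refine (hS.finite.biUnion fun e _ => (Set.toFinite {e.lo j, e.hi j})).subset ?_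
  rintro s ⟨-, e, he, hs, -⟩
  rw [Function.update_self] at hs
  exact Set.mem_biUnion he hs

/-- Entries strictly inside the domain stem from faces of elements of `S`, provided the other
coordinates of the anchor are replaced by their projections. -/
theorem exists_face (hS : D.Structured S Q) {j : Fin d} {s : ℝ} (hs : s ∈ D.globalIndex Q z j)
    (h1 : (D.p j : ℝ) + 1 < s) (h2 : s < (D.n j : ℝ) + 1) :
    ∃ e ∈ S, (s = e.lo j ∨ s = e.hi j) ∧ ∀ i, i ≠ j → D.proj z i ∈ Set.Icc (e.lo i) (e.hi i) := by
  obtain ⟨-, g, hg, hsg, hz⟩ := hs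
  rw [hS.eq_prolong] at hg
  obtain ⟨e, he, hm⟩ := hg
  rw [Function.update_self] at hsg
  refine ⟨e, he, ?_, fun i hi => ?_⟩
  · have := hS.mirror_lt he hm j
    rcases hm.proj_mid (hS.inside e he) (hS.lt he) j with ⟨h3, h4, -⟩ | ⟨h3, -⟩ | ⟨h3, -⟩
    · rwa [h3, h4] at hsg
    · rcases hsg with h | h <;> linarith
    · rcases hsg with h | h <;> linarith
  · have hzi := hz i hi
    rw [Function.update_of_ne hi] at hzi
    have hlt := hS.lt he i
    have hpn := D.p_lt_n_real i
    have hin := hS.inside e he i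
    simp only [Data.proj]
    rcases hm.proj_mid (hS.inside e he) (hS.lt he) i with ⟨h3, h4, -⟩ | ⟨h3, -, h4, -⟩ | ⟨h3, -, h4, -⟩
    · rw [h3, h4] at hzi
      rw [max_eq_left (by linarith [hzi.1]), min_eq_left (by linarith [hzi.2])]
      exact hzi
    · rw [max_eq_right (hzi.2.trans h3), min_eq_left (by linarith)]
      exact ⟨h4.le, by linarith⟩
    · have := h3.trans hzi.1
      rw [max_eq_left (by linarith), min_eq_right this]
      exact ⟨by linarith, h4.ge⟩

theorem mem_globalIndex_of_mirrorSide (hS : D.Structured S Q) (hz : D.InDomain z) {j : Fin d}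
    {s a b : ℝ} (hs : s ∈ Set.Icc (1 : ℝ) ((D.n j : ℝ) + D.p j + 1)) {e : Elem d} (he : e ∈ S)
    (hab : D.MirrorSide j (e.lo j) (e.hi j) a b) (hsab : s = a ∨ s = b)
    (hze : ∀ i, i ≠ j → D.proj z i ∈ Set.Icc (e.lo i) (e.hi i)) : s ∈ D.globalIndex Q z j := by
  have hc : ∀ i, ∃ a' b', D.MirrorSide i (e.lo i) (e.hi i) a' b' ∧
      (i ≠ j → z i ∈ Set.Icc a' b') ∧ (i = j → s = a' ∨ s = b') := by
    intro i
    by_cases hi : i = j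
    · subst hi
      exact ⟨a, b, hab, fun h => absurd rfl h, fun _ => hsab⟩
    · obtain ⟨a', b', h1, h2⟩ := D.exists_mirrorSide i (hS.inside e he i).1 (hS.inside e he i).2
        (hz i) (hze i hi)
      exact ⟨a', b', h1, fun _ => h2, fun h => absurd h hi⟩
  choose a' b' h1 h2 h3 using hc
  refine ⟨hs, ⟨a', b', e.level⟩, ?_, ?_, fun i hi => ?_⟩
  · rw [hS.eq_prolong]
    exact ⟨e, he, rfl, h1⟩
  · rw [Function.update_self]
    exact h3 j rfl
  · rw [Function.update_of_ne hi]
    exact h2 i hi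

theorem mem_globalIndex (hS : D.Structured S Q) (hz : D.InDomain z) {j : Fin d} {s : ℝ}
    {e : Elem d} (he : e ∈ S) (hs : s = e.lo j ∨ s = e.hi j)
    (hze : ∀ i, i ≠ j → D.proj z i ∈ Set.Icc (e.lo i) (e.hi i)) : s ∈ D.globalIndex Q z j := by
  refine hS.mem_globalIndex_of_mirrorSide hz ?_ he (Or.inl ⟨rfl, rfl⟩) hs hze
  have h1 := hS.inside e he j
  have h2 := hS.lt he j
  have h3 : (0 : ℝ) ≤ D.p j := Nat.cast_nonneg _
  rcases hs with rfl | rfl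
  · exact ⟨by linarith, by linarith⟩
  · exact ⟨by linarith, by linarith⟩

/-- Generic points are dense in the open box between `α` and `β`, and finitely many elements cover
them, so the closures of these elements cover the closed box. The element found meets the open box,
as the level bounds of the grading require; touching it would not suffice. -/
theorem exists_mem_closure (hS : D.Structured S Q) {α β c : Fin d → ℝ} (hαβ : ∀ j, α j < β j)
    (hα : ∀ j, (D.p j : ℝ) + 1 ≤ α j) (hβ : ∀ j, β j ≤ (D.n j : ℝ) + 1)
    (hc : ∀ j, c j ∈ Set.Icc (α j) (β j)) :
    ∃ e ∈ S, (∃ x ∈ e.box, ∀ j, x j ∈ Set.Ioo (α j) (β j)) ∧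
      ∀ j, c j ∈ Set.Icc (e.lo j) (e.hi j) := by
  set N : Set (Fin d → ℝ) := Set.univ.pi fun j => Set.Ioo (α j) (β j) with hN
  have hNo : IsOpen N := isOpen_set_pi Set.finite_univ fun j _ => isOpen_Ioo
  set T : Set (Elem d) := {e | e ∈ S ∧ ∃ x ∈ e.box, x ∈ N}
  have hT : T.Finite := hS.finite.subset fun e he => hS.subset he.1
  have hsub : N ∩ {x | Generic x} ⊆ ⋃ e ∈ T, e.box := by
    rintro x ⟨hx, hgen⟩
    obtain ⟨e, he, hxe⟩ := hS.cover x (fun j hj =>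
      ⟨(hα j).trans_lt (hx j hj).1, (hx j hj).2.trans_le (hβ j)⟩) hgen
    exact Set.mem_biUnion (show e ∈ T from ⟨he, x, hxe, hx⟩) hxe
  have hcN : c ∈ closure N := by
    rw [hN, closure_pi_set]
    intro j _
    simpa only [closure_Ioo (hαβ j).ne] using hc j
  have h1 : N ⊆ closure (N ∩ {x | Generic x}) := dense_generic.open_subset_closure_inter hNo
  have h2 : c ∈ closure (⋃ e ∈ T, e.box) :=
    closure_mono hsub (closure_minimal h1 isClosed_closure hcN)
  rw [hT.closure_biUnion] at h2
  simp only [Set.mem_iUnion] at h2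
  obtain ⟨e, ⟨he, x, hx, hxN⟩, hce⟩ := h2
  rw [hS.closure_box he] at hce
  exact ⟨e, he, ⟨x, hx, fun j => hxN j trivial⟩, fun j => hce j trivial⟩

theorem exists_mem_Icc (hS : D.Structured S Q) {c : Fin d → ℝ}
    (hc : ∀ j, c j ∈ Set.Icc ((D.p j : ℝ) + 1) ((D.n j : ℝ) + 1)) :
    ∃ e ∈ S, ∀ j, c j ∈ Set.Icc (e.lo j) (e.hi j) := by
  obtain ⟨e, he, -, h⟩ := hS.exists_mem_closure
    (fun j => (lt_add_one _).trans_le (add_le_add_left (D.p_lt_n_real j) 1))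
    (fun j => le_rfl) (fun j => le_rfl) hc
  exact ⟨e, he, h⟩

/-- An element touching the boundary at the projected anchor has a prolongation over each outer unit
interval. The outer integers therefore occur in every global index vector and make the local index
vectors complete. -/
theorem natCast_mem_globalIndex_left (hS : D.Structured S Q) (hz : D.InDomain z) {j : Fin d}
    {l : ℕ} (h1 : 1 ≤ l) (h2 : l ≤ D.p j + 1) : (l : ℝ) ∈ D.globalIndex Q z j := by
  have hpn := D.p_lt_n_real j
  have hp := D.three_le_p j
  obtain ⟨e, he, hc⟩ := hS.exists_mem_Icc (c := Function.update (D.proj z) j ((D.p j : ℝ) + 1))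
    fun i => by
      by_cases hi : i = j
      · subst hi
        simp only [Function.update_self]
        exact ⟨le_rfl, by linarith⟩
      · simp only [Function.update_of_ne hi]
        exact D.proj_mem z i
  have hlo : e.lo j = (D.p j : ℝ) + 1 := by
    have := hc j
    rw [Function.update_self] at this
    exact le_antisymm this.1 (hS.inside e he j).1
  have hze : ∀ i, i ≠ j → D.proj z i ∈ Set.Icc (e.lo i) (e.hi i) := fun i hi => by
    have := hc i
    rwa [Function.update_of_ne hi] at this
  have h2' : (l : ℝ) ≤ (D.p j : ℝ) + 1 := by exact_mod_cast h2
  have hs : (l : ℝ) ∈ Set.Icc (1 : ℝ) ((D.n j : ℝ) + D.p j + 1) :=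
    ⟨by exact_mod_cast h1, by linarith [(Nat.cast_nonneg (D.n j) : (0 : ℝ) ≤ D.n j)]⟩
  rcases Nat.lt_or_ge 1 l with h3 | h3
  · obtain ⟨m, rfl⟩ : ∃ m, l = m + 1 := ⟨l - 1, by omega⟩
    exact hS.mem_globalIndex_of_mirrorSide hz hs he
      (Or.inr (Or.inl ⟨hlo, m, by omega, by omega, rfl, rfl⟩)) (Or.inr (by push_cast; rfl)) hze
  · exact hS.mem_globalIndex_of_mirrorSide hz hs he
      (Or.inr (Or.inl ⟨hlo, l, h1, by omega, rfl, rfl⟩)) (Or.inl rfl) hze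

theorem natCast_mem_globalIndex_right (hS : D.Structured S Q) (hz : D.InDomain z) {j : Fin d}
    {l : ℕ} (h1 : D.n j + 1 ≤ l) (h2 : l ≤ D.n j + D.p j + 1) :
    (l : ℝ) ∈ D.globalIndex Q z j := by
  have hpn := D.p_lt_n_real j
  have hp := D.three_le_p j
  obtain ⟨e, he, hc⟩ := hS.exists_mem_Icc (c := Function.update (D.proj z) j ((D.n j : ℝ) + 1))
    fun i => by
      by_cases hi : i = j
      · subst hi
        simp only [Function.update_self]
        exact ⟨by linarith, le_rfl⟩
      · simp only [Function.update_of_ne hi]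
        exact D.proj_mem z i
  have hhi : e.hi j = (D.n j : ℝ) + 1 := by
    have := hc j
    rw [Function.update_self] at this
    exact le_antisymm (hS.inside e he j).2 this.2
  have hze : ∀ i, i ≠ j → D.proj z i ∈ Set.Icc (e.lo i) (e.hi i) := fun i hi => by
    have := hc i
    rwa [Function.update_of_ne hi] at this
  have hs : (l : ℝ) ∈ Set.Icc (1 : ℝ) ((D.n j : ℝ) + D.p j + 1) :=
    ⟨by exact_mod_cast (show 1 ≤ l by omega), by exact_mod_cast h2⟩
  rcases Nat.lt_or_ge (D.n j + 1) l with h3 | h3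
  · obtain ⟨m, rfl⟩ : ∃ m, l = m + 1 := ⟨l - 1, by omega⟩
    exact hS.mem_globalIndex_of_mirrorSide hz hs he
      (Or.inr (Or.inr ⟨hhi, m, by omega, by omega, rfl, rfl⟩)) (Or.inr (by push_cast; rfl)) hze
  · exact hS.mem_globalIndex_of_mirrorSide hz hs he
      (Or.inr (Or.inr ⟨hhi, l, h1, by omega, rfl, rfl⟩)) (Or.inl rfl) hze

/-! ### Local index vectors of anchors -/

theorem anchor_mem_globalIndex (hS : D.Structured S Q) (hz : z ∈ D.anchors Q) (j : Fin d) :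
    z j ∈ D.globalIndex Q z j := by
  obtain ⟨g, hg, hzg⟩ := hz.2
  have hg' := hg
  rw [hS.eq_prolong] at hg'
  obtain ⟨e, he, hm⟩ := hg'
  refine ⟨D.inDomain_of_mem_anchors hz j, g, hg, ?_, fun i _ => ?_⟩
  · rw [Function.update_eq_self]
    exact hzg j
  · rw [Function.update_eq_self]
    have := hS.mirror_lt he hm i
    rcases hzg i with h | h <;> rw [h]
    · exact ⟨le_rfl, this.le⟩
    · exact ⟨this.le, le_rfl⟩

theorem localIndex_right (hS : D.Structured S Q) (hz : z ∈ D.anchors Q) (j : Fin d) {t : ℕ}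
    (ht : t < (D.p j + 1) / 2) :
    D.localIndex Q z j ((D.p j + 1) / 2 + t) < D.localIndex Q z j ((D.p j + 1) / 2 + (t + 1)) ∧
      D.localIndex Q z j ((D.p j + 1) / 2 + (t + 1)) ∈ D.globalIndex Q z j := by
  have hdom := D.inDomain_of_mem_anchors hz
  have hc := D.half_succ j
  have h2 := (hz.1 j).2
  rw [D.localIndex_add, D.localIndex_add]
  generalize (D.p j + 1) / 2 = c at *
  -- Since `z j ≤ n + p + 1 - c`, the last `c` integers of the index domain lie to the right of the
  -- anchor. They are at least `n + 1` because `p + 1 = 2 * c`.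
  refine iterate_nextEntry_spec (hS.finite_globalIndex z j)
    (g := fun t => ((D.n j + D.p j + 2 - c + t : ℕ) : ℝ))
    (fun a b hab => by simpa using hab) ?_ fun i hi => ?_
  · have h3 : ((D.n j + D.p j + 2 - c + 0 : ℕ) : ℝ) + c = D.n j + D.p j + 2 := by
      exact_mod_cast (show D.n j + D.p j + 2 - c + 0 + c = D.n j + D.p j + 2 by omega)
    linarith
  · exact hS.natCast_mem_globalIndex_right hdom (by omega) (by omega)

theorem localIndex_left (hS : D.Structured S Q) (hz : z ∈ D.anchors Q) (j : Fin d) {t : ℕ}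
    (ht : t < (D.p j + 1) / 2) :
    D.localIndex Q z j ((D.p j + 1) / 2 - (t + 1)) < D.localIndex Q z j ((D.p j + 1) / 2 - t) ∧
      D.localIndex Q z j ((D.p j + 1) / 2 - (t + 1)) ∈ D.globalIndex Q z j := by
  have hdom := D.inDomain_of_mem_anchors hz
  have hc := D.half_succ j
  have h2 := (hz.1 j).1
  rw [D.localIndex_sub _ _ _ (by omega), D.localIndex_sub _ _ _ (by omega)]
  generalize (D.p j + 1) / 2 = c at *
  -- Since `c + 1 ≤ z j`, the integers `c, …, 1` lie to the left of the anchor.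
  refine iterate_prevEntry_spec (hS.finite_globalIndex z j)
    (g := fun t => (c : ℝ) - t)
    (fun a b hab => by
      have : (a : ℝ) < b := by exact_mod_cast hab
      dsimp only
      linarith) ?_ fun i hi => ?_
  · simp only [Nat.cast_zero, sub_zero]
    linarith
  · have : (c : ℝ) - i = ((c - i : ℕ) : ℝ) := by
      rw [Nat.cast_sub (by omega)]
    rw [this]
    exact hS.natCast_mem_globalIndex_left hdom (by omega) (by omega)

theorem localIndex_mem (hS : D.Structured S Q) (hz : z ∈ D.anchors Q) (j : Fin d) {i : ℕ}
    (hi : i ≤ D.p j + 1) : D.localIndex Q z j i ∈ D.globalIndex Q z j := by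
  have hc := D.half_succ j
  rcases lt_trichotomy i ((D.p j + 1) / 2) with h | h | h
  · obtain ⟨t, ht, rfl⟩ : ∃ t, t < (D.p j + 1) / 2 ∧ i = (D.p j + 1) / 2 - (t + 1) :=
      ⟨(D.p j + 1) / 2 - i - 1, by omega, by omega⟩
    exact (hS.localIndex_left hz j ht).2
  · rw [h, D.localIndex_half]
    exact hS.anchor_mem_globalIndex hz j
  · obtain ⟨t, rfl⟩ : ∃ t, i = (D.p j + 1) / 2 + (t + 1) := ⟨i - (D.p j + 1) / 2 - 1, by omega⟩
    exact (hS.localIndex_right hz j (by omega)).2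

theorem localIndex_lt_succ (hS : D.Structured S Q) (hz : z ∈ D.anchors Q) (j : Fin d) {i : ℕ}
    (hi : i ≤ D.p j) : D.localIndex Q z j i < D.localIndex Q z j (i + 1) := by
  have hc := D.half_succ j
  rcases Nat.lt_or_ge i ((D.p j + 1) / 2) with h | h
  · have := (hS.localIndex_left hz j (t := (D.p j + 1) / 2 - i - 1) (by omega)).1
    rwa [show (D.p j + 1) / 2 - ((D.p j + 1) / 2 - i - 1 + 1) = i by omega,
      show (D.p j + 1) / 2 - ((D.p j + 1) / 2 - i - 1) = i + 1 by omega] at this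
  · have := (hS.localIndex_right hz j (t := i - (D.p j + 1) / 2) (by omega)).1
    rwa [show (D.p j + 1) / 2 + (i - (D.p j + 1) / 2) = i by omega,
      show (D.p j + 1) / 2 + (i - (D.p j + 1) / 2 + 1) = i + 1 by omega] at this

theorem localIndex_strictMono (hS : D.Structured S Q) (hz : z ∈ D.anchors Q) (j : Fin d) {i k : ℕ}
    (hik : i < k) (hk : k ≤ D.p j + 1) : D.localIndex Q z j i < D.localIndex Q z j k := by
  induction k, hik using Nat.le_induction with
  | base => exact hS.localIndex_lt_succ hz j (by omega)
  | succ k hk' ih => exact (ih (by omega)).trans (hS.localIndex_lt_succ hz j (by omega))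

theorem localIndex_mono (hS : D.Structured S Q) (hz : z ∈ D.anchors Q) (j : Fin d) {i k : ℕ}
    (hik : i ≤ k) (hk : k ≤ D.p j + 1) : D.localIndex Q z j i ≤ D.localIndex Q z j k := by
  rcases hik.lt_or_eq with h | h
  · exact (hS.localIndex_strictMono hz j h hk).le
  · rw [h]

end Data.Structured

end TSpline

/-! ### Where knots can cut an element -/

namespace TSpline

variable {d : ℕ} [NeZero d]

theorem exists_onGrid_succ {j : Fin d} {r : ℝ} {k k' : ℕ} (h : ¬ OnGrid k j r)
    (h' : OnGrid k' j r) : ∃ l, k ≤ l ∧ l < k' ∧ ¬ OnGrid l j r ∧ OnGrid (l + 1) j r := by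
  induction k' with
  | zero => exact absurd (h'.mono (Nat.zero_le k)) h
  | succ k' ih =>
    by_cases hk : OnGrid k' j r
    · obtain ⟨l, h1, h2, h3⟩ := ih hk
      exact ⟨l, h1, by omega, h3⟩
    · refine ⟨k', ?_, Nat.lt_succ_self _, hk, h'⟩
      by_contra! hlt
      exact h (h'.mono hlt)

/-- Passing to the next level refines the grid only in the direction of the bisection, and adds a
single point to the side of a cell. -/
theorem Elem.IsCell.eq_mid {a : Elem d} (ha : a.IsCell) {j : Fin d} {r : ℝ}
    (h1 : a.lo j ≤ r) (h2 : r ≤ a.hi j) (h : ¬ OnGrid a.level j r)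
    (h' : OnGrid (a.level + 1) j r) : dir d a.level = j ∧ r = a.mid j := by
  have hj : dir d a.level = j := by
    by_contra hj
    obtain ⟨m, rfl⟩ := h'
    exact h ⟨m, by rw [sideLength_succ_of_ne hj]⟩
  refine ⟨hj, ?_⟩
  subst hj
  have h3 : a.lo _ < r := lt_of_le_of_ne h1 fun h3 => h (h3 ▸ (ha _).1)
  have h4 : r < a.hi _ := lt_of_le_of_ne h2 fun h3 => h (h3 ▸ ha.onGrid_hi _)
  have hmid := ha.onGrid_mid
  have hs := sideLength_succ_dir (d := d) a.level
  have hlo := ha.mid_sub_lo (dir d a.level)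
  have hhi := ha.hi_eq_mid (dir d a.level)
  rcases lt_trichotomy r (a.mid (dir d a.level)) with h5 | h5 | h5
  · have := (ha _).1.succ.add_le_of_lt h' h3
    linarith
  · exact h5
  · have := hmid.add_le_of_lt h' h5
    linarith

/-- All elements that meet the neighborhood of the ancestor `a` of the element `f` have at least the
level of `a`. -/
structure Data.FineNbhd (D : Data d) (S : Set (Elem d)) (a f : Elem d) : Prop where
  isCell : a.IsCell
  mem : f ∈ S
  subset : ∀ j, a.lo j ≤ f.lo j ∧ f.hi j ≤ a.hi j
  level_le : ∀ g ∈ S, ∀ x ∈ g.box, (∀ j, |x j - a.mid j| < D.nbhdRadius a.level j) →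
    a.level ≤ g.level

namespace Data.Structured

variable {D : Data d} {S Q : Set (Elem d)} {z : Fin d → ℝ} {a f : Elem d}

/-- The point with `i`-th coordinate `w` and the other coordinates of the projected anchor lies in
the closure of an element meeting the neighborhood of `a`. This element is at least as fine as `a`,
so a grid line of the level of `a` cannot cross its interior and must contain one of its faces. -/
theorem grid_mem_globalIndex (hS : D.Structured S Q) (hD : D.WideNbhds) (hz : D.InDomain z)
    (hf : D.FineNbhd S a f) {i : Fin d} {w : ℝ} (hw : |w - a.mid i| ≤ D.nbhdRadius a.level i)
    (hw1 : (D.p i : ℝ) + 1 ≤ w) (hw2 : w ≤ (D.n i : ℝ) + 1) (hgrid : OnGrid a.level i w)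
    (hzl : ∀ l, l ≠ i → |D.proj z l - a.mid l| ≤ D.nbhdRadius a.level l) :
    w ∈ D.globalIndex Q z i := by
  have hnear : ∀ j, a.mid j - D.nbhdRadius a.level j ≤ f.lo j ∧
      f.hi j ≤ a.mid j + D.nbhdRadius a.level j := by
    intro j
    have h1 := hD.sideLength_div_two_le a.level j
    have h2 := hf.isCell.mid_sub_lo j
    have h3 := hf.isCell.hi_eq_mid j
    have h4 := hf.subset j
    exact ⟨by linarith, by linarith⟩
  obtain ⟨e, he, ⟨x, hx, hxN⟩, hc⟩ := hS.exists_mem_closure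
    (α := fun j => max ((D.p j : ℝ) + 1) (a.mid j - D.nbhdRadius a.level j))
    (β := fun j => min ((D.n j : ℝ) + 1) (a.mid j + D.nbhdRadius a.level j))
    (c := Function.update (D.proj z) i w)
    (fun j => (max_le (hS.inside f hf.mem j).1 (hnear j).1).trans_lt
      ((hS.lt hf.mem j).trans_le (le_min (hS.inside f hf.mem j).2 (hnear j).2)))
    (fun j => le_max_left _ _) (fun j => min_le_left _ _) (fun j => by
      by_cases hj : j = i
      · subst hj
        rw [Function.update_self]
        have := abs_le.1 hw
        exact ⟨max_le hw1 (by linarith), le_min hw2 (by linarith)⟩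
      · rw [Function.update_of_ne hj]
        have := abs_le.1 (hzl j hj)
        exact ⟨max_le (D.proj_mem z j).1 (by linarith), le_min (D.proj_mem z j).2 (by linarith)⟩)
  have hlev : a.level ≤ e.level := hf.level_le e he x hx fun j => by
    have h1 := hxN j
    have h2 := (le_max_right _ _).trans_lt h1.1
    have h3 := h1.2.trans_le (min_le_right _ _)
    rw [abs_lt]
    exact ⟨by linarith, by linarith⟩
  have hci := hc i
  rw [Function.update_self] at hci
  refine hS.mem_globalIndex hz he ?_ fun l hl => ?_
  · rcases (hS.isCell e he).le_or_le hlev hgrid with h | h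
    · exact Or.inl (le_antisymm h hci.1)
    · exact Or.inr (le_antisymm hci.2 h)
  · have := hc l
    rwa [Function.update_of_ne hl] at this

theorem abs_proj_sub_mid_le_of_mem (hD : D.WideNbhds) (hf : D.FineNbhd S a f) {l : Fin d}
    (h : D.proj z l ∈ Set.Icc (f.lo l) (f.hi l)) :
    |D.proj z l - a.mid l| ≤ D.nbhdRadius a.level l := by
  have h1 := hD.sideLength_div_two_le a.level l
  have h2 := hf.isCell.mid_sub_lo l
  have h3 := hf.isCell.hi_eq_mid l
  have h4 := hf.subset l
  rw [abs_le]
  exact ⟨by linarith [h.1], by linarith [h.2]⟩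

/-- An anchor whose local index vector contains the midpoint of `a` is close to `a`. -/
theorem abs_proj_sub_mid_le (hS : D.Structured S Q) (hD : D.WideNbhds) (hz : z ∈ D.anchors Q)
    (hf : D.FineNbhd S a f) {j : Fin d} {m : ℕ} (hm : m ≤ D.p j + 1)
    (hr : D.localIndex Q z j m = a.mid j) (h1 : (D.p j : ℝ) + 1 < a.mid j)
    (h2 : a.mid j < (D.n j : ℝ) + 1)
    (hzl : ∀ l, l ≠ j → D.proj z l ∈ Set.Icc (f.lo l) (f.hi l)) :
    |D.proj z j - a.mid j| ≤ D.nbhdRadius a.level j := by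
  have hdom := D.inDomain_of_mem_anchors hz
  have hzl' := fun l hl => abs_proj_sub_mid_le_of_mem hD hf (hzl l hl)
  have hpos := sideLength_pos a.level j
  have hR := hD.half_p_le a.level j
  have hc := D.half_succ j
  have hcr : (D.p j : ℝ) / 2 = (((D.p j + 1) / 2 : ℕ) : ℝ) - 1 / 2 := by
    have : ((D.p j : ℝ)) + 1 = 2 * (((D.p j + 1) / 2 : ℕ) : ℝ) := by exact_mod_cast hc
    linarith
  have hlo := hf.isCell.mid_sub_lo j
  have hhi := hf.isCell.hi_eq_mid j
  rw [hcr] at hR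
  have hmid := D.localIndex_half Q z j
  have hadd := D.localIndex_add Q z j
  have hsub := fun t => D.localIndex_sub Q z j (t := t)
  have hmono := fun {i k} => hS.localIndex_mono hz j (i := i) (k := k)
  generalize (D.p j + 1) / 2 = c at *
  set s := sideLength d a.level j with hs
  have hp := D.proj_mem z j
  rw [abs_le]
  constructor
  · by_contra! hlt
    have hlt' : D.proj z j < a.mid j - s * (c - 1 / 2) := by linarith
    have hsc : ∀ i : ℕ, i + 1 ≤ c → 0 ≤ s * i ∧ s * i + s ≤ s * c := by
      intro i hi
      have hi' : (i : ℝ) + 1 ≤ c := by exact_mod_cast hi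
      exact ⟨by positivity, by nlinarith⟩
    have hcpos : 0 < c := by have := D.three_le_p j; omega
    have hsc0 := hsc 0 hcpos
    simp only [Nat.cast_zero, mul_zero] at hsc0
    have hzr : z j < a.mid j := by
      by_contra! h
      have : a.mid j ≤ D.proj z j := le_min (h.trans (le_max_left _ _)) h2.le
      linarith
    have hmc : c < m := by
      by_contra! h
      have := hmono h (by omega)
      rw [hr, hmid] at this
      linarith
    obtain ⟨t, rfl⟩ : ∃ t, m = c + (t + 1) := ⟨m - c - 1, by omega⟩
    -- If the anchor lay too far left, the `c` grid lines at distances `s * (c - 1 / 2), …, s / 2`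
    -- before the midpoint would be entries between the two. At most `c` moves to the right from the
    -- anchor then end before the midpoint, which could not be in the local index vector.
    have hle := iterate_nextEntry_le (G := D.globalIndex Q z j)
      (g := fun i : ℕ => a.mid j - s * (c - 1 / 2) + s * i)
      (fun u v huv => by
        have huv' : (u : ℝ) < v := by exact_mod_cast huv
        have := mul_lt_mul_of_pos_left huv' hpos
        dsimp only
        linarith)
      (s := z j) (t := t)
      (by
        have := D.le_proj (z := z) (j := j) (by linarith)
        simp only [Nat.cast_zero, mul_zero]
        linarith)
      (fun i hi => by
        have hi' := hsc i (by omega)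
        refine hS.grid_mem_globalIndex hD hdom hf ?_ ?_ ?_ ?_ hzl'
        · rw [abs_le]; constructor <;> linarith
        · linarith
        · linarith
        · have : a.mid j - s * (c - 1 / 2) + s * i = a.lo j + ((i + 1 - c : ℤ) : ℝ) * s := by
            rw [hlo]; push_cast; ring
          rw [this]
          exact (hf.isCell j).1.add (onGrid_int_mul _ _ _))
    rw [← hadd, hr] at hle
    have := hsc t (by omega)
    linarith
  · by_contra! hlt
    have hlt' : a.mid j + s * (c - 1 / 2) < D.proj z j := by linarith
    have hsc : ∀ i : ℕ, i + 1 ≤ c → 0 ≤ s * i ∧ s * i + s ≤ s * c := by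
      intro i hi
      have hi' : (i : ℝ) + 1 ≤ c := by exact_mod_cast hi
      exact ⟨by positivity, by nlinarith⟩
    have hcpos : 0 < c := by have := D.three_le_p j; omega
    have hsc0 := hsc 0 hcpos
    simp only [Nat.cast_zero, mul_zero] at hsc0
    have hzr : a.mid j < z j := by
      by_contra! h
      have : D.proj z j ≤ a.mid j := (min_le_left _ _).trans (max_le h h1.le)
      linarith
    have hmc : m < c := by
      by_contra! h
      have := hmono h (by omega)
      rw [hr, hmid] at this
      linarith
    obtain ⟨t, ht, rfl⟩ : ∃ t, t + 1 ≤ c ∧ m = c - (t + 1) := ⟨c - m - 1, by omega, by omega⟩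
    have hle := le_iterate_prevEntry (G := D.globalIndex Q z j)
      (g := fun i : ℕ => a.mid j + s * (c - 1 / 2) - s * i)
      (fun u v huv => by
        have huv' : (u : ℝ) < v := by exact_mod_cast huv
        have := mul_lt_mul_of_pos_left huv' hpos
        dsimp only
        linarith)
      (s := z j) (t := t)
      (by
        have := D.proj_le (z := z) (j := j) (by linarith)
        simp only [Nat.cast_zero, mul_zero]
        linarith)
      (fun i hi => by
        have hi' := hsc i (by omega)
        refine hS.grid_mem_globalIndex hD hdom hf ?_ ?_ ?_ ?_ hzl'
        · rw [abs_le]; constructor <;> linarith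
        · linarith
        · linarith
        · have : a.mid j + s * (c - 1 / 2) - s * i = a.lo j + ((c - i : ℤ) : ℝ) * s := by
            rw [hlo]; push_cast; ring
          rw [this]
          exact (hf.isCell j).1.add (onGrid_int_mul _ _ _))
    rw [← hsub _ ht, hr] at hle
    have := hsc t ht
    linarith

/-- The support of the blending function of an anchor close to `a` stays in the neighborhood of `a`
in every direction in which `a` is not bisected. -/
theorem localIndex_last_le (hS : D.Structured S Q) (hD : D.WideNbhds) (hz : z ∈ D.anchors Q)
    (hf : D.FineNbhd S a f) {i : Fin d} (hi : dir d a.level ≠ i)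
    (hzi : D.proj z i ∈ Set.Icc (f.lo i) (f.hi i))
    (hzl : ∀ l, l ≠ i → |D.proj z l - a.mid l| ≤ D.nbhdRadius a.level l) {R : ℝ}
    (hR1 : a.mid i + D.nbhdRadius a.level i ≤ R) (hR2 : R < (D.n i : ℝ) + 1) :
    D.localIndex Q z i (D.p i + 1) ≤ R := by
  have hdom := D.inDomain_of_mem_anchors hz
  have hpos := sideLength_pos a.level i
  have hR := hD.half_p_add_one_le a.level i hi
  have hc := D.half_succ i
  have hcr : (D.p i : ℝ) / 2 = (((D.p i + 1) / 2 : ℕ) : ℝ) - 1 / 2 := by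
    have : ((D.p i : ℝ)) + 1 = 2 * (((D.p i + 1) / 2 : ℕ) : ℝ) := by exact_mod_cast hc
    linarith
  have hlo := hf.isCell.mid_sub_lo i
  have hhi := hf.isCell.hi_eq_mid i
  rw [hcr] at hR
  have hadd := D.localIndex_add Q z i
  have hcpos : 0 < (D.p i + 1) / 2 := by have := D.three_le_p i; omega
  generalize (D.p i + 1) / 2 = c at *
  set s := sideLength d a.level i with hs
  have hsub := hf.subset i
  have hin := hS.inside f hf.mem i
  have hlt := hS.lt hf.mem i
  have hDpos := hD.sideLength_div_two_le a.level i
  have hz1 : z i ≤ D.proj z i := by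
    refine D.le_proj ?_
    by_contra! h
    have : (D.n i : ℝ) + 1 ≤ D.proj z i := le_min (h.le.trans (le_max_left _ _)) le_rfl
    linarith [hzi.2]
  obtain ⟨t, rfl⟩ : ∃ t, c = t + 1 := ⟨c - 1, by omega⟩
  push_cast at hR
  have hsc : ∀ h : ℕ, h ≤ t → 0 ≤ s * h ∧ s * h ≤ s * t := by
    intro h ht
    have ht' : (h : ℝ) ≤ t := by exact_mod_cast ht
    exact ⟨by positivity, by nlinarith⟩
  -- The anchor may sit on `a.hi i`, and the next entry must be strictly larger, so counting starts
  -- one side length further. The last of these `c` lines is at distance `s * (c + 1 / 2)` from the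
  -- midpoint, which accounts for the radius `p / 2 + 1`.
  have hle := iterate_nextEntry_le (G := D.globalIndex Q z i)
    (g := fun h : ℕ => a.hi i + s + s * h)
    (fun u v huv => by
      have huv' : (u : ℝ) < v := by exact_mod_cast huv
      have := mul_lt_mul_of_pos_left huv' hpos
      dsimp only
      linarith)
    (s := z i) (t := t)
    (by
      simp only [Nat.cast_zero, mul_zero]
      linarith [hzi.2])
    (fun h ht => by
      have ht' := hsc h ht
      refine hS.grid_mem_globalIndex hD hdom hf ?_ ?_ ?_ ?_ hzl
      · rw [abs_le]; constructor <;> linarith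
      · linarith
      · linarith
      · have : a.hi i + s + s * h = a.hi i + ((h + 1 : ℤ) : ℝ) * s := by
          push_cast; ring
        rw [this]
        exact (hf.isCell.onGrid_hi i).add (onGrid_int_mul _ _ _))
  rw [← hadd, show t + 1 + (t + 1) = D.p i + 1 by omega] at hle
  linarith

/-- The mirror image of the previous bound, with grid lines counted downwards from `a.lo i`. -/
theorem le_localIndex_zero (hS : D.Structured S Q) (hD : D.WideNbhds) (hz : z ∈ D.anchors Q)
    (hf : D.FineNbhd S a f) {i : Fin d} (hi : dir d a.level ≠ i)
    (hzi : D.proj z i ∈ Set.Icc (f.lo i) (f.hi i))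
    (hzl : ∀ l, l ≠ i → |D.proj z l - a.mid l| ≤ D.nbhdRadius a.level l) {R : ℝ}
    (hR1 : R ≤ a.mid i - D.nbhdRadius a.level i) (hR2 : (D.p i : ℝ) + 1 < R) :
    R ≤ D.localIndex Q z i 0 := by
  have hdom := D.inDomain_of_mem_anchors hz
  have hpos := sideLength_pos a.level i
  have hR := hD.half_p_add_one_le a.level i hi
  have hc := D.half_succ i
  have hcr : (D.p i : ℝ) / 2 = (((D.p i + 1) / 2 : ℕ) : ℝ) - 1 / 2 := by
    have : ((D.p i : ℝ)) + 1 = 2 * (((D.p i + 1) / 2 : ℕ) : ℝ) := by exact_mod_cast hc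
    linarith
  have hlo := hf.isCell.mid_sub_lo i
  have hhi := hf.isCell.hi_eq_mid i
  rw [hcr] at hR
  have hidx := D.localIndex_sub Q z i (t := (D.p i + 1) / 2) le_rfl
  rw [Nat.sub_self] at hidx
  have hcpos : 0 < (D.p i + 1) / 2 := by have := D.three_le_p i; omega
  generalize (D.p i + 1) / 2 = c at *
  set s := sideLength d a.level i with hs
  have hsub := hf.subset i
  have hin := hS.inside f hf.mem i
  have hlt := hS.lt hf.mem i
  have hDpos := hD.sideLength_div_two_le a.level i
  have hz1 : D.proj z i ≤ z i := by
    refine D.proj_le ?_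
    by_contra! h
    have : D.proj z i ≤ (D.p i : ℝ) + 1 := (min_le_left _ _).trans (max_le h.le le_rfl)
    linarith [hzi.1]
  obtain ⟨t, rfl⟩ : ∃ t, c = t + 1 := ⟨c - 1, by omega⟩
  push_cast at hR
  have hsc : ∀ h : ℕ, h ≤ t → 0 ≤ s * h ∧ s * h ≤ s * t := by
    intro h ht
    have ht' : (h : ℝ) ≤ t := by exact_mod_cast ht
    exact ⟨by positivity, by nlinarith⟩
  have hle := le_iterate_prevEntry (G := D.globalIndex Q z i)
    (g := fun h : ℕ => a.lo i - s - s * h)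
    (fun u v huv => by
      have huv' : (u : ℝ) < v := by exact_mod_cast huv
      have := mul_lt_mul_of_pos_left huv' hpos
      dsimp only
      linarith)
    (s := z i) (t := t)
    (by
      simp only [Nat.cast_zero, mul_zero]
      linarith [hzi.1])
    (fun h ht => by
      have ht' := hsc h ht
      refine hS.grid_mem_globalIndex hD hdom hf ?_ ?_ ?_ ?_ hzl
      · rw [abs_le]; constructor <;> linarith
      · linarith
      · linarith
      · have : a.lo i - s - s * h = a.lo i + ((-(h + 1) : ℤ) : ℝ) * s := by
          push_cast; ring
        rw [this]
        exact (hf.isCell i).1.add (onGrid_int_mul _ _ _))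
  rw [← hidx] at hle
  linarith

/-- A knot of a blending function which cuts an element inside its support is the knot at the
midpoint of the element in the direction in which the element would be bisected. -/
theorem localIndex_eq_mid (hS : D.Structured S Q) (hD : D.WideNbhds) (hz : z ∈ D.anchors Q)
    {e : Elem d} (he : e ∈ S)
    (hmeet : ∀ i, D.localIndex Q z i 0 < e.hi i ∧ e.lo i < D.localIndex Q z i (D.p i + 1))
    {j : Fin d} {m : ℕ} (hm : m ≤ D.p j + 1)
    (h : D.localIndex Q z j m ∈ Set.Ioo (e.lo j) (e.hi j)) :
    dir d e.level = j ∧ D.localIndex Q z j m = e.mid j := by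
  have hecell := hS.isCell e he
  have hein := hS.inside e he
  have hG := hS.localIndex_mem hz j hm
  have hr1 : (D.p j : ℝ) + 1 < D.localIndex Q z j m := (hein j).1.trans_lt h.1
  have hr2 : D.localIndex Q z j m < (D.n j : ℝ) + 1 := h.2.trans_le (hein j).2
  obtain ⟨f, hf, hface, hzf⟩ := hS.exists_face hG hr1 hr2
  have hfcell := hS.isCell f hf
  have hnot : ¬ OnGrid e.level j (D.localIndex Q z j m) := fun hgrid => by
    rcases hecell.le_or_le le_rfl hgrid with h' | h'
    · exact absurd h.1 (not_lt.2 h')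
    · exact absurd h.2 (not_lt.2 h')
  have hgridf : OnGrid f.level j (D.localIndex Q z j m) := by
    rcases hface with h' | h' <;> rw [h']
    · exact (hfcell j).1
    · exact hfcell.onGrid_hi j
  -- The level `k` is chosen so that the knot is absent from grid `k` but present in the next one.
  -- It is therefore the midpoint of the ancestor of `f` at that level.
  obtain ⟨k, hk1, hk2, hk3, hk4⟩ := exists_onGrid_succ hnot hgridf
  obtain ⟨a, ha, hal, hasub⟩ := hfcell.exists_ancestor hk2.le
  subst hal
  have hflt := hS.lt hf j
  obtain ⟨hdir, hmid⟩ := ha.eq_mid (j := j) (r := D.localIndex Q z j m)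
    (by rcases hface with h' | h' <;> rw [h'] <;> linarith [(hasub j).1])
    (by rcases hface with h' | h' <;> rw [h'] <;> linarith [(hasub j).2]) hk3 hk4
  rcases hk1.lt_or_eq with hlt | heq
  · exfalso
    have hfine : D.FineNbhd S a f := ⟨ha, hf, hasub, fun g hg x hx hnear =>
      hS.graded f hf a ha hk2 hasub g hg x hx hnear⟩
    have hzj := hS.abs_proj_sub_mid_le hD hz hfine hm hmid (hmid ▸ hr1) (hmid ▸ hr2) hzf
    have hzall : ∀ l, |D.proj z l - a.mid l| ≤ D.nbhdRadius a.level l := by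
      intro l
      by_cases hl : l = j
      · rw [hl]; exact hzj
      · exact abs_proj_sub_mid_le_of_mem hD hfine (hzf l hl)
    -- In this case `e` is coarser than `a`, so by grading it does not meet the open neighborhood of
    -- `a`; two disjoint boxes are separated in some direction.
    have hfar : ∃ i, e.hi i ≤ a.mid i - D.nbhdRadius a.level i ∨
        a.mid i + D.nbhdRadius a.level i ≤ e.lo i := by
      by_contra! hcon
      have hx : ∀ i, ∃ x, x ∈ Set.Ioo (e.lo i) (e.hi i) ∧
          |x - a.mid i| < D.nbhdRadius a.level i := by
        intro i
        have hpos := hD.nbhdRadius_pos a.level i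
        obtain ⟨x, hx1, hx2⟩ := exists_between
          (show max (e.lo i) (a.mid i - D.nbhdRadius a.level i) <
            min (e.hi i) (a.mid i + D.nbhdRadius a.level i) from
            max_lt (lt_min (hS.lt he i) (hcon i).2) (lt_min (hcon i).1 (by linarith)))
        rw [max_lt_iff] at hx1
        rw [lt_min_iff] at hx2
        exact ⟨x, ⟨hx1.1, hx2.1⟩, abs_lt.2 ⟨by linarith, by linarith⟩⟩
      choose x hx1 hx2 using hx
      have := hfine.level_le e he x (fun i _ => hx1 i) hx2
      omega
    obtain ⟨i, hi⟩ := hfar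
    have hpos := hD.nbhdRadius_pos a.level i
    -- In direction `j` the element contains the midpoint of `a`. The separation is thus in a
    -- direction where `a` is not bisected, where the support is confined to the neighborhood.
    have hij : i ≠ j := by
      rintro rfl
      rw [hmid] at h
      rcases hi with hi | hi
      · linarith [h.2]
      · linarith [h.1]
    have hdi : dir d a.level ≠ i := hdir ▸ hij.symm
    have helt := hS.lt he i
    rcases hi with hi | hi
    · have := hS.le_localIndex_zero hD hz hfine hdi (hzf i hij) (fun l _ => hzall l) hi
        (by linarith [(hein i).1])
      linarith [(hmeet i).1]
    · have := hS.localIndex_last_le hD hz hfine hdi (hzf i hij) (fun l _ => hzall l) hi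
        (by linarith [(hein i).2])
      linarith [(hmeet i).2]
  -- At equal levels the sides of `a` and `e` in direction `j` overlap and hence coincide. The cells
  -- themselves may differ in other directions.
  · rw [heq]
    refine ⟨hdir, hmid.trans ?_⟩
    have hov := ha.nested hecell heq.le (j := j)
      (h.1.trans_le (by rw [hmid]; have := ha.lo_lt_hi j; rw [Elem.mid]; linarith))
      (lt_of_le_of_lt (by rw [hmid]; have := ha.lo_lt_hi j; rw [Elem.mid]; linarith) h.2)
    have h1 := (ha j).2
    have h2 := (hecell j).2
    rw [heq] at h2
    rw [Elem.mid, Elem.mid]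
    linarith [hov.1, hov.2]

end Data.Structured

end TSpline

/-! ### Parts of elements and the blending functions that separate them -/

namespace TSpline

variable {d : ℕ}

theorem Data.knotAt_lt_of_lt (D : Data d) (j : Fin d) {r s : ℝ} (hrs : r < s) (hr : 1 ≤ r)
    (hs : s ≤ (D.n j : ℝ) + D.p j + 1) (hr' : r < (D.n j : ℝ) + 1) (hs' : (D.p j : ℝ) + 1 < s) :
    D.knotAt j r < D.knotAt j s := by
  have hpn := D.p_lt_n_real j
  have hp : (0 : ℝ) ≤ D.p j := Nat.cast_nonneg _
  have h1 : max r ((D.p j : ℝ) + 1) < min s ((D.n j : ℝ) + 1) :=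
    max_lt (lt_min hrs hr') (lt_min hs' (by linarith))
  have h2 : r ≤ max r ((D.p j : ℝ) + 1) := le_max_left _ _
  have h3 : min s ((D.n j : ℝ) + 1) ≤ s := min_le_left _ _
  have h4 : (D.p j : ℝ) + 1 ≤ max r ((D.p j : ℝ) + 1) := le_max_right _ _
  have h5 : min s ((D.n j : ℝ) + 1) ≤ (D.n j : ℝ) + 1 := min_le_right _ _
  generalize max r ((D.p j : ℝ) + 1) = r' at *
  generalize min s ((D.n j : ℝ) + 1) = s' at *
  have hm := D.knotAt_monotoneOn j
  calc D.knotAt j r ≤ D.knotAt j r' := hm ⟨hr, by linarith⟩ ⟨by linarith, by linarith⟩ h2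
    _ < D.knotAt j s' := D.knotAt_strictMonoOn j ⟨h4, by linarith⟩ ⟨by linarith, h5⟩ h1
    _ ≤ D.knotAt j s := hm ⟨by linarith, by linarith⟩ ⟨by linarith, hs⟩ h3

theorem exists_span {τ : ℕ → ℝ} {α β : ℝ} {N : ℕ}
    (hfree : ∀ m, τ m ∉ Set.Ioo α β) (h0 : τ 0 < β) (hN : α < τ N) :
    ∃ a < N, τ a ≤ α ∧ β ≤ τ (a + 1) := by
  induction N with
  | zero => exact absurd ⟨hN, h0⟩ (hfree 0)
  | succ N ih =>
    rcases lt_or_ge α (τ N) with h | h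
    · obtain ⟨a, ha, h'⟩ := ih h
      exact ⟨a, by omega, h'⟩
    · refine ⟨N, Nat.lt_succ_self N, h, ?_⟩
      by_contra! hlt
      exact hfree (N + 1) ⟨hN, hlt⟩

/-- The knot vectors of the blending function of an anchor, continued by their last entries. -/
noncomputable def Data.anchorKnots (D : Data d) (Q : Set (Elem d)) (z : Fin d → ℝ) (j : Fin d)
    (i : ℕ) : ℝ :=
  D.knotAt j (D.localIndex Q z j (min i (D.p j + 1)))

theorem Data.anchorKnots_of_le (D : Data d) (Q : Set (Elem d)) (z : Fin d → ℝ) (j : Fin d)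
    {i : ℕ} (hi : i ≤ D.p j + 1) :
    D.anchorKnots Q z j i = D.knotAt j (D.localIndex Q z j i) := by
  rw [Data.anchorKnots, min_eq_left hi]

theorem Data.blending_eq (D : Data d) (Q : Set (Elem d)) (z : Fin d → ℝ) :
    D.blending Q z = tensorSpline (D.anchorKnots Q z) D.p := by
  funext x
  refine Finset.prod_congr rfl fun j _ => bspline_congr _ _ fun m _ hm => ?_
  rw [D.anchorKnots_of_le Q z j (by omega)]

/-- The closed support of the blending function of `z` does not contain a neighborhood of a point of
the parametric image of `u`. -/
def Data.Off (D : Data d) (Q : Set (Elem d)) (z : Fin d → ℝ) (u : Elem d) : Prop :=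
  ∃ i, D.knotAt i (u.hi i) ≤ D.anchorKnots Q z i 0 ∨
    D.anchorKnots Q z i (D.p i + 1) ≤ D.knotAt i (u.lo i)

/-- The parametric image of `u` lies in one knot span of the blending function of `z`. -/
def Data.Spans (D : Data d) (Q : Set (Elem d)) (z : Fin d → ℝ) (u : Elem d) (a : Fin d → ℕ) :
    Prop :=
  ∀ j, a j ≤ D.p j ∧ D.anchorKnots Q z j (a j) ≤ D.knotAt j (u.lo j) ∧
    D.knotAt j (u.hi j) ≤ D.anchorKnots Q z j (a j + 1)

variable [NeZero d]

/-- A blending function whose support meets `e` has a knot at the midpoint of `e`. -/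
def Data.IsCut (D : Data d) (Q : Set (Elem d)) (e : Elem d) : Prop :=
  ∃ z ∈ D.anchors Q, ¬ D.Off Q z e ∧
    ∃ m ≤ D.p (dir d e.level) + 1, D.localIndex Q z (dir d e.level) m = e.mid (dir d e.level)

/-- The index boxes of the Bézier elements in the element `e`. -/
def Data.IsPart (D : Data d) (Q : Set (Elem d)) (e u : Elem d) : Prop :=
  (¬ D.IsCut Q e ∧ u = e) ∨ (D.IsCut Q e ∧ e.IsHalf u)

namespace Data.Structured

variable {D : Data d} {S Q : Set (Elem d)} {z : Fin d → ℝ} {e f u v : Elem d}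

theorem localIndex_mem_Icc (hS : D.Structured S Q) (hz : z ∈ D.anchors Q) (j : Fin d) {i : ℕ}
    (hi : i ≤ D.p j + 1) :
    D.localIndex Q z j i ∈ Set.Icc (1 : ℝ) ((D.n j : ℝ) + D.p j + 1) :=
  (hS.localIndex_mem hz j hi).1

theorem monotone_anchorKnots (hS : D.Structured S Q) (hz : z ∈ D.anchors Q) (j : Fin d) :
    Monotone (D.anchorKnots Q z j) := by
  intro i k hik
  exact D.knotAt_monotoneOn j (hS.localIndex_mem_Icc hz j (min_le_right _ _))
    (hS.localIndex_mem_Icc hz j (min_le_right _ _))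
    (hS.localIndex_mono hz j (min_le_min_right _ hik) (min_le_right _ _))

theorem mem_Icc_of_inside (hS : D.Structured S Q) (he : e ∈ S) {j : Fin d} {r : ℝ}
    (h1 : e.lo j ≤ r) (h2 : r ≤ e.hi j) : r ∈ Set.Icc (1 : ℝ) ((D.n j : ℝ) + D.p j + 1) := by
  have := hS.inside e he j
  have hp : (0 : ℝ) ≤ D.p j := Nat.cast_nonneg _
  exact ⟨by linarith, by linarith⟩

theorem index_meet (hS : D.Structured S Q) (hz : z ∈ D.anchors Q) (he : e ∈ S)
    (h : ¬ D.Off Q z e) (i : Fin d) :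
    D.localIndex Q z i 0 < e.hi i ∧ e.lo i < D.localIndex Q z i (D.p i + 1) := by
  simp only [Data.Off, not_exists, not_or, not_le] at h
  have h1 := h i
  rw [D.anchorKnots_of_le Q z i (Nat.zero_le _), D.anchorKnots_of_le Q z i le_rfl] at h1
  have hm := D.knotAt_monotoneOn i
  have hlt := (hS.lt he i).le
  constructor
  · by_contra! hle
    exact absurd h1.1 (not_lt.2 (hm (hS.mem_Icc_of_inside he hlt le_rfl)
      (hS.localIndex_mem_Icc hz i (Nat.zero_le _)) hle))
  · by_contra! hle
    exact absurd h1.2 (not_lt.2 (hm (hS.localIndex_mem_Icc hz i le_rfl)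
      (hS.mem_Icc_of_inside he le_rfl hlt) hle))

theorem localIndex_eq_mid_of_knot_mem (hS : D.Structured S Q) (hD : D.WideNbhds)
    (hz : z ∈ D.anchors Q) (he : e ∈ S) (h : ¬ D.Off Q z e) {j : Fin d} {m : ℕ}
    (hm : D.anchorKnots Q z j m ∈ Set.Ioo (D.knotAt j (e.lo j)) (D.knotAt j (e.hi j))) :
    dir d e.level = j ∧ D.localIndex Q z j (min m (D.p j + 1)) = e.mid j := by
  refine hS.localIndex_eq_mid hD hz he (hS.index_meet hz he h) (min_le_right _ _) ?_
  have hmono := D.knotAt_monotoneOn j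
  have hlt := (hS.lt he j).le
  have hL := hS.localIndex_mem_Icc hz j (min_le_right m (D.p j + 1))
  constructor
  · by_contra! hle
    exact absurd hm.1 (not_lt.2 (hmono hL (hS.mem_Icc_of_inside he le_rfl hlt) hle))
  · by_contra! hle
    exact absurd hm.2 (not_lt.2 (hmono (hS.mem_Icc_of_inside he hlt le_rfl) hL hle))

theorem part_subset (hS : D.Structured S Q) (he : e ∈ S) (hu : D.IsPart Q e u) (j : Fin d) :
    e.lo j ≤ u.lo j ∧ u.hi j ≤ e.hi j ∧ u.lo j ≤ e.mid j ∧ e.mid j ≤ u.hi j ∧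
      u.lo j < u.hi j := by
  have hlt := hS.lt he j
  have h1 : e.lo j < e.mid j := by rw [Elem.mid]; linarith
  have h2 : e.mid j < e.hi j := by rw [Elem.mid]; linarith
  rcases hu with ⟨-, rfl⟩ | ⟨-, hu⟩
  · exact ⟨le_rfl, le_rfl, h1.le, h2.le, hlt⟩
  · by_cases hj : j = dir d e.level
    · subst hj
      rcases hu with rfl | rfl
      · simp [Elem.lower, h1, h1.le, h2.le]
      · simp [Elem.upper, h2, h1.le, h2.le]
    · obtain ⟨h3, h4⟩ := hu.side_of_ne hj
      rw [h3, h4]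
      exact ⟨le_rfl, le_rfl, h1.le, h2.le, hlt⟩

theorem part_inside (hS : D.Structured S Q) (he : e ∈ S) (hu : D.IsPart Q e u) : D.Inside u :=
  fun j => ⟨(hS.inside e he j).1.trans (hS.part_subset he hu j).1,
    (hS.part_subset he hu j).2.1.trans (hS.inside e he j).2⟩

theorem knotAt_part (hS : D.Structured S Q) (he : e ∈ S) (hu : D.IsPart Q e u) (j : Fin d) :
    D.knotAt j (e.lo j) ≤ D.knotAt j (u.lo j) ∧ D.knotAt j (u.hi j) ≤ D.knotAt j (e.hi j) ∧
      D.knotAt j (u.lo j) < D.knotAt j (u.hi j) := by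
  obtain ⟨h1, h2, h3, h4, h5⟩ := hS.part_subset he hu j
  have hm := D.knotAt_monotoneOn j
  have hlt := (hS.lt he j).le
  exact ⟨hm (hS.mem_Icc_of_inside he le_rfl hlt) (hS.mem_Icc_of_inside he h1 (by linarith)) h1,
    hm (hS.mem_Icc_of_inside he (by linarith) h2) (hS.mem_Icc_of_inside he hlt le_rfl) h2,
    D.knotAt_lt_knotAt (hS.part_inside he hu) h5⟩

/-- The parts of an element are not cut by knots of the blending functions. -/
theorem off_or_exists_spans (hS : D.Structured S Q) (hD : D.WideNbhds) (hz : z ∈ D.anchors Q)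
    (he : e ∈ S) (hu : D.IsPart Q e u) : D.Off Q z u ∨ ∃ a, D.Spans Q z u a := by
  by_cases hoffu : D.Off Q z u
  · exact Or.inl hoffu
  right
  have hoff : ¬ D.Off Q z e := by
    rintro ⟨i, hi⟩
    obtain ⟨h1, h2, -⟩ := hS.knotAt_part he hu i
    exact hoffu ⟨i, hi.imp (fun h => h2.trans h) (fun h => h.trans h1)⟩
  simp only [Data.Off, not_exists, not_or, not_le] at hoffu
  have key : ∀ j, ∃ a < D.p j + 1, D.anchorKnots Q z j a ≤ D.knotAt j (u.lo j) ∧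
      D.knotAt j (u.hi j) ≤ D.anchorKnots Q z j (a + 1) := by
    intro j
    obtain ⟨h1, h2, h3⟩ := hS.knotAt_part he hu j
    refine exists_span (fun m hm => ?_) (hoffu j).1 (hoffu j).2
    obtain ⟨hdir, hmid⟩ := hS.localIndex_eq_mid_of_knot_mem hD hz he hoff
      ⟨h1.trans_lt hm.1, hm.2.trans_le h2⟩
    rw [Data.anchorKnots, hmid] at hm
    subst hdir
    rcases hu with ⟨hcut, rfl⟩ | ⟨-, rfl | rfl⟩
    · exact hcut ⟨z, hz, hoff, _, min_le_right _ _, hmid⟩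
    · simp [Elem.lower] at hm
    · simp [Elem.upper] at hm
  choose a ha using key
  exact ⟨a, fun j => ⟨Nat.lt_succ_iff.1 (ha j).1, (ha j).2⟩⟩

theorem isPolynomialOn_part (hS : D.Structured S Q) (hD : D.WideNbhds) (hz : z ∈ D.anchors Q)
    (he : e ∈ S) (hu : D.IsPart Q e u) :
    IsPolynomialOn D.p (D.paramImage u) (D.blending Q z) := by
  rw [D.blending_eq]
  rcases hS.off_or_exists_spans hD hz he hu with ⟨i, hi⟩ | ⟨a, ha⟩
  · refine isPolynomialOn_zero fun x hx => tensorSpline_eq_zero (hS.monotone_anchorKnots hz)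
      (j := i) ?_
    have := hx i trivial
    exact hi.imp (fun h => this.2.trans_le h) (fun h => (h.trans_lt this.1).le)
  · refine isPolynomialOn_tensorSpline (hS.monotone_anchorKnots hz) (a := a) fun x hx j => ?_
    have := hx j trivial
    exact ⟨(ha j).2.1.trans_lt this.1, this.2.trans_le (ha j).2.2⟩

/-- The blending function of `z` distinguishes the boxes `u` and `v`. -/
theorem not_isPolynomialOn_blending (hS : D.Structured S Q) (hz : z ∈ D.anchors Q)
    {V : Set (Fin d → ℝ)} (hV : IsOpen V) {x y : Fin d → ℝ} (hxV : x ∈ V) (hyV : y ∈ V)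
    (hx : x ∈ D.paramImage u) (hy : y ∈ D.paramImage v) {a : Fin d → ℕ} (ha : D.Spans Q z u a)
    (h : D.Off Q z v ∨ ∃ b, D.Spans Q z v b ∧ a ≠ b) :
    ¬ IsPolynomialOn D.p V (D.blending Q z) := by
  rw [D.blending_eq]
  refine not_isPolynomialOn_tensorSpline (hS.monotone_anchorKnots hz)
    (fun j => by have := D.three_le_p j; omega) hV (fun j => (ha j).1) hxV hyV
    (fun j => ⟨(ha j).2.1.trans_lt (hx j trivial).1, (hx j trivial).2.trans_le (ha j).2.2⟩) ?_
  rcases h with ⟨i, hi⟩ | ⟨b, hb, hab⟩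
  · exact Or.inl ⟨i, hi.imp (fun h => (hy i trivial).2.trans_le h)
      (fun h => h.trans_lt (hy i trivial).1)⟩
  · exact Or.inr ⟨b, fun j => (hb j).1, fun j =>
      ⟨(hb j).2.1.trans_lt (hy j trivial).1, (hy j trivial).2.trans_le (hb j).2.2⟩, hab⟩

/-- A knot between `u` and `v` excludes a common span, since it would have an index strictly between
two consecutive indices. -/
theorem off_or_spans_ne (hS : D.Structured S Q) (hD : D.WideNbhds) (hz : z ∈ D.anchors Q)
    (he : e ∈ S) (hu : D.IsPart Q e u) (hf : f ∈ S) (hv : D.IsPart Q f v) {a : Fin d → ℕ}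
    (ha : D.Spans Q z u a) {j : Fin d} {m : ℕ}
    (h : (D.knotAt j (u.hi j) ≤ D.anchorKnots Q z j m ∧
        D.anchorKnots Q z j m ≤ D.knotAt j (v.lo j)) ∨
      (D.knotAt j (v.hi j) ≤ D.anchorKnots Q z j m ∧
        D.anchorKnots Q z j m ≤ D.knotAt j (u.lo j))) :
    D.Off Q z v ∨ ∃ b, D.Spans Q z v b ∧ a ≠ b := by
  refine (hS.off_or_exists_spans hD hz hf hv).imp id ?_
  rintro ⟨b, hb⟩
  refine ⟨b, hb, ?_⟩
  rintro rfl
  have hu' := (hS.knotAt_part he hu j).2.2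
  have hv' := (hS.knotAt_part hf hv j).2.2
  have ha' := (ha j).2
  have hb' := (hb j).2
  have hmono := hS.monotone_anchorKnots hz j
  have h1 : D.anchorKnots Q z j (a j) < D.anchorKnots Q z j m := by
    rcases h with h | h <;> linarith [h.1, h.2, ha'.1, hb'.1]
  have h2 : D.anchorKnots Q z j m < D.anchorKnots Q z j (a j + 1) := by
    rcases h with h | h <;> linarith [h.1, h.2, ha'.2, hb'.2]
  have h3 := hmono.reflect_lt h1
  have h4 := hmono.reflect_lt h2
  omega

theorem vertex_mem_anchors (hS : D.Structured S Q) (he : e ∈ S)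
    (hz : ∀ j, z j = e.lo j ∨ z j = e.hi j) : z ∈ D.anchors Q := by
  refine ⟨fun j => ?_, e, hS.subset he, hz⟩
  have h1 := hS.inside e he j
  have h2 := hS.lt he j
  have hc := D.half_succ j
  have h3 : (((D.p j + 1) / 2 : ℕ) : ℝ) ≤ D.p j := by
    have := D.three_le_p j
    exact_mod_cast (show (D.p j + 1) / 2 ≤ D.p j by omega)
  rcases hz j with h | h <;> rw [h] <;> exact ⟨by linarith, by linarith⟩

/-- Every vertex of `e` is an anchor, and the support of the one at the lower corner has the
midpoint of `e` in its interior. Its blending function can thus detect any part of `e`. -/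
theorem lo_localIndex (hS : D.Structured S Q) (hD : D.WideNbhds) (he : e ∈ S) (i : Fin d) :
    D.localIndex Q e.lo i 0 < e.mid i ∧ e.mid i < D.localIndex Q e.lo i (D.p i + 1) := by
  have hz := hS.vertex_mem_anchors he (z := e.lo) fun _ => Or.inl rfl
  have hp := fun j => D.three_le_p j
  have hc := fun j => D.half_succ j
  have hlt := hS.lt he i
  have hhalf := D.localIndex_half Q e.lo
  have hmono := fun j {k l} => hS.localIndex_mono hz j (i := k) (k := l)
  have hstrict := fun j {k l} => hS.localIndex_strictMono hz j (i := k) (k := l)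
  have hmeet : ∀ j, D.localIndex Q e.lo j 0 < e.hi j ∧
      e.lo j < D.localIndex Q e.lo j (D.p j + 1) := by
    intro j
    have := hp j
    have := hc j
    have h1 := hmono j (Nat.zero_le ((D.p j + 1) / 2)) (by omega)
    have h2 := hstrict j (show (D.p j + 1) / 2 < D.p j + 1 by omega) le_rfl
    rw [hhalf] at h1 h2
    exact ⟨h1.trans_lt (hS.lt he j), h2⟩
  have := hp i
  have := hc i
  constructor
  · have h1 := hmono i (Nat.zero_le ((D.p i + 1) / 2)) (by omega)
    rw [hhalf] at h1
    rw [Elem.mid]; linarith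
  · by_contra! hle
    have h1 := hstrict i (Nat.lt_succ_self ((D.p i + 1) / 2)) (by omega)
    rw [hhalf] at h1
    -- By `3 ≤ p` there is another entry strictly between the anchor and the last one. If the last
    -- one did not exceed the midpoint, this entry would cut `e` before its midpoint, which is
    -- impossible.
    have h2 := hstrict i (show (D.p i + 1) / 2 + 1 < D.p i + 1 by omega) le_rfl
    have := (hS.localIndex_eq_mid hD hz he hmeet (j := i) (m := (D.p i + 1) / 2 + 1) (by omega)
      ⟨h1, by rw [Elem.mid] at hle; linarith⟩).2
    linarith

theorem hi_localIndex (hS : D.Structured S Q) (hD : D.WideNbhds) (he : e ∈ S) (i : Fin d) :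
    D.localIndex Q e.hi i 0 < e.mid i ∧ e.mid i < D.localIndex Q e.hi i (D.p i + 1) := by
  have hz := hS.vertex_mem_anchors he (z := e.hi) fun _ => Or.inr rfl
  have hp := fun j => D.three_le_p j
  have hc := fun j => D.half_succ j
  have hlt := hS.lt he i
  have hhalf := D.localIndex_half Q e.hi
  have hmono := fun j {k l} => hS.localIndex_mono hz j (i := k) (k := l)
  have hstrict := fun j {k l} => hS.localIndex_strictMono hz j (i := k) (k := l)
  have hmeet : ∀ j, D.localIndex Q e.hi j 0 < e.hi j ∧
      e.lo j < D.localIndex Q e.hi j (D.p j + 1) := by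
    intro j
    have := hp j
    have := hc j
    have h1 := hmono j (show (D.p j + 1) / 2 ≤ D.p j + 1 by omega) le_rfl
    have h2 := hstrict j (show 0 < (D.p j + 1) / 2 by omega) (by omega)
    rw [hhalf] at h1 h2
    exact ⟨h2, (hS.lt he j).trans_le h1⟩
  have := hp i
  have := hc i
  constructor
  · by_contra! hle
    have h1 := hstrict i (show (D.p i + 1) / 2 - 1 < (D.p i + 1) / 2 by omega) (by omega)
    rw [hhalf] at h1
    have h2 := hstrict i (show 0 < (D.p i + 1) / 2 - 1 by omega) (by omega)
    have := (hS.localIndex_eq_mid hD hz he hmeet (j := i) (m := (D.p i + 1) / 2 - 1) (by omega)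
      ⟨by rw [Elem.mid] at hle; linarith, h1⟩).2
    linarith
  · have h1 := hmono i (show (D.p i + 1) / 2 ≤ D.p i + 1 by omega) le_rfl
    rw [hhalf] at h1
    rw [Elem.mid]; linarith

/-- The parts of an element lie in the support of blending functions whose support has the midpoint
of the element in its interior. -/
theorem exists_spans_of_mid (hS : D.Structured S Q) (hD : D.WideNbhds) (hz : z ∈ D.anchors Q)
    (he : e ∈ S) (hu : D.IsPart Q e u)
    (h : ∀ i, D.localIndex Q z i 0 < e.mid i ∧ e.mid i < D.localIndex Q z i (D.p i + 1)) :
    ∃ a, D.Spans Q z u a := by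
  refine (hS.off_or_exists_spans hD hz he hu).resolve_left ?_
  rintro ⟨i, hi⟩
  obtain ⟨h1, h2, h3, h4, -⟩ := hS.part_subset he hu i
  have hlt := hS.lt he i
  have hin := hS.inside e he i
  have hm1 : e.lo i < e.mid i := by rw [Elem.mid]; linarith
  have hm2 : e.mid i < e.hi i := by rw [Elem.mid]; linarith
  have hmono := D.knotAt_monotoneOn i
  have hmid := hS.mem_Icc_of_inside he hm1.le hm2.le
  rw [D.anchorKnots_of_le Q z i (Nat.zero_le _), D.anchorKnots_of_le Q z i le_rfl] at hi
  rcases hi with hi | hi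
  · have h5 := D.knotAt_lt_of_lt i (h i).1 (hS.localIndex_mem_Icc hz i (Nat.zero_le _)).1 hmid.2
      (by linarith [(h i).1]) (by linarith)
    have h6 := hmono hmid (hS.mem_Icc_of_inside he (by linarith) h2) h4
    linarith
  · have h5 := D.knotAt_lt_of_lt i (h i).2 hmid.1 (hS.localIndex_mem_Icc hz i le_rfl).2
      (by linarith) (by linarith [(h i).2])
    have h6 := hmono (hS.mem_Icc_of_inside he h1 (by linarith)) hmid h3
    linarith

/-- A function that cuts `e` at the midpoint is supported on at least one half, and its knot
separates the two. -/
theorem separated_halves (hS : D.Structured S Q) (hD : D.WideNbhds) (he : e ∈ S)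
    (hcut : D.IsCut Q e) : ∃ z ∈ D.anchors Q,
      (∃ a, D.Spans Q z e.lower a ∧
        (D.Off Q z e.upper ∨ ∃ b, D.Spans Q z e.upper b ∧ a ≠ b)) ∨
      (∃ a, D.Spans Q z e.upper a ∧
        (D.Off Q z e.lower ∨ ∃ b, D.Spans Q z e.lower b ∧ a ≠ b)) := by
  have hl : D.IsPart Q e e.lower := Or.inr ⟨hcut, Or.inl rfl⟩
  have hu : D.IsPart Q e e.upper := Or.inr ⟨hcut, Or.inr rfl⟩
  obtain ⟨z, hz, hoff, m, hm, hmid⟩ := hcut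
  refine ⟨z, hz, ?_⟩
  have hknot : D.anchorKnots Q z (dir d e.level) m =
      D.knotAt (dir d e.level) (e.mid (dir d e.level)) := by
    rw [D.anchorKnots_of_le Q z _ hm, hmid]
  have h1 : e.lower.hi (dir d e.level) = e.mid (dir d e.level) := by simp [Elem.lower]
  have h2 : e.upper.lo (dir d e.level) = e.mid (dir d e.level) := by simp [Elem.upper]
  have hord : D.knotAt (dir d e.level) (e.lower.hi (dir d e.level)) ≤
      D.anchorKnots Q z (dir d e.level) m ∧ D.anchorKnots Q z (dir d e.level) m ≤
        D.knotAt (dir d e.level) (e.upper.lo (dir d e.level)) := by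
    rw [h1, h2, hknot]
    exact ⟨le_rfl, le_rfl⟩
  rcases hS.off_or_exists_spans hD hz he hl with hl0 | ⟨a, ha⟩
  · rcases hS.off_or_exists_spans hD hz he hu with hu0 | ⟨a, ha⟩
    · exfalso
      simp only [Data.Off, not_exists, not_or, not_le] at hoff
      obtain ⟨i, hi⟩ := hl0
      obtain ⟨k, hk⟩ := hu0
      have hi' : i = dir d e.level := by
        by_contra hne
        have h3 := (show e.IsHalf e.lower from Or.inl rfl).side_of_ne hne
        rw [h3.1, h3.2] at hi
        rcases hi with hi | hi
        · exact absurd (hoff i).1 (not_lt.2 hi)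
        · exact absurd (hoff i).2 (not_lt.2 hi)
      have hk' : k = dir d e.level := by
        by_contra hne
        have h3 := (show e.IsHalf e.upper from Or.inr rfl).side_of_ne hne
        rw [h3.1, h3.2] at hk
        rcases hk with hk | hk
        · exact absurd (hoff k).1 (not_lt.2 hk)
        · exact absurd (hoff k).2 (not_lt.2 hk)
      subst hi'
      subst hk'
      have hoff' := hoff (dir d e.level)
      have h3 : e.lower.lo (dir d e.level) = e.lo (dir d e.level) := rfl
      have h4 : e.upper.hi (dir d e.level) = e.hi (dir d e.level) := rfl
      rw [h1, h3] at hi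
      rw [h2, h4] at hk
      have hlt := hS.lt he (dir d e.level)
      have hin := hS.inside e he (dir d e.level)
      have hm1 : e.lo (dir d e.level) < e.mid (dir d e.level) := by rw [Elem.mid]; linarith
      have hm2 : e.mid (dir d e.level) < e.hi (dir d e.level) := by rw [Elem.mid]; linarith
      have h5 := hS.localIndex_mono hz (dir d e.level) (Nat.zero_le m) hm
      have h6 := hS.localIndex_mono hz (dir d e.level) hm le_rfl
      have h7 := hS.localIndex_strictMono hz (dir d e.level)
        (Nat.zero_lt_succ (D.p (dir d e.level))) le_rfl
      rw [hmid] at h5 h6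
      have h8 := D.knotAt_lt_of_lt (dir d e.level) h7
        (hS.localIndex_mem_Icc hz _ (Nat.zero_le _)).1 (hS.localIndex_mem_Icc hz _ le_rfl).2
        (by linarith) (by linarith)
      rw [D.anchorKnots_of_le Q z _ (Nat.zero_le _)] at hi hk hoff'
      rw [D.anchorKnots_of_le Q z _ le_rfl] at hi hk hoff'
      -- If the support missed both halves while meeting `e`, its first knot would be at or after
      -- the midpoint and its last at or before it, although the first and last knots differ.
      rcases hi with hi | hi <;> rcases hk with hk | hk <;> linarith [hoff'.1, hoff'.2]
    · exact Or.inr ⟨a, ha, hS.off_or_spans_ne hD hz he hu he hl ha (Or.inr hord)⟩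
  · exact Or.inl ⟨a, ha, hS.off_or_spans_ne hD hz he hl he hu ha (Or.inl hord)⟩

/-- Different parts of elements are distinguished by a blending function. -/
theorem separated (hS : D.Structured S Q) (hD : D.WideNbhds) (he : e ∈ S) (hf : f ∈ S)
    (hu : D.IsPart Q e u) (hv : D.IsPart Q f v) (huv : u ≠ v) : ∃ z ∈ D.anchors Q,
      (∃ a, D.Spans Q z u a ∧ (D.Off Q z v ∨ ∃ b, D.Spans Q z v b ∧ a ≠ b)) ∨
      (∃ a, D.Spans Q z v a ∧ (D.Off Q z u ∨ ∃ b, D.Spans Q z u b ∧ a ≠ b)) := by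
  by_cases hef : e = f
  · subst hef
    rcases hu with ⟨hcut, rfl⟩ | ⟨hcut, hu⟩
    · rcases hv with ⟨-, rfl⟩ | ⟨hcut', -⟩
      · exact absurd rfl huv
      · exact absurd hcut' hcut
    · rcases hv with ⟨hcut', -⟩ | ⟨-, hv⟩
      · exact absurd hcut hcut'
      · obtain ⟨z, hz, h⟩ := hS.separated_halves hD he hcut
        refine ⟨z, hz, ?_⟩
        rcases hu with rfl | rfl <;> rcases hv with rfl | rfl
        · exact absurd rfl huv
        · exact h
        · exact h.symm
        · exact absurd rfl huv
  · have hno : ¬ e.Overlap f := fun h => hef (hS.eq_of_overlap e he f hf h)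
    simp only [Elem.Overlap, not_forall, not_and_or, not_lt] at hno
    obtain ⟨j, hj⟩ := hno
    have hmono := D.knotAt_monotoneOn j
    have hue := hS.part_subset he hu j
    have hvf := hS.part_subset hf hv j
    have hle := (hS.lt he j).le
    have hc : (D.p j + 1) / 2 ≤ D.p j + 1 := by omega
    rcases hj with hj | hj
    -- The face of `e` turned towards `f` carries a vertex whose middle knot in direction `j` lies
    -- on that face, hence between the two parts.
    · have hz := hS.vertex_mem_anchors he (z := e.lo) fun _ => Or.inl rfl
      obtain ⟨a, ha⟩ := hS.exists_spans_of_mid hD hz he hu (hS.lo_localIndex hD he)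
      refine ⟨e.lo, hz, Or.inl ⟨a, ha, hS.off_or_spans_ne hD hz he hu hf hv ha (j := j)
        (m := (D.p j + 1) / 2) (Or.inr ?_)⟩⟩
      rw [D.anchorKnots_of_le Q _ j hc, D.localIndex_half]
      exact ⟨hmono (hS.mem_Icc_of_inside hf (by linarith) (by linarith))
        (hS.mem_Icc_of_inside he le_rfl hle) (by linarith),
        hmono (hS.mem_Icc_of_inside he le_rfl hle)
          (hS.mem_Icc_of_inside he (by linarith) (by linarith)) (by linarith)⟩
    · have hz := hS.vertex_mem_anchors he (z := e.hi) fun _ => Or.inr rfl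
      obtain ⟨a, ha⟩ := hS.exists_spans_of_mid hD hz he hu (hS.hi_localIndex hD he)
      refine ⟨e.hi, hz, Or.inl ⟨a, ha, hS.off_or_spans_ne hD hz he hu hf hv ha (j := j)
        (m := (D.p j + 1) / 2) (Or.inl ?_)⟩⟩
      rw [D.anchorKnots_of_le Q _ j hc, D.localIndex_half]
      exact ⟨hmono (hS.mem_Icc_of_inside he (by linarith) (by linarith))
        (hS.mem_Icc_of_inside he hle le_rfl) (by linarith),
        hmono (hS.mem_Icc_of_inside he hle le_rfl)
          (hS.mem_Icc_of_inside hf (by linarith) (by linarith)) (by linarith)⟩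

end Data.Structured

end TSpline

/-! ### Bézier elements as maximal polynomial regions -/

namespace TSpline

variable {d : ℕ}

/-- The open sets on which the blending functions are polynomials. -/
def Data.IsPolynomialRegion (D : Data d) (Q : Set (Elem d)) (U : Set (Fin d → ℝ)) : Prop :=
  IsOpen U ∧ U ⊆ paramDomain d ∧ ∀ z ∈ D.anchors Q, IsPolynomialOn D.p U (D.blending Q z)

/-- Overlapping regions carry the same polynomials and can be merged, so maximal regions are equal
or disjoint. -/
theorem Data.IsPolynomialRegion.union {D : Data d} {Q : Set (Elem d)} {U V : Set (Fin d → ℝ)}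
    (hU : D.IsPolynomialRegion Q U) (hV : D.IsPolynomialRegion Q V) (h : (U ∩ V).Nonempty) :
    D.IsPolynomialRegion Q (U ∪ V) :=
  ⟨hU.1.union hV.1, Set.union_subset hU.2.1 hV.2.1,
    fun z hz => (hU.2.2 z hz).union hU.1 hV.1 h (hV.2.2 z hz)⟩

theorem Data.isOpen_paramImage (D : Data d) (e : Elem d) : IsOpen (D.paramImage e) :=
  isOpen_set_pi Set.finite_univ fun _ _ => isOpen_Ioo

theorem Data.mem_bezierMesh_iff {D : Data d} {Q : Set (Elem d)} {B : Set (Fin d → ℝ)} :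
    B ∈ D.bezierMesh Q ↔ Maximal (D.IsPolynomialRegion Q) B := Iff.rfl

variable [NeZero d]

/-- The ancestor of level zero is a unit cell, on which the knots are interpolated linearly. -/
theorem Elem.IsCell.exists_natCast_le {e : Elem d} (he : e.IsCell) {j : Fin d} (h0 : 0 ≤ e.lo j) :
    ∃ i : ℕ, (i : ℝ) ≤ e.lo j ∧ e.hi j ≤ i + 1 := by
  obtain ⟨a, ha, hal, hae⟩ := he.exists_ancestor (Nat.zero_le e.level)
  obtain ⟨⟨m, hm⟩, hhi⟩ := ha j
  rw [hal] at hm hhi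
  simp only [sideLength, mul_one] at hm hhi
  have h1 := hae j
  have hlt := he.lo_lt_hi j
  have hm0 : 0 ≤ m := by
    have : (-1 : ℝ) < m := by linarith
    have : (-1 : ℤ) < m := by exact_mod_cast this
    omega
  lift m to ℕ using hm0
  push_cast at hm
  exact ⟨m, by linarith, by linarith⟩

/-- Parametric points without dyadic index coordinates. -/
def Data.ParamGeneric (D : Data d) (x : Fin d → ℝ) : Prop :=
  ∀ j r k, OnGrid k j r → x j ≠ D.knotAt j r

theorem Data.dense_paramGeneric (D : Data d) : Dense {x : Fin d → ℝ | D.ParamGeneric x} := by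
  have : {x : Fin d → ℝ | D.ParamGeneric x} =
      Set.univ.pi fun j => (D.knotAt j '' {r : ℝ | ∃ k, OnGrid k j r})ᶜ := by
    ext x
    simp only [Data.ParamGeneric, Set.mem_ofPred_eq, Set.mem_univ_pi, Set.mem_compl_iff,
      Set.mem_image, not_exists, not_and, ne_eq]
    exact ⟨fun h j r ⟨k, hk⟩ hr => h j r k hk hr.symm, fun h j r k hk hr => h j r ⟨k, hk⟩ hr.symm⟩
  rw [this]
  exact dense_pi _ fun j _ => ((countable_onGrid j).image _).dense_compl ℝ

namespace Data.Structured

variable {D : Data d} {S Q : Set (Elem d)} {e f u v : Elem d}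

theorem paramImage_nonempty (hS : D.Structured S Q) (he : e ∈ S) (hu : D.IsPart Q e u) :
    (D.paramImage u).Nonempty :=
  Set.univ_pi_nonempty_iff.2 fun j => Set.nonempty_Ioo.2 (hS.knotAt_part he hu j).2.2

theorem paramImage_subset (hS : D.Structured S Q) (he : e ∈ S) (hu : D.IsPart Q e u) :
    D.paramImage u ⊆ D.paramImage e := fun _ hx j hj =>
  ⟨(hS.knotAt_part he hu j).1.trans_lt (hx j hj).1,
    (hx j hj).2.trans_le (hS.knotAt_part he hu j).2.1⟩

theorem paramImage_subset_paramDomain (hS : D.Structured S Q) (he : e ∈ S) :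
    D.paramImage e ⊆ paramDomain d := by
  intro x hx j hj
  have h1 := hS.inside e he j
  have h2 := (hS.lt he j).le
  have hp : (0 : ℝ) ≤ D.p j := Nat.cast_nonneg _
  have hpn := D.p_lt_n_real j
  have hm := (D.knotAt_strictMonoOn j).monotoneOn
  have h3 : 0 ≤ D.knotAt j (e.lo j) := by
    rw [← D.knotAt_left j (show (1 : ℝ) ≤ (D.p j : ℝ) + 1 by linarith) le_rfl]
    exact hm ⟨le_rfl, by linarith⟩ ⟨h1.1, by linarith⟩ h1.1
  have h4 : D.knotAt j (e.hi j) ≤ 1 := by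
    rw [← D.knotAt_right j (le_refl ((D.n j : ℝ) + 1)) (by linarith)]
    exact hm ⟨by linarith, h1.2⟩ ⟨by linarith, le_rfl⟩ h1.2
  exact ⟨h3.trans_lt (hx j hj).1, (hx j hj).2.trans_le h4⟩

theorem closure_paramImage_part (hS : D.Structured S Q) (he : e ∈ S) (hu : D.IsPart Q e u) :
    closure (D.paramImage u) =
      Set.univ.pi fun j => Set.Icc (D.knotAt j (u.lo j)) (D.knotAt j (u.hi j)) := by
  rw [Data.paramImage, closure_pi_set]
  congr 1
  funext j
  exact closure_Ioo (hS.knotAt_part he hu j).2.2.ne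

theorem interior_closure_paramImage_part (hS : D.Structured S Q) (he : e ∈ S)
    (hu : D.IsPart Q e u) : interior (closure (D.paramImage u)) = D.paramImage u := by
  rw [hS.closure_paramImage_part he hu, interior_pi_set Set.finite_univ]
  simp only [interior_Icc]
  rfl

theorem isPolynomialRegion_part (hS : D.Structured S Q) (hD : D.WideNbhds) (he : e ∈ S)
    (hu : D.IsPart Q e u) : D.IsPolynomialRegion Q (D.paramImage u) :=
  ⟨D.isOpen_paramImage u,
    (hS.paramImage_subset he hu).trans (hS.paramImage_subset_paramDomain he),
    fun _ hz => hS.isPolynomialOn_part hD hz he hu⟩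

theorem exists_part_mem (hS : D.Structured S Q) (he : e ∈ S) {y : Fin d → ℝ}
    (hgen : D.ParamGeneric y) (hy : y ∈ D.paramImage e) :
    ∃ u, D.IsPart Q e u ∧ y ∈ D.paramImage u := by
  by_cases hcut : D.IsCut Q e
  · rcases lt_or_gt_of_ne (hgen _ _ _ (hS.isCell e he).onGrid_mid) with h | h
    · refine ⟨e.lower, Or.inr ⟨hcut, Or.inl rfl⟩, fun j hj => ?_⟩
      by_cases hjd : j = dir d e.level
      · subst hjd
        simpa [Elem.lower] using ⟨(hy _ hj).1, h⟩
      · simpa [Elem.lower, hjd] using hy j hj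
    · refine ⟨e.upper, Or.inr ⟨hcut, Or.inr rfl⟩, fun j hj => ?_⟩
      by_cases hjd : j = dir d e.level
      · subst hjd
        simpa [Elem.upper] using ⟨h, (hy _ hj).2⟩
      · simpa [Elem.upper, hjd] using hy j hj
  · exact ⟨e, Or.inl ⟨hcut, rfl⟩, hy⟩

theorem exists_elem_mem (hS : D.Structured S Q) {y : Fin d → ℝ} (hgen : D.ParamGeneric y)
    (hy : y ∈ paramDomain d) : ∃ e ∈ S, y ∈ D.paramImage e := by
  have : ∀ j, ∃ w ∈ Set.Ioo ((D.p j : ℝ) + 1) ((D.n j : ℝ) + 1), D.knotAt j w = y j := fun j =>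
    D.exists_knotAt_eq j (hy j trivial).1 (hy j trivial).2
  choose w hw hwy using this
  obtain ⟨e, he, hwe⟩ := hS.cover w (fun j _ => hw j)
    fun j k hk => hgen j (w j) k hk (hwy j).symm
  refine ⟨e, he, fun j hj => ?_⟩
  have h1 := hS.inside e he j
  have h2 := hwe j hj
  have hlt := hS.lt he j
  have hm := D.knotAt_strictMonoOn j
  rw [← hwy j]
  exact ⟨hm ⟨h1.1, by linarith⟩ ⟨(hw j).1.le, (hw j).2.le⟩ h2.1,
    hm ⟨(hw j).1.le, (hw j).2.le⟩ ⟨by linarith, h1.2⟩ h2.2⟩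

/-- The parts of the elements are Bézier elements. -/
theorem part_mem_bezierMesh (hS : D.Structured S Q) (hD : D.WideNbhds) (he : e ∈ S)
    (hu : D.IsPart Q e u) : D.paramImage u ∈ D.bezierMesh Q := by
  refine ⟨hS.isPolynomialRegion_part hD he hu, fun V hV hsub => ?_⟩
  change D.paramImage u ⊆ V at hsub
  by_contra hnot
  -- An open box is the interior of its closure, so an open set that is not contained in the part
  -- must leave its closure. It then has a generic point there, which belongs to another part.
  have hne : (V ∩ (closure (D.paramImage u))ᶜ).Nonempty := by
    by_contra hempty
    rw [Set.not_nonempty_iff_eq_empty, ← Set.sdiff_eq, Set.sdiff_eq_empty] at hempty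
    refine hnot ?_
    have := interior_maximal hempty hV.1
    rwa [hS.interior_closure_paramImage_part he hu] at this
  obtain ⟨y, ⟨hyV, hyu⟩, hgen⟩ := D.dense_paramGeneric.inter_open_nonempty _
    (hV.1.inter isClosed_closure.isOpen_compl) hne
  obtain ⟨f, hf, hyf⟩ := hS.exists_elem_mem hgen (hV.2.1 hyV)
  obtain ⟨v, hv, hyv⟩ := hS.exists_part_mem hf hgen hyf
  have huv : u ≠ v := by
    rintro rfl
    exact hyu (subset_closure hyv)
  obtain ⟨x, hx⟩ := hS.paramImage_nonempty he hu
  obtain ⟨z, hz, ⟨a, ha, h⟩ | ⟨a, ha, h⟩⟩ := hS.separated hD he hf hu hv huv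
  · exact hS.not_isPolynomialOn_blending hz hV.1 (hsub hx) hyV hx hyv ha h (hV.2.2 z hz)
  · exact hS.not_isPolynomialOn_blending hz hV.1 hyV (hsub hx) hyv hx ha h (hV.2.2 z hz)

/-- The Bézier elements which meet an element are its parts. -/
theorem bezierElementsMeeting_eq (hS : D.Structured S Q) (hD : D.WideNbhds) (he : e ∈ S) :
    D.bezierElementsMeeting Q (D.paramImage e) = {B | ∃ u, D.IsPart Q e u ∧ B = D.paramImage u} := by
  ext B
  constructor
  · rintro ⟨hB, hmeet⟩
    have hB := Data.mem_bezierMesh_iff.1 hB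
    obtain ⟨y, ⟨hyB, hye⟩, hgen⟩ := D.dense_paramGeneric.inter_open_nonempty _
      (hB.prop.1.inter (D.isOpen_paramImage e)) hmeet
    obtain ⟨u, hu, hyu⟩ := hS.exists_part_mem he hgen hye
    refine ⟨u, hu, ?_⟩
    -- The Bézier element and the part share a generic point. Both are maximal, so each equals their
    -- union.
    have hunion := Data.IsPolynomialRegion.union hB.prop (hS.isPolynomialRegion_part hD he hu)
      ⟨y, hyB, hyu⟩
    have h1 := hB.eq_of_subset hunion Set.subset_union_left
    have h2 := (Data.mem_bezierMesh_iff.1 (hS.part_mem_bezierMesh hD he hu)).eq_of_subset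
      hunion Set.subset_union_right
    exact h1.trans h2.symm
  · rintro ⟨u, hu, rfl⟩
    refine ⟨hS.part_mem_bezierMesh hD he hu, ?_⟩
    rw [Set.inter_eq_left.2 (hS.paramImage_subset he hu)]
    exact hS.paramImage_nonempty he hu

theorem knotAt_mid (hS : D.Structured S Q) (he : e ∈ S) (j : Fin d) :
    D.knotAt j (e.mid j) = (D.knotAt j (e.lo j) + D.knotAt j (e.hi j)) / 2 := by
  have hp : (0 : ℝ) ≤ D.p j := Nat.cast_nonneg _
  obtain ⟨i, hi1, hi2⟩ := (hS.isCell e he).exists_natCast_le (j := j)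
    (by linarith [(hS.inside e he j).1])
  exact D.knotAt_midpoint j hi1 (hS.lt he j).le hi2

/-- Only the factor of the bisected direction changes, and the knot at the midpoint halves it
exactly. -/
theorem volume_half (hS : D.Structured S Q) (he : e ∈ S) (hu : e.IsHalf u) :
    volume (D.paramImage u) = volume (D.paramImage e) / 2 := by
  have hmid := hS.knotAt_mid he (dir d e.level)
  have hhalf : D.knotAt (dir d e.level) (u.hi (dir d e.level)) -
      D.knotAt (dir d e.level) (u.lo (dir d e.level)) =
      (D.knotAt (dir d e.level) (e.hi (dir d e.level)) -
        D.knotAt (dir d e.level) (e.lo (dir d e.level))) / 2 := by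
    rcases hu with rfl | rfl
    · simp only [Elem.lower, Function.update_self, hmid]
      ring
    · simp only [Elem.upper, Function.update_self, hmid]
      ring
  have hother : ∏ j ∈ Finset.univ.erase (dir d e.level),
      ENNReal.ofReal (D.knotAt j (u.hi j) - D.knotAt j (u.lo j)) =
      ∏ j ∈ Finset.univ.erase (dir d e.level),
        ENNReal.ofReal (D.knotAt j (e.hi j) - D.knotAt j (e.lo j)) := by
    refine Finset.prod_congr rfl fun j hj => ?_
    obtain ⟨h1, h2⟩ := hu.side_of_ne (Finset.ne_of_mem_erase hj)
    rw [h1, h2]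
  rw [Data.paramImage, Data.paramImage, Real.volume_pi_Ioo, Real.volume_pi_Ioo,
    ← Finset.prod_erase_mul _ _ (Finset.mem_univ (dir d e.level)), hother, hhalf,
    ENNReal.ofReal_div_of_pos two_pos, ENNReal.ofReal_ofNat, ← mul_div_assoc,
    Finset.prod_erase_mul _ _ (Finset.mem_univ (dir d e.level))]

theorem disjoint_halves (e : Elem d) : Disjoint (D.paramImage e.lower) (D.paramImage e.upper) := by
  rw [Set.disjoint_left]
  intro x h1 h2
  have h3 := (h1 (dir d e.level) trivial).2
  have h4 := (h2 (dir d e.level) trivial).1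
  simp only [Elem.lower, Elem.upper, Function.update_self] at h3 h4
  linarith

theorem closure_halves (hS : D.Structured S Q) (he : e ∈ S) (hcut : D.IsCut Q e) :
    closure (D.paramImage e.lower ∪ D.paramImage e.upper) = closure (D.paramImage e) := by
  have hl : D.IsPart Q e e.lower := Or.inr ⟨hcut, Or.inl rfl⟩
  have hu : D.IsPart Q e e.upper := Or.inr ⟨hcut, Or.inr rfl⟩
  refine (closure_mono (Set.union_subset (hS.paramImage_subset he hl)
    (hS.paramImage_subset he hu))).antisymm ?_
  have he' : closure (D.paramImage e) =
      Set.univ.pi fun j => Set.Icc (D.knotAt j (e.lo j)) (D.knotAt j (e.hi j)) := by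
    rw [Data.paramImage, closure_pi_set]
    congr 1
    funext j
    exact closure_Ioo (D.knotAt_lt_knotAt (hS.inside e he) (hS.lt he j)).ne
  rw [closure_union, hS.closure_paramImage_part he hl, hS.closure_paramImage_part he hu, he']
  intro x hx
  rcases le_total (x (dir d e.level)) (D.knotAt (dir d e.level) (e.mid (dir d e.level)))
    with h | h
  · refine Or.inl fun j hj => ?_
    by_cases hjd : j = dir d e.level
    · subst hjd
      simpa [Elem.lower] using ⟨(hx _ hj).1, h⟩
    · simpa [Elem.lower, hjd] using hx j hj
  · refine Or.inr fun j hj => ?_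
    by_cases hjd : j = dir d e.level
    · subst hjd
      simpa [Elem.upper] using ⟨h, (hx _ hj).2⟩
    · simpa [Elem.upper, hjd] using hx j hj

end Data.Structured

end TSpline

theorem lemma4p22 {d : ℕ} [NeZero d] (hd : d = 2 ∨ d = 3) (D : TSpline.Data d)
    (Q : Set (TSpline.Elem d)) (hQ : D.IsAdmissible Q)
    (E : Set (Fin d → ℝ)) (hE : E ∈ D.paramMesh Q) :
    D.bezierElementsMeeting Q E = {E} ∨
      ∃ B₁ B₂ : Set (Fin d → ℝ),
        B₁ ≠ B₂ ∧ D.bezierElementsMeeting Q E = {B₁, B₂} ∧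
        B₁ ⊆ E ∧ B₂ ⊆ E ∧ Disjoint B₁ B₂ ∧ closure (B₁ ∪ B₂) = closure E ∧
        MeasureTheory.volume B₁ = MeasureTheory.volume E / 2 ∧
        MeasureTheory.volume B₂ = MeasureTheory.volume E / 2 := by
  have hD := D.wideNbhds hd
  obtain ⟨S, hS⟩ := hQ.exists_structured hD
  obtain ⟨hvol, e, heQ, rfl⟩ := hE
  have he := hS.mem_of_volume_ne_zero heQ hvol
  rw [hS.bezierElementsMeeting_eq hD he]
  by_cases hcut : D.IsCut Q e
  · right
    have hl : D.IsPart Q e e.lower := Or.inr ⟨hcut, Or.inl rfl⟩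
    have hu : D.IsPart Q e e.upper := Or.inr ⟨hcut, Or.inr rfl⟩
    have hdisj := TSpline.Data.Structured.disjoint_halves (D := D) e
    refine ⟨D.paramImage e.lower, D.paramImage e.upper,
      hdisj.ne (hS.paramImage_nonempty he hl).ne_empty, ?_, hS.paramImage_subset he hl,
      hS.paramImage_subset he hu, hdisj, hS.closure_halves he hcut,
      hS.volume_half he (Or.inl rfl), hS.volume_half he (Or.inr rfl)⟩
    ext B
    constructor
    · rintro ⟨u, ⟨hno, -⟩ | ⟨-, rfl | rfl⟩, rfl⟩
      · exact absurd hcut hno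
      · exact Or.inl rfl
      · exact Or.inr rfl
    · rintro (rfl | rfl)
      · exact ⟨_, hl, rfl⟩
      · exact ⟨_, hu, rfl⟩
  · left
    ext B
    constructor
    · rintro ⟨u, ⟨-, rfl⟩ | ⟨hcut', -⟩, rfl⟩
      · rfl
      · exact absurd hcut' hcut
    · rintro rfl
      exact ⟨e, Or.inl ⟨hcut, rfl⟩, rfl⟩
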